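/- Let $K$ be a field with separable closure $\overline K$ and $G_K=\mathrm{Gal}(\overline K/K)$, let $E/K$ be an elliptic curve and let $n\ge 2$ be an integer not divisible by the characteristic of $K$. Write $E[n]$ for the $n$-torsion of $E(\overline K)$, and put $R=\mathrm{Map}_K(E[n],\overline K)$ (the Galois equivariant maps) and $\overline R=R\otimes_K\overline K=\mathrm{Map}(E[n],\overline K)$, so that $\mu_n(\overline R)=\mathrm{Map}(E[n],\mu_n)$. Let $\partial:\overline R^\times\to(\overline R\otimes\overline R)^\times=\mathrm{Map}(E[n]\times E[n],\overline K^\times)$ be given by $(\partial\alpha)(T_1,T_2)=\alpha(T_1)\alpha(T_2)/\alpha(T_1+T_2)$. Let $w:E[n]\to\mu_n(\overline R)$ be the Galois equivariant homomorphism $w(S)(T)=e_n(S,T)$, where $e_n$ is the Weil pairing, and let $w_1:H^1(K,E[n])\to R^\times/(R^\times)^n$ be the composite of $w_*:H^1(K,E[n])\to H^1(K,\mu_n(\overline R))$ with the Kummer isomorphism $H^1(K,\mu_n(\overline R))\cong R^\times/(R^\times)^n$, under which the class of $\sigma\mapsto\sigma(\beta)/\beta$ (for $\beta\in\overline R^\times$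 with $\beta^n\in R^\times$) corresponds to the class of $\beta^n$. Finally let $\Gamma$ be the group of all maps $\gamma:E[n]\to\mu_n$ with $$\frac{\gamma(\sigma T_1)\gamma(\sigma T_2)}{\gamma(\sigma(T_1+T_2))}=\sigma\left(\frac{\gamma(T_1)\gamma(T_2)}{\gamma(T_1+T_2)}\right)\qquad\text{for all }\sigma\in G_K,\ T_1,T_2\in E[n].$$ Then $\partial(\mu_n(R))\subseteq(\partial\mu_n(\overline R))^{G_K}=\partial\Gamma$, and $$\ker(w_1)\;\cong\;(\partial\mu_n(\overline R))^{G_K}/\partial(\mu_n(R))=\partial\Gamma/\partial(\mu_n(R)).$$ In particular, $w_1$ is injective if and only if $\partial\Gamma=\partial(\mu_n(R))$. -/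

import Mathlib

open scoped nonZeroDivisors

noncomputable section

namespace Descent

section Cohomology

variable (G M : Type*) [Group G] [TopologicalSpace G] [AddCommGroup M] [TopologicalSpace M]
  [IsTopologicalAddGroup M] [DistribMulAction G M]

/-- Continuous 1-cocycles. -/
def Z1 : AddSubgroup (G → M) where
  carrier := {c | Continuous c ∧ ∀ σ τ, c (σ * τ) = c σ + σ • c τ}
  zero_mem' := ⟨continuous_const, by simp⟩
  add_mem' := by
    rintro a b ⟨ha, ha'⟩ ⟨hb, hb'⟩
    refine ⟨ha.add hb, fun σ τ => ?_⟩
    simp only [Pi.add_apply, ha', hb', smul_add]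
    abel
  neg_mem' := by
    rintro a ⟨ha, ha'⟩
    refine ⟨ha.neg, fun σ τ => ?_⟩
    simp only [Pi.neg_apply, ha', smul_neg]
    abel

/-- The 1-coboundaries among them. -/
def B1 : AddSubgroup (Z1 G M) where
  carrier := {c | ∃ m : M, ∀ σ, c.1 σ = σ • m - m}
  zero_mem' := ⟨0, by simp⟩
  add_mem' := by
    rintro a b ⟨m, hm⟩ ⟨m', hm'⟩
    refine ⟨m + m', fun σ => ?_⟩
    simp only [AddSubgroup.coe_add, Pi.add_apply, hm, hm', smul_add]
    abel
  neg_mem' := by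
    rintro a ⟨m, hm⟩
    refine ⟨-m, fun σ => ?_⟩
    simp only [AddSubgroup.coe_neg, Pi.neg_apply, hm, smul_neg]
    abel

/-- The first continuous cohomology group. -/
def H1 : Type _ := Z1 G M ⧸ B1 G M

instance : AddCommGroup (H1 G M) := inferInstanceAs (AddCommGroup (Z1 G M ⧸ B1 G M))

/-- The class of a cocycle. -/
def H1.mk : Z1 G M →+ H1 G M := QuotientAddGroup.mk' _

variable {G M}
variable {N : Type*} [AddCommGroup N] [TopologicalSpace N] [IsTopologicalAddGroup N]
  [DistribMulAction G N]

/-- The map on cocycles induced by an equivariant homomorphism. -/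
def Z1.map (f : M →+[G] N) (hf : Continuous f) : Z1 G M →+ Z1 G N where
  toFun c := ⟨fun σ => f (c.1 σ), hf.comp c.2.1, fun σ τ => by
    change f (c.1 (σ * τ)) = f (c.1 σ) + σ • f (c.1 τ)
    rw [c.2.2, map_add, map_smul]⟩
  map_zero' := by ext σ; simp
  map_add' a b := by ext σ; simp

/-- The map on `H¹` induced by an equivariant homomorphism. -/
def H1.map (f : M →+[G] N) (hf : Continuous f) : H1 G M →+ H1 G N :=
  QuotientAddGroup.map _ _ (Z1.map f hf) (by
    rintro c ⟨m, hm⟩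
    exact ⟨f m, fun σ => by simp [Z1.map, hm, map_sub, map_smul]⟩)

end Cohomology

section Maps

/-- The ring of all maps `X → A` under pointwise operations. For `X = E[n]` and `A = K̄` this is
`R̄ = R ⊗ K̄`, the étale algebra of `E[n]` over `K̄`; for `X = E[n] × E[n]` it is `R̄ ⊗ R̄`. -/
def Maps (X A : Type*) := X → A

variable {G X A : Type*} [Group G] [MulAction G X]

instance [CommRing A] : CommRing (Maps X A) := inferInstanceAs (CommRing (X → A))

instance {K : Type*} [CommSemiring K] [CommRing A] [Algebra K A] : Algebra K (Maps X A) :=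
  inferInstanceAs (Algebra K (X → A))

/-- The Galois action on maps: `(σα)(T) = σ(α(σ⁻¹T))`. -/
instance [CommRing A] [MulSemiringAction G A] : MulSemiringAction G (Maps X A) where
  smul σ α := fun T => σ • α (σ⁻¹ • T)
  one_smul α := by funext T; change (1 : G) • α ((1 : G)⁻¹ • T) = α T; simp
  mul_smul σ τ α := by
    funext T
    change (σ * τ) • α ((σ * τ)⁻¹ • T) = σ • (τ • α (τ⁻¹ • (σ⁻¹ • T)))
    simp [mul_smul]
  smul_zero σ := by funext T; exact smul_zero σ
  smul_add σ α β := by funext T; exact smul_add σ _ _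
  smul_one σ := by funext T; exact smul_one σ
  smul_mul σ α β := by funext T; exact smul_mul' σ _ _

/-- The product of the discrete topologies (discrete when `X` is finite, as is the case for the
`n`-torsion of an elliptic curve). -/
instance : TopologicalSpace (Maps X A) := @Pi.topologicalSpace X (fun _ => A) (fun _ => ⊥)

instance [CommRing A] : ContinuousMul (Maps X A) := by
  let _ : TopologicalSpace A := ⊥
  have : DiscreteTopology A := ⟨rfl⟩
  exact inferInstanceAs (ContinuousMul (X → A))

instance [CommRing A] [MulSemiringAction G A] : MulDistribMulAction G (Maps X A)ˣ :=
  Units.mulDistribMulActionRight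

instance [CommRing A] [MulSemiringAction G A] (n : ℕ) :
    MulDistribMulAction G (rootsOfUnity n (Maps X A)) where
  smul σ ζ := ⟨σ • ζ.1, by
    have h := ζ.2
    rw [mem_rootsOfUnity] at h ⊢
    rw [← smul_pow', h, smul_one]⟩
  one_smul ζ := Subtype.ext (one_smul G ζ.1)
  mul_smul σ τ ζ := Subtype.ext (mul_smul σ τ ζ.1)
  smul_mul σ ζ ξ := Subtype.ext (smul_mul' σ ζ.1 ξ.1)
  smul_one σ := Subtype.ext (smul_one σ)

end Maps

instance {G M : Type*} [Group G] [CommGroup M] [MulDistribMulAction G M] :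
    DistribMulAction G (Additive M) where
  smul σ m := Additive.ofMul (σ • m.toMul)
  one_smul m := one_smul G m.toMul
  mul_smul σ τ m := mul_smul σ τ m.toMul
  smul_zero σ := congrArg Additive.ofMul (smul_one σ : σ • (1 : M) = 1)
  smul_add σ m m' := smul_mul' σ m.toMul m'.toMul



section H90
variable {K L : Type*} [Field K] [Field L] [Algebra K L]

/-- Hilbert's Theorem 90 for a subgroup of the Galois group and a locally constant cocycle. -/
lemma hilbert90_sub (H : Subgroup Gal(L/K)) (d : H → Lˣ)
    (hd : ∀ σ τ : H, (d (σ * τ) : L) = d σ * σ.1 (d τ))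
    (hc : ∃ E : IntermediateField K L, FiniteDimensional K E ∧
      ∀ u : H, u.1 ∈ E.fixingSubgroup → d u = 1) :
    ∃ b : Lˣ, ∀ σ : H, σ.1 (b : L) = d σ * b := by
  classical
  obtain ⟨E, hE, hE1⟩ := hc
  let r : H → (E →ₐ[K] L) := fun σ => (σ.1 : L →ₐ[K] L).comp E.val
  have hr : ∀ σ τ : H, r σ = r τ → d σ = d τ := by
    intro σ τ h
    have h1 : (σ⁻¹ * τ).1 ∈ E.fixingSubgroup := by
      rw [IntermediateField.mem_fixingSubgroup_iff]
      intro x hx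
      have := DFunLike.congr_fun h ⟨x, hx⟩
      change σ.1 x = τ.1 x at this
      change σ.1⁻¹ (τ.1 x) = x
      rw [← this]
      exact σ.1.symm_apply_apply x
    have h2 := hd σ (σ⁻¹ * τ)
    rw [mul_inv_cancel_left, hE1 _ h1] at h2
    ext
    simpa using h2.symm
  let I := Set.range r
  have : Finite I := Finite.of_injective (fun x : I => (x : E →ₐ[K] L)) Subtype.val_injective
  have := Fintype.ofFinite I
  choose s hs using fun x : I => x.2
  have hlin : LinearIndependent L (fun x : I => ((x.1 : E →ₐ[K] L) : E → L)) :=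
    (linearIndependent_monoidHom E L).comp (fun x : I => ((x.1 : E →ₐ[K] L) : E →* L))
      (fun x y h => Subtype.ext (by ext z; exact DFunLike.congr_fun h z))
  obtain ⟨θ, hθ⟩ : ∃ θ : E, ∑ x : I, (d (s x) : L) * x.1 θ ≠ 0 := by
    by_contra! hcon
    have := Fintype.linearIndependent_iff.1 hlin (fun x => (d (s x) : L)) (by
      funext θ; simpa using hcon θ) ⟨r 1, 1, rfl⟩
    exact (d _).ne_zero this
  refine ⟨(Units.mk0 _ hθ)⁻¹, fun τ => ?_⟩
  let e : I → I := fun x => ⟨r (τ * s x), τ * s x, rfl⟩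
  have he : ∀ x : I, (e x).1 = (τ.1 : L →ₐ[K] L).comp x.1 := by
    intro x
    conv_rhs => rw [← hs x]
    rfl
  have hinj : Function.Injective e := by
    intro x y hxy
    have h1 := congrArg Subtype.val hxy
    rw [he, he] at h1
    apply Subtype.ext
    ext z
    exact τ.1.injective (DFunLike.congr_fun h1 z)
  have hbij : Function.Bijective e := Finite.injective_iff_bijective.1 hinj
  have key : (d τ : L) * τ.1 (∑ x : I, (d (s x) : L) * x.1 θ) = ∑ x : I, (d (s x) : L) * x.1 θ := by
    rw [map_sum, Finset.mul_sum]
    refine Fintype.sum_bijective e hbij _ _ fun x => ?_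
    have h1 : d (s (e x)) = d (τ * s x) := hr _ _ (hs (e x))
    rw [h1, hd, map_mul, he]
    simp [mul_assoc]
  have h2 : τ.1 (∑ x : I, (d (s x) : L) * x.1 θ) ≠ 0 := (map_ne_zero _).2 hθ
  rw [Units.val_inv_eq_inv_val, Units.val_mk0, map_inv₀, ← div_eq_mul_inv, eq_div_iff hθ,
    inv_mul_eq_iff_eq_mul₀ h2, mul_comm, key]

variable {X : Type*} [MulAction Gal(L/K) X]

lemma smul_units_apply (σ : Gal(L/K)) (β : (Maps X L)ˣ) (T : X) :
    (σ • β).1 T = σ (β.1 (σ⁻¹ • T)) := rfl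

lemma unit_apply_ne_zero (β : (Maps X L)ˣ) (T : X) : β.1 T ≠ 0 := by
  intro h
  have := congrFun β.mul_inv T
  change β.1 T * _ = (1 : L) at this
  rw [h, zero_mul] at this
  exact zero_ne_one this

lemma coe_units_inv_apply (β : (Maps X L)ˣ) (T : X) : (β⁻¹).1 T = (β.1 T)⁻¹ := by
  have := congrFun β.mul_inv T
  change β.1 T * _ = (1 : L) at this
  exact eq_inv_of_mul_eq_one_right this

lemma coe_units_div_apply (β γ : (Maps X L)ˣ) (T : X) : (β / γ).1 T = β.1 T / γ.1 T := by
  rw [div_eq_mul_inv, div_eq_mul_inv, ← coe_units_inv_apply]; rfl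

/-- The unit given by a map without zeros. -/
def Maps.mkUnit (f : X → L) (hf : ∀ T, f T ≠ 0) : (Maps X L)ˣ where
  val := f
  inv := fun T => (f T)⁻¹
  val_inv := funext fun T => mul_inv_cancel₀ (hf T)
  inv_val := funext fun T => inv_mul_cancel₀ (hf T)

lemma continuous_maps_iff {X L Y : Type*} [TopologicalSpace Y] (f : Y → Maps X L) :
    Continuous f ↔ ∀ T, IsLocallyConstant fun y => f y T := by
  let _ : TopologicalSpace L := ⊥
  have : DiscreteTopology L := ⟨rfl⟩
  simp_rw [IsLocallyConstant.iff_continuous]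
  exact continuous_pi_iff

/-- Hilbert's Theorem 90 for `R̄ˣ`. -/
theorem hilbert90 (c : Gal(L/K) → (Maps X L)ˣ) (hc : Continuous c)
    (hcoc : ∀ σ τ, c (σ * τ) = c σ * σ • c τ) :
    ∃ β : (Maps X L)ˣ, ∀ σ, c σ = σ • β / β := by
  have hcont : ∀ T, IsLocallyConstant fun σ => (c σ).1 T :=
    (continuous_maps_iff _).1 (Units.continuous_val.comp hc)
  have hc1 : c 1 = 1 := by
    have := hcoc 1 1
    rw [one_smul, mul_one] at this
    exact (left_eq_mul.1 this)
  have hcoc' : ∀ σ τ T, (c (σ * τ)).1 T = (c σ).1 T * σ ((c τ).1 (σ⁻¹ • T)) := by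
    intro σ τ T; rw [hcoc]; rfl
  have step : ∀ T0 : X, ∃ b : Lˣ, ∀ σ : Gal(L/K), σ • T0 = T0 →
      σ (b : L) = (c σ).1 T0 * b := by
    intro T0
    obtain ⟨b, hb⟩ := hilbert90_sub (MulAction.stabilizer Gal(L/K) T0)
      (fun σ => Units.mk0 ((c σ.1).1 T0) (unit_apply_ne_zero _ _)) (by
        intro σ τ
        have : σ.1⁻¹ • T0 = T0 := by
          rw [inv_smul_eq_iff]; exact σ.2.symm
        simp only [Units.val_mk0, Subgroup.coe_mul, hcoc', this]) (by
        have h := (krullTopology_mem_nhds_one_iff K L {σ | (c σ).1 T0 = 1}).1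
          (((hcont T0).isOpen_fiber 1).mem_nhds (by
            change (c 1).1 T0 = 1; rw [hc1]; rfl))
        obtain ⟨E, hE, hE1⟩ := h
        refine ⟨E, hE, fun u hu => Units.ext ?_⟩
        exact hE1 hu)
    exact ⟨b, fun σ hσ => hb ⟨σ, hσ⟩⟩
  choose b hb using step
  let rep : X → X := fun T => (Quotient.out (Quotient.mk (MulAction.orbitRel Gal(L/K) X) T))
  have hrep : ∀ T, ∃ τ : Gal(L/K), τ • rep T = T := by
    intro T
    have : (MulAction.orbitRel Gal(L/K) X) (rep T) T := Quotient.mk_out T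
    exact (MulAction.orbitRel Gal(L/K) X).symm this
  have hrep' : ∀ (σ : Gal(L/K)) T, rep (σ • T) = rep T := by
    intro σ T
    have : Quotient.mk (MulAction.orbitRel Gal(L/K) X) (σ • T) =
      Quotient.mk (MulAction.orbitRel Gal(L/K) X) T := Quotient.sound ⟨σ, rfl⟩
    simp only [rep, this]
  choose t ht using hrep
  refine ⟨Maps.mkUnit (fun T => t T (b (rep T)) / (c (t T)).1 T) (fun T => by
    simp [unit_apply_ne_zero]), fun σ => Units.ext (funext fun T => ?_)⟩
  rw [coe_units_div_apply, smul_units_apply]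
  change _ = σ (t (σ⁻¹ • T) (b (rep (σ⁻¹ • T))) / (c (t (σ⁻¹ • T))).1 (σ⁻¹ • T)) /
    (t T (b (rep T)) / (c (t T)).1 T)
  rw [hrep', map_div₀]
  set T0 := rep T with hT0
  set t' := t (σ⁻¹ • T) with ht'
  have e1 : t' • T0 = σ⁻¹ • T := by
    have := ht (σ⁻¹ • T); rwa [hrep'] at this
  set h := (t T)⁻¹ * (σ * t') with hh
  have hst : σ * t' = t T * h := by rw [hh, mul_inv_cancel_left]
  have hstab : h • T0 = T0 := by
    rw [hh, mul_smul, mul_smul, e1, smul_inv_smul, inv_smul_eq_iff, ht]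
  have e2 : σ (t' (b T0)) = t T ((c h).1 T0) * t T (b T0) := by
    change (σ * t') (b T0 : L) = _
    rw [hst, ← map_mul, ← hb T0 h hstab]
    rfl
  have e3 := hcoc' σ t' T
  have e4 := hcoc' (t T) h T
  rw [← hst] at e4
  have e5 : (t T)⁻¹ • T = T0 := by rw [inv_smul_eq_iff, ht]
  rw [e5] at e4
  rw [e4] at e3
  rw [e2]
  have n1 : (c (t T)).1 T ≠ 0 := unit_apply_ne_zero _ _
  have n2 : (t T) (b T0 : L) ≠ 0 := by simp
  have n3 : σ ((c t').1 (σ⁻¹ • T)) ≠ 0 := by simp [unit_apply_ne_zero]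
  field_simp
  linear_combination -e3

end H90

section Kummer

/-- Two surjections with the same kernel have isomorphic targets. -/
def isoOfKerEq {A B C : Type*} [AddCommGroup A] [AddCommGroup B] [AddCommGroup C]
    (f : A →+ B) (g : A →+ C) (hf : Function.Surjective f) (hg : Function.Surjective g)
    (h : f.ker = g.ker) : B ≃+ C :=
  ((QuotientAddGroup.quotientKerEquivOfSurjective f hf).symm.trans
    (QuotientAddGroup.quotientAddEquivOfEq h)).trans
    (QuotientAddGroup.quotientKerEquivOfSurjective g hg)

theorem isoOfKerEq_apply {A B C : Type*} [AddCommGroup A] [AddCommGroup B] [AddCommGroup C]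
    (f : A →+ B) (g : A →+ C) (hf : Function.Surjective f) (hg : Function.Surjective g)
    (h : f.ker = g.ker) (a : A) : isoOfKerEq f g hf hg h (f a) = g a := by
  have : (QuotientAddGroup.quotientKerEquivOfSurjective f hf).symm (f a) =
      QuotientAddGroup.mk a := by
    rw [AddEquiv.symm_apply_eq]; rfl
  simp only [isoOfKerEq, AddEquiv.trans_apply, this]
  rfl

variable (K X L : Type*) [Field K] [Field L] [Algebra K L] [MulAction Gal(L/K) X] (n : ℕ)

/-- The algebra `R = Map_K(X, L)` of Galois equivariant maps. -/
def EqMaps : Subalgebra K (Maps X L) where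
  carrier := {α | ∀ (σ : Gal(L/K)) (T : X), α (σ • T) = σ (α T)}
  mul_mem' {α β} ha hb σ T := by
    change α (σ • T) * β (σ • T) = σ (α T * β T)
    rw [ha, hb, map_mul]
  add_mem' {α β} ha hb σ T := by
    change α (σ • T) + β (σ • T) = σ (α T + β T)
    rw [ha, hb, map_add]
  algebraMap_mem' a σ T := (σ.commutes a).symm

instance : CommRing (EqMaps K X L) := (EqMaps K X L).toCommRing

/-- `Rˣ/(Rˣ)ⁿ`. -/
def UnitsModPow : Type _ := (EqMaps K X L)ˣ ⧸ (powMonoidHom n : (EqMaps K X L)ˣ →* _).range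

instance : CommGroup (UnitsModPow K X L n) :=
  inferInstanceAs (CommGroup ((EqMaps K X L)ˣ ⧸ (powMonoidHom n : (EqMaps K X L)ˣ →* _).range))

/-- The class of a unit of `R`. -/
def UnitsModPow.mk : (EqMaps K X L)ˣ →* UnitsModPow K X L n := QuotientGroup.mk' _

/-- The group of those `β ∈ R̄ˣ` for which `βⁿ` is Galois invariant, i.e. lies in `Rˣ`. -/
def NthRootGroup : Subgroup (Maps X L)ˣ where
  carrier := {β | ∀ σ : Gal(L/K), σ • β ^ n = β ^ n}
  one_mem' σ := by rw [one_pow, smul_one]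
  mul_mem' {β γ} hb hc σ := by rw [mul_pow, smul_mul', hb, hc]
  inv_mem' {β} hb σ := by rw [inv_pow, smul_inv', hb]

variable {K X L n}

lemma mem_eqMaps_of_smul_eq (u : (Maps X L)ˣ) (h : ∀ σ : Gal(L/K), σ • u = u) :
    u.1 ∈ EqMaps K X L := by
  intro σ T
  have := congrFun (congrArg Units.val (h σ)) (σ • T)
  rw [smul_units_apply, inv_smul_smul] at this
  exact this.symm

/-- A Galois invariant unit of `R̄` as a unit of `R`. -/
def toEqUnits (u : (Maps X L)ˣ) (h : ∀ σ : Gal(L/K), σ • u = u) : (EqMaps K X L)ˣ where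
  val := ⟨u.1, mem_eqMaps_of_smul_eq u h⟩
  inv := ⟨(u⁻¹).1, mem_eqMaps_of_smul_eq u⁻¹ fun σ => by rw [smul_inv', h]⟩
  val_inv := Subtype.ext u.mul_inv
  inv_val := Subtype.ext u.inv_mul

lemma smul_map_units (r : (EqMaps K X L)ˣ) (σ : Gal(L/K)) :
    σ • Units.map (EqMaps K X L).val.toMonoidHom r = Units.map (EqMaps K X L).val.toMonoidHom r := by
  ext
  funext T
  rw [smul_units_apply]
  change σ (r.1.1 (σ⁻¹ • T)) = r.1.1 T
  rw [← r.1.2 σ, smul_inv_smul]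

variable (K X L n) in
/-- The map `β ↦ βⁿ` with values in `Rˣ/(Rˣ)ⁿ`. -/
def nthPower : NthRootGroup K X L n →* UnitsModPow K X L n where
  toFun β := UnitsModPow.mk K X L n (toEqUnits (β.1 ^ n) β.2)
  map_one' := by
    rw [← map_one (UnitsModPow.mk K X L n)]
    congr 1
    ext : 2
    simp [toEqUnits]
  map_mul' β γ := by
    rw [← map_mul]
    congr 1
    ext : 2
    simp [toEqUnits, mul_pow]

/-- The group `μ_n(R̄)` of `n`-th roots of unity of `R̄ = Map(X, L)`, written additively. -/
abbrev MuBar (X L : Type*) [Field L] (n : ℕ) : Type _ := Additive (rootsOfUnity n (Maps X L))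

/-- The discrete Galois set condition: all stabilizers are open. -/
class SmoothAction (K X L : Type*) [Field K] [Field L] [Algebra K L] [MulAction Gal(L/K) X] :
    Prop where
  isOpen_stabilizer : ∀ T : X, IsOpen (MulAction.stabilizer Gal(L/K) T : Set Gal(L/K))

lemma SmoothAction.isLocallyConstant {K L Y : Type*} [Field K] [Field L] [Algebra K L] 
    [MulAction Gal(L/K) Y] (y : Y)
    (h : IsOpen (MulAction.stabilizer Gal(L/K) y : Set Gal(L/K))) :
    IsLocallyConstant fun σ : Gal(L/K) => σ • y := by
  rw [IsLocallyConstant.iff_exists_open]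
  intro σ
  refine ⟨(fun τ => σ⁻¹ * τ) ⁻¹' (MulAction.stabilizer Gal(L/K) y), ?_, ?_, ?_⟩
  · exact h.preimage (continuous_const.mul continuous_id)
  · simp
  · intro τ hτ
    have : (σ⁻¹ * τ) • y = y := hτ
    rw [mul_smul, inv_smul_eq_iff] at this
    exact this

lemma continuous_orbit [Algebra.IsIntegral K L] [SmoothAction K X L] (β : (Maps X L)ˣ) :
    Continuous fun σ : Gal(L/K) => σ • β := by
  have key : ∀ α : Maps X L, Continuous fun σ : Gal(L/K) => σ • α := by
    intro α
    rw [continuous_maps_iff]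
    intro T
    rw [IsLocallyConstant.iff_eventually_eq]
    intro σ
    have h1 := (IsLocallyConstant.iff_eventually_eq _).1
      (SmoothAction.isLocallyConstant T (SmoothAction.isOpen_stabilizer (K := K) (L := L) T)) σ⁻¹
    have h2 := (IsLocallyConstant.iff_eventually_eq _).1
      (SmoothAction.isLocallyConstant (α (σ⁻¹ • T)) (stabilizer_isOpen_of_isIntegral (α (σ⁻¹ • T)))) σ
    filter_upwards [continuous_inv.continuousAt.eventually h1, h2] with τ t1 t2
    change τ • α (τ⁻¹ • T) = σ • α (σ⁻¹ • T)
    rw [t1, t2]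
  rw [Units.continuous_iff]
  refine ⟨key β.1, ?_⟩
  simpa [smul_inv'] using key (β⁻¹).1

variable (K X L n) in
/-- The cocycle `σ ↦ σβ/β` with values in `μ_n(R̄)`. -/
def kummerCocycle [Algebra.IsIntegral K L] [SmoothAction K X L] :
    Additive (NthRootGroup K X L n) →+ Z1 Gal(L/K) (MuBar X L n) where
  toFun β := ⟨fun σ => Additive.ofMul ⟨σ • β.toMul.1 / β.toMul.1, by
    rw [mem_rootsOfUnity, div_pow, ← smul_pow', β.toMul.2, div_self']⟩, by
      have : Continuous fun σ : Gal(L/K) => σ • β.toMul.1 / β.toMul.1 :=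
        (continuous_orbit _).div' continuous_const
      exact continuous_induced_rng.2 this, fun σ τ => by
      apply Subtype.ext
      change (σ * τ) • β.toMul.1 / β.toMul.1 =
        (σ • β.toMul.1 / β.toMul.1) * σ • (τ • β.toMul.1 / β.toMul.1)
      rw [smul_div', mul_smul, mul_comm, div_mul_div_cancel]⟩
  map_zero' := by
    refine Subtype.ext (funext fun σ => Subtype.ext ?_)
    change σ • (1 : (Maps X L)ˣ) / 1 = 1
    rw [smul_one, div_one]
  map_add' β γ := by
    refine Subtype.ext (funext fun σ => Subtype.ext ?_)
    change σ • (β.toMul.1 * γ.toMul.1) / (β.toMul.1 * γ.toMul.1) =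
      (σ • β.toMul.1 / β.toMul.1) * (σ • γ.toMul.1 / γ.toMul.1)
    rw [smul_mul', mul_div_mul_comm]

variable (K X L n) in
/-- The class of the cocycle `σ ↦ σβ/β` in `H¹(K, μ_n(R̄))`. -/
def kummerClass [Algebra.IsIntegral K L] [SmoothAction K X L] :
    Additive (NthRootGroup K X L n) →+ H1 Gal(L/K) (MuBar X L n) :=
  (H1.mk _ _).comp (kummerCocycle K X L n)

lemma kummerClass_surjective [Algebra.IsIntegral K L] [SmoothAction K X L] :
    Function.Surjective (kummerClass K X L n) := by
  intro ξ
  obtain ⟨c, rfl⟩ := QuotientAddGroup.mk'_surjective _ ξ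
  obtain ⟨β, hβ⟩ := hilbert90 (fun σ => (c.1 σ).toMul.1) (continuous_subtype_val.comp c.2.1)
    (fun σ τ => congrArg Subtype.val (c.2.2 σ τ))
  refine ⟨Additive.ofMul ⟨β, fun σ => ?_⟩, ?_⟩
  · have h := (c.1 σ).toMul.2
    rw [mem_rootsOfUnity] at h
    rw [hβ, div_pow, div_eq_one, ← smul_pow'] at h
    exact h
  · exact congrArg (H1.mk _ _) (Subtype.ext (funext fun σ => Subtype.ext (hβ σ).symm))

lemma nthPower_surjective [IsSepClosed L] (hn : (n : L) ≠ 0) :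
    Function.Surjective (nthPower K X L n) := by
  intro a
  obtain ⟨r, rfl⟩ := QuotientGroup.mk'_surjective _ a
  have : NeZero (n : L) := ⟨hn⟩
  choose f hf using fun T => IsSepClosed.exists_pow_nat_eq (r.1.1 T) n
  have hn0 : n ≠ 0 := by rintro rfl; simp at hn
  let u : (Maps X L)ˣ := Units.map (EqMaps K X L).val.toMonoidHom r
  let β : (Maps X L)ˣ := Maps.mkUnit f fun T h => unit_apply_ne_zero u T (by
    change r.1.1 T = 0
    rw [← hf, h, zero_pow hn0])
  have hβ : β ^ n = u := Units.ext (funext hf)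
  refine ⟨⟨β, fun σ => ?_⟩, ?_⟩
  · rw [hβ]; exact smul_map_units r σ
  · have h : toEqUnits (β ^ n) (by rw [hβ]; exact smul_map_units r) = r := by
      apply Units.ext
      exact Subtype.ext (funext hf)
    exact congrArg (UnitsModPow.mk K X L n) h

lemma kummer_ker_eq [Algebra.IsIntegral K L] [SmoothAction K X L] :
    (kummerClass K X L n).ker = (MonoidHom.toAdditive (nthPower K X L n)).ker := by
  ext β
  have h1 : β ∈ (kummerClass K X L n).ker ↔
      ∃ ζ : MuBar X L n, ∀ σ, (kummerCocycle K X L n β).1 σ = σ • ζ - ζ :=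
    QuotientAddGroup.eq_zero_iff _
  have h2 : β ∈ (MonoidHom.toAdditive (nthPower K X L n)).ker ↔
      ∃ r : (EqMaps K X L)ˣ, r ^ n = toEqUnits (β.toMul.1 ^ n) β.toMul.2 :=
    QuotientGroup.eq_one_iff _
  rw [h1, h2]
  constructor
  · rintro ⟨ζ, hζ⟩
    have hz : ∀ σ : Gal(L/K), σ • β.toMul.1 / β.toMul.1 = σ • ζ.toMul.1 / ζ.toMul.1 :=
      fun σ => congrArg Subtype.val (hζ σ)
    refine ⟨toEqUnits (β.toMul.1 / ζ.toMul.1) fun σ => ?_, ?_⟩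
    · rw [smul_div', div_eq_div_iff_mul_eq_mul]
      have := hz σ
      rw [div_eq_div_iff_mul_eq_mul] at this
      rw [this, mul_comm]
    · apply Units.ext
      apply Subtype.ext
      change ((β.toMul.1 / ζ.toMul.1) ^ n).1 = (β.toMul.1 ^ n).1
      have := ζ.toMul.2
      rw [mem_rootsOfUnity] at this
      rw [div_pow, this, div_one]
  · rintro ⟨r, hr⟩
    let u : (Maps X L)ˣ := Units.map (EqMaps K X L).val.toMonoidHom r
    have hu : u ^ n = β.toMul.1 ^ n := by
      apply Units.ext
      exact congrArg Subtype.val (congrArg Units.val hr)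
    refine ⟨Additive.ofMul ⟨β.toMul.1 / u, ?_⟩, fun σ => Subtype.ext ?_⟩
    · rw [mem_rootsOfUnity, div_pow, hu, div_self']
    · change σ • β.toMul.1 / β.toMul.1 = (σ • (β.toMul.1 / u)) / (β.toMul.1 / u)
      have : σ • u = u := smul_map_units r σ
      rw [smul_div', this, div_div_div_cancel_right]

variable (K X L n) in
/-- The Kummer isomorphism `H¹(K, μ_n(R̄)) ≅ Rˣ/(Rˣ)ⁿ`: the class of `σ ↦ σβ/β` corresponds to
the class of `βⁿ` (see `kummerIso_apply`). -/
def kummerIso [IsSepClosure K L] [SmoothAction K X L] (hn : (n : L) ≠ 0) :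
    H1 Gal(L/K) (MuBar X L n) ≃+ Additive (UnitsModPow K X L n) :=
  have : IsSepClosed L := IsSepClosure.sep_closed K
  isoOfKerEq (kummerClass K X L n) (MonoidHom.toAdditive (nthPower K X L n))
    kummerClass_surjective (nthPower_surjective hn) kummer_ker_eq

theorem kummerIso_apply [IsSepClosure K L] [SmoothAction K X L] (hn : (n : L) ≠ 0)
    (β : NthRootGroup K X L n) :
    kummerIso K X L n hn (kummerClass K X L n (Additive.ofMul β)) =
      Additive.ofMul (nthPower K X L n β) :=
  isoOfKerEq_apply ..

end Kummer
section Coboundary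
variable {K X L : Type*} [Field K] [Field L] [Algebra K L] [AddCommGroup X]

variable (X L) in
/-- The homomorphism `∂ : R̄ˣ → (R̄ ⊗ R̄)ˣ`, `∂α(T₁, T₂) = α(T₁)α(T₂)/α(T₁ + T₂)`. -/
def del : (Maps X L)ˣ →* (Maps (X × X) L)ˣ where
  toFun α := Maps.mkUnit (fun T => α.1 T.1 * α.1 T.2 / α.1 (T.1 + T.2)) fun T =>
    div_ne_zero (mul_ne_zero (unit_apply_ne_zero _ _) (unit_apply_ne_zero _ _))
      (unit_apply_ne_zero _ _)
  map_one' := by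
    apply Units.ext
    funext T
    change (1 : L) * 1 / 1 = 1
    simp
  map_mul' α β := by
    apply Units.ext
    funext T
    change α.1 T.1 * β.1 T.1 * (α.1 T.2 * β.1 T.2) / (α.1 (T.1 + T.2) * β.1 (T.1 + T.2)) =
      α.1 T.1 * α.1 T.2 / α.1 (T.1 + T.2) * (β.1 T.1 * β.1 T.2 / β.1 (T.1 + T.2))
    rw [div_mul_div_comm]
    ring

variable [DistribMulAction Gal(L/K) X] (n : ℕ)

variable (K X L) in
/-- The group `(∂ μ_n(R̄))^{G_K}`. -/
def delMuBarInvariants : Subgroup (Maps (X × X) L)ˣ where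
  carrier := {ρ | ρ ∈ (rootsOfUnity n (Maps X L)).map (del X L) ∧ ∀ σ : Gal(L/K), σ • ρ = ρ}
  one_mem' := ⟨one_mem _, fun σ => smul_one σ⟩
  mul_mem' {ρ ρ'} h h' := ⟨mul_mem h.1 h'.1, fun σ => by rw [smul_mul', h.2, h'.2]⟩
  inv_mem' {ρ} h := ⟨inv_mem h.1, fun σ => by rw [smul_inv', h.2]⟩

variable (K X L) in
/-- The group `∂(μ_n(R))`. -/
def delMu : Subgroup (Maps (X × X) L)ˣ :=
  ((rootsOfUnity n (EqMaps K X L)).map (Units.map (EqMaps K X L).val.toMonoidHom)).map (del X L)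

variable (K X L) in
/-- The group `Γ` of all maps `γ : X → μ_n` with
`γ(σT₁)γ(σT₂)/γ(σ(T₁ + T₂)) = σ(γ(T₁)γ(T₂)/γ(T₁ + T₂))` for all `σ`, `T₁`, `T₂`. -/
def Gam : Subgroup (Maps X L)ˣ where
  carrier := {γ | (∀ T, γ.1 T ^ n = 1) ∧ ∀ (σ : Gal(L/K)) (T₁ T₂ : X),
    γ.1 (σ • T₁) * γ.1 (σ • T₂) / γ.1 (σ • (T₁ + T₂)) =
      σ (γ.1 T₁ * γ.1 T₂ / γ.1 (T₁ + T₂))}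
  one_mem' := by
    refine ⟨fun T => one_pow n, fun σ T₁ T₂ => ?_⟩
    change (1 : L) * 1 / 1 = σ (1 * 1 / 1)
    simp
  mul_mem' {γ δ} h h' := by
    refine ⟨fun T => ?_, fun σ T₁ T₂ => ?_⟩
    · change (γ.1 T * δ.1 T) ^ n = 1
      rw [mul_pow, h.1, h'.1, one_mul]
    · change γ.1 (σ • T₁) * δ.1 (σ • T₁) * (γ.1 (σ • T₂) * δ.1 (σ • T₂)) /
        (γ.1 (σ • (T₁ + T₂)) * δ.1 (σ • (T₁ + T₂))) =
        σ (γ.1 T₁ * δ.1 T₁ * (γ.1 T₂ * δ.1 T₂) / (γ.1 (T₁ + T₂) * δ.1 (T₁ + T₂)))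
      rw [mul_mul_mul_comm, mul_div_mul_comm, h.2, h'.2, ← map_mul, ← mul_div_mul_comm,
        mul_mul_mul_comm]
  inv_mem' {γ} h := by
    refine ⟨fun T => ?_, fun σ T₁ T₂ => ?_⟩
    · rw [coe_units_inv_apply, inv_pow, h.1, inv_one]
    · simp only [coe_units_inv_apply]
      rw [← mul_inv, ← inv_div_inv, inv_inv, inv_inv, ← inv_div, h.2, ← map_inv₀, inv_div]
      congr 1
      rw [← mul_inv, div_eq_mul_inv, div_eq_mul_inv, inv_inv, mul_comm]

end Coboundary

section Weil
open WeierstrassCurve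
variable {F : Type*} [Field F] (W : Affine F)

/-- The (invertible) fractional ideal of the affine coordinate ring of functions vanishing at the
point `P`; the trivial ideal for the point at infinity. -/
def pointIdeal : W.Point → (FractionalIdeal W.CoordinateRing⁰ W.FunctionField)ˣ
  | .zero => 1
  | .some _ _ h => Affine.CoordinateRing.XYIdeal' h

/-- The rational function `g` is defined at the affine point `P` and has the value `v` there:
`g = a/b` with `a, b` in the coordinate ring, `b(P) ≠ 0` and `a(P)/b(P) = v`. -/
def HasAffineValue (g : W.FunctionField) : W.Point → F → Prop
  | .zero, _ => False
  | .some _ _ h, v => ∃ a b : W.CoordinateRing,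
      g * algebraMap _ W.FunctionField b = algebraMap _ W.FunctionField a ∧
      AdjoinRoot.evalEval h.1 b ≠ 0 ∧
      AdjoinRoot.evalEval h.1 a = v * AdjoinRoot.evalEval h.1 b

variable [DecidableEq F]

/-- `div(g) = ∑_{nP = T} (P) - ∑_{nQ = O} (Q)`. Divisors on the affine curve are written as
fractional ideals; since a principal divisor and the right hand side both have degree zero, the
order at the point at infinity is determined by the affine part. -/
def IsWeilFunction (n : ℕ) (T : W.Point) (g : W.FunctionField) : Prop :=
  FractionalIdeal.spanSingleton W.CoordinateRing⁰ g =
    (((∏ᶠ (P : W.Point) (_ : n • P = T), pointIdeal W P) *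
      (∏ᶠ (Q : W.Point) (_ : n • Q = 0), pointIdeal W Q)⁻¹ :
      (FractionalIdeal W.CoordinateRing⁰ W.FunctionField)ˣ) :
      FractionalIdeal W.CoordinateRing⁰ W.FunctionField)

/-- The Weil pairing `e_n(S, T)` of two `n`-torsion points: the constant `ζ` such that
`G_T(P + S) = ζ G_T(P)` whenever both sides are defined, where
`div(G_T) = ∑_{nP = T} (P) - ∑_{nQ = O} (Q)`. -/
def weilPairing (n : ℕ) (S T : W.Point) : F :=
  Classical.epsilon fun ζ => ∃ g, IsWeilFunction W n T g ∧ ∀ (P : W.Point) (u v : F),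
    HasAffineValue W g P u → HasAffineValue W g (P + S) v → v = ζ * u

end Weil

section Torsion
open WeierstrassCurve
variable {K : Type*} [Field K] (W : Affine K) (L : Type*) [Field L] [Algebra K L] [DecidableEq L]
  (n : ℕ)

/-- The `n`-torsion subgroup `E[n]` of `E(L)`. -/
def Tors : AddSubgroup (Affine.Point (W⁄L)) := AddSubgroup.torsionBy _ (n : ℤ)

/-- The Galois action on points, coordinatewise. -/
instance : DistribMulAction Gal(L/K) (Affine.Point (W⁄L)) where
  smul σ P := Affine.Point.map (W' := W) (S := K) (σ : L →ₐ[K] L) P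
  one_smul P := by cases P <;> rfl
  mul_smul σ τ P := by cases P <;> rfl
  smul_zero σ := map_zero _
  smul_add σ P Q := map_add _ _ _

instance : DistribMulAction Gal(L/K) (Tors W L n) where
  smul σ P := ⟨σ • P.1, by
    have h := AddSubgroup.torsionBy.nsmul_iff.1 P.2
    refine AddSubgroup.torsionBy.nsmul_iff.2 ?_
    exact (map_nsmul (DistribSMul.toAddMonoidHom _ σ) n P.1).symm.trans
      ((congrArg (σ • ·) h).trans (smul_zero σ))⟩
  one_smul P := Subtype.ext (one_smul _ P.1)
  mul_smul σ τ P := Subtype.ext (mul_smul σ τ P.1)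
  smul_zero σ := Subtype.ext (smul_zero σ)
  smul_add σ P Q := Subtype.ext (smul_add σ P.1 Q.1)

instance : TopologicalSpace (Tors W L n) := ⊥

instance : DiscreteTopology (Tors W L n) := ⟨rfl⟩

instance [Algebra.IsIntegral K L] : SmoothAction K (Tors W L n) L where
  isOpen_stabilizer T := by
    obtain ⟨P, hP⟩ := T
    have key : ∃ U : Subgroup Gal(L/K), IsOpen (U : Set Gal(L/K)) ∧ ∀ σ ∈ U, σ • P = P := by
      cases P with
      | zero => exact ⟨⊤, isOpen_univ, fun σ _ => rfl⟩
      | some x y h =>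
        refine ⟨MulAction.stabilizer Gal(L/K) x ⊓ MulAction.stabilizer Gal(L/K) y,
          (stabilizer_isOpen_of_isIntegral x).inter (stabilizer_isOpen_of_isIntegral y), ?_⟩
        rintro σ ⟨h1, h2⟩
        change Affine.Point.map (W' := W) (S := K) (σ : L →ₐ[K] L) _ = _
        rw [Affine.Point.map_some]
        have e1 : σ x = x := h1
        have e2 : σ y = y := h2
        simp [e1, e2]
    obtain ⟨U, hU, hU'⟩ := key
    exact Subgroup.isOpen_mono (H₁ := U) (fun σ hσ => Subtype.ext (hU' σ hσ)) hU

variable {W L n}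

/-- The homomorphism `w₁ : H¹(K, E[n]) → H¹(K, μ_n(R̄)) ≅ Rˣ/(Rˣ)ⁿ` obtained from an equivariant
homomorphism `w : E[n] → μ_n(R̄)` and the Kummer isomorphism. -/
def w1 [IsSepClosure K L] (hn : (n : K) ≠ 0) (w : Tors W L n →+[Gal(L/K)] MuBar (Tors W L n) L n) :
    H1 Gal(L/K) (Tors W L n) →+ Additive (UnitsModPow K (Tors W L n) L n) :=
  (kummerIso K (Tors W L n) L n fun h => hn ((algebraMap K L).injective (by
    rw [map_natCast, map_zero, h]))).toAddMonoidHom.comp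
    (H1.map w continuous_of_discreteTopology)

end Torsion

end Descent

end

/-!
Two things have to be shown: that the Weil pairing, given as the constant ratio of values
`G_T(P + S) / G_T(P)`, is a bilinear, Galois equivariant and nondegenerate pairing with values
in `μ_n`, and that such a pairing forces the description of the kernel on cohomology.

**Cohomology.** The kernel of `∂` on `μ_n(R̄) = Map(E[n], μ_n)` is `Hom(E[n], μ_n)`,
and `w` identifies `E[n]` with it (`weilHom_injective`, `mem_range_weilHom_iff`). A map `γ :
E[n] → μ_n` lies in `Γ` exactly if `∂γ` is Galois invariant, i.e. if `σγ/γ` lies in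
`ker ∂ = w(E[n])` for all `σ`. So `γ` gives a cocycle `σ ↦ w⁻¹(σγ/γ)` in `E[n]`
whose image in `H¹(K, μ_n(R̄))` is the coboundary of `γ`, and every class killed by `w_*`
arises in this way. On the other hand `∂` maps `Γ` onto `(∂μ_n(R̄))^{G_K}`. Both
surjections, onto `ker w_*` and onto `(∂μ_n(R̄))^{G_K} / ∂μ_n(R)`, have as kernel
the products of elements of `μ_n(R)` and of `w(E[n])`, so their targets are isomorphic
(`kerMapEquiv`). The Kummer isomorphism is injective, hence `ker w₁ = ker w_*`.

**Divisors.** The points of `E` over its function field contain the generic point `P`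
and the constant points. Since `x(P + R)` is transcendental, `P ↦ P + R` induces an
endomorphism `trans R` of the function field, and the valuation `ordAt R` at the point
`R` is the pullback under `trans R` of the valuation at infinity, which is given by the
degree of the norm to `L[X]`. The identity expressing `x(P + R) x(P - R)` and `x(P + R)
+ x(P - R)` through `x(P)` and `x(R)` (`sym2x_add_sub`) yields the divisor of `x - x(C)`
(`ordAt_lin`). Working in the ring generated by the coordinates and the inverses of the
functions `x - x(C)`, which is stable under translations, one finds that a function without
poles is constant (`exists_const_of_ordAt_le_one`), and that the functions `G_T` have the
expected valuations at all points (`IsWeilFunction.ordAt_eq`); they exist because the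
map from `E` to the class group of its coordinate ring is a homomorphism, together with
`#{P | nP = T} = n²` (`card_nsmul_eq`). That count comes from writing `x(nP) = aₙ(x)/bₙ(x)` with `aₙ` monic
of degree `n²` and `bₙ` of leading term `n² x ^ (n² - 1)`, so that the derivative of
`aₙ/bₙ` does not vanish identically.

**The pairing.** As translation by `S ∈ E[n]` preserves the divisor of `G_T`, it multiplies
`G_T` by a constant, which is `e_n(S, T)` (`weilPairing_eq`). Bilinearity is read off from
this, and equivariance from the Galois action on the function field (`weilPairing_smul`).

**Nondegeneracy** (`eq_zero_of_weilPairing_eq_one`). If `e_n(S, T) = 1` for all `S` and `T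
≠ 0`, then `G_T` is invariant under translation by `E[n]`, and has simple poles exactly on
`E[n]`. Every function invariant under `E[n]` with poles only on `E[n]` is then a polynomial in
`G_T`, because its pole at `O` can be removed by subtracting powers of `G_T`. In particular
`x(nP)`, with a double pole at `O`, is a polynomial of degree `2` in `G_T`, and `y(nP)`,
which is integral over these polynomials, is a polynomial in `G_T` as well. But an elliptic
curve has no polynomial parametrisation (`false_of_polynomial_point`). So `T ↦ e_n(-, T)`
is injective, and by counting and duality of finite abelian groups `S ↦ e_n(S, -)` is an
isomorphism of `E[n]` with `Hom(E[n], μ_n)`.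
-/

set_option linter.unusedSectionVars false

noncomputable section

namespace Descent
open WeierstrassCurve Polynomial

/-! ### The addition-and-subtraction map on `x`-coordinates -/

section AddSub

variable {R : Type*} [CommRing R] (W : WeierstrassCurve R)

/-- The homogeneous form representing `x(P + Q) x(P - Q)` in terms of the elementary symmetric
functions `(s : t : u)` of the projective coordinates `x(P)` and `x(Q)`. -/
def addSubS (s t u : R) : R := s ^ 2 - W.b₄ * s * u - W.b₆ * t * u - W.b₈ * u ^ 2

/-- The homogeneous form representing `x(P + Q) + x(P - Q)`. -/
def addSubT (s t u : R) : R := 2 * t * s + W.b₂ * s * u + W.b₄ * t * u + W.b₆ * u ^ 2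

/-- The common denominator of the forms `addSubS` and `addSubT`. -/
def addSubU (s t u : R) : R := t ^ 2 - 4 * s * u

/-- The form `U x₃² - T x₃ + S` for `x₁ = a/b`, `x₂ = c/d`, `x₃ = e/f`. It vanishes if
`x₁`, `x₂`, `x₃` are the `x`-coordinates of three points with sum zero; as `x(-P) = x(P)`, the signs
of the points do not matter. -/
def triForm (a b c d e f : R) : R :=
  addSubU (a * c) (a * d + b * c) (b * d) * e ^ 2
    - addSubT W (a * c) (a * d + b * c) (b * d) * (e * f)
    + addSubS W (a * c) (a * d + b * c) (b * d) * f ^ 2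

lemma triForm_swap₁₃ (a b c d e f : R) : triForm W a b c d e f = triForm W e f c d a b := by
  simp only [triForm, addSubS, addSubT, addSubU]; ring

/-- The forms are the components of `WeierstrassCurve.addSubMap`. -/
lemma eval_addSubMap (s t u : R) : (fun i => (W.addSubMap i).eval ![s, t, u]) =
    ![addSubS W s t u, addSubT W s t u, addSubU s t u] := by
  funext i
  fin_cases i <;> simp [addSubMap, addSubS, addSubT, addSubU]

/-- The three forms have no common zero: each fourth power lies in any ideal containing them. -/
lemma pow_four_mem_of_addSub_mem [W.IsElliptic] {s t u : R} {I : Ideal R}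
    (hS : addSubS W s t u ∈ I) (hT : addSubT W s t u ∈ I) (hU : addSubU s t u ∈ I) :
    s ^ 4 ∈ I ∧ t ^ 4 ∈ I ∧ u ^ 4 ∈ I := by
  have h (i : Fin 3) : ![s, t, u] i ^ 4 ∈ I := by
    rw [← addSubMapCoeff_condition W ![s, t, u] i]
    refine I.sum_mem fun j _ => I.mul_mem_left _ ?_
    rw [show (W.addSubMap j).eval ![s, t, u] = _ from congrFun (eval_addSubMap W s t u) j]
    fin_cases j
    exacts [hS, hT, hU]
  exact ⟨h 0, h 1, h 2⟩

end AddSub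

section AddSubPoint

variable {F : Type*} [Field F] [DecidableEq F] {W : Affine F} [W.IsElliptic]

open Affine Point

omit [DecidableEq F] [W.IsElliptic] in
lemma sym2x_zero_self (Q : W.Point) : ∃ k : F, k ≠ 0 ∧ Q.sym2x Q = k •
    ![addSubS W (sym2x 0 Q 0) (sym2x 0 Q 1) (sym2x 0 Q 2),
      addSubT W (sym2x 0 Q 0) (sym2x 0 Q 1) (sym2x 0 Q 2),
      addSubU (sym2x 0 Q 0) (sym2x 0 Q 1) (sym2x 0 Q 2)] := by
  refine ⟨1, one_ne_zero, ?_⟩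
  rw [one_smul]
  cases Q with
  | zero => simp [← zero_def, addSubS, addSubT, addSubU]
  | some x y h => simp [addSubS, addSubT, addSubU, pow_two, two_mul]

lemma sym2x_double {x y : F} (h : W.Nonsingular x y) : ∃ k : F, k ≠ 0 ∧
    sym2x (some x y h + some x y h) 0 = k •
      ![addSubS W (x * x) (x + x) 1, addSubT W (x * x) (x + x) 1,
        addSubU (x * x) (x + x) 1] := by
  have heq := (equation_iff ..).1 h.1
  have hU : addSubU (x * x) (x + x) 1 = 0 := by simp only [addSubU]; ring
  have hT : addSubT W (x * x) (x + x) 1 = (2 * y + W.a₁ * x + W.a₃) ^ 2 := by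
    simp only [addSubT, b₂, b₄, b₆]
    linear_combination -4 * heq
  by_cases hy : y = W.negY x y
  · have h0 : 2 * y + W.a₁ * x + W.a₃ = 0 := by
      rw [negY] at hy; linear_combination hy
    have hT0 : addSubT W (x * x) (x + x) 1 = 0 := by rw [hT, h0]; ring
    have hS : addSubS W (x * x) (x + x) 1 ≠ 0 := by
      intro hS
      have := (pow_four_mem_of_addSub_mem W (I := ⊥) hS hT0 hU).2.2
      simp at this
    refine ⟨_, inv_ne_zero hS, ?_⟩
    rw [add_self_of_Y_eq hy, sym2x_zero_zero, hT0, hU]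
    simp [hS]
  · have h0 : 2 * y + W.a₁ * x + W.a₃ ≠ 0 := by
      intro h0; apply hy; rw [negY]; linear_combination h0
    have hT0 : addSubT W (x * x) (x + x) 1 ≠ 0 := by rw [hT]; exact pow_ne_zero 2 h0
    refine ⟨_, inv_ne_zero hT0, ?_⟩
    rw [add_self_of_Y_ne hy, sym2x_some_zero, hU]
    have e : W.addX x x (W.slope x x y y) * addSubT W (x * x) (x + x) 1 =
        addSubS W (x * x) (x + x) 1 := by
      have h1 : y - W.negY x y = 2 * y + W.a₁ * x + W.a₃ := by rw [negY]; ring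
      have h2 : W.slope x x y y * (2 * y + W.a₁ * x + W.a₃) =
          3 * x ^ 2 + 2 * W.a₂ * x + W.a₄ - W.a₁ * y := by
        rw [slope_of_Y_ne rfl hy, h1, div_mul_cancel₀ _ h0]
      rw [hT, addX]
      simp only [addSubS, b₄, b₆, b₈]
      linear_combination (W.slope x x y y * (2 * y + W.a₁ * x + W.a₃) +
        (3 * x ^ 2 + 2 * W.a₂ * x + W.a₄ - W.a₁ * y) + W.a₁ * (2 * y + W.a₁ * x + W.a₃)) * h2 +
        (-(8 * x) - W.a₁ ^ 2 - 4 * W.a₂) * heq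
    rw [← e]
    ext i
    fin_cases i
    · change W.addX x x (W.slope x x y y) = (addSubT W (x * x) (x + x) 1)⁻¹ *
        (W.addX x x (W.slope x x y y) * addSubT W (x * x) (x + x) 1)
      rw [mul_comm _ (addSubT W (x * x) (x + x) 1), inv_mul_cancel_left₀ hT0]
    · simp [hT0]
    · simp

omit [DecidableEq F] [W.IsElliptic] in
/-- Product and sum of `x(P + Q)` and `x(P - Q)` for points with `x(P) ≠ x(Q)`, with denominators
cleared; `l` and `l'` are the slopes of the two chords. -/
lemma addX_mul_addX_sub {x₁ x₂ y₁ y₂ : F} (e1 : W.Equation x₁ y₁) (e2 : W.Equation x₂ y₂)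
    {l l' : F} (h : l * (x₁ - x₂) = y₁ - y₂) (h' : l' * (x₁ - x₂) = y₁ - W.negY x₂ y₂) :
    W.addX x₁ x₂ l * W.addX x₁ x₂ l' * (x₁ - x₂) ^ 4 =
        addSubS W (x₁ * x₂) (x₁ + x₂) 1 * (x₁ - x₂) ^ 2 ∧
      (W.addX x₁ x₂ l + W.addX x₁ x₂ l') * (x₁ - x₂) ^ 2 =
        addSubT W (x₁ * x₂) (x₁ + x₂) 1 := by
  rw [equation_iff] at e1 e2
  rw [negY] at h'
  simp only [addX]
  set f₁ := x₁ ^ 3 + W.a₂ * x₁ ^ 2 + W.a₄ * x₁ + W.a₆ with hf₁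
  set f₂ := x₂ ^ 3 + W.a₂ * x₂ ^ 2 + W.a₄ * x₂ + W.a₆ with hf₂
  set A₁ := W.a₁ * x₁ + W.a₃ with hA₁
  set A₂ := W.a₁ * x₂ + W.a₃ with hA₂
  -- The conjugate `y`-coordinates, in which both numerators become symmetric.
  obtain ⟨z₁, hz₁⟩ : ∃ z, z = -y₁ - A₁ := ⟨_, rfl⟩
  obtain ⟨z₂, hz₂⟩ : ∃ z, z = -y₂ - A₂ := ⟨_, rfl⟩
  have p1 : y₁ * z₁ = -f₁ := by rw [hz₁, hA₁]; linear_combination -e1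
  have p2 : y₂ * z₂ = -f₂ := by rw [hz₂, hA₂]; linear_combination -e2
  obtain ⟨B, hB⟩ : ∃ B, B = f₁ + f₂ - (W.a₂ + x₁ + x₂) * (x₁ - x₂) ^ 2 := ⟨_, rfl⟩
  have m1 : (l ^ 2 + W.a₁ * l - W.a₂ - x₁ - x₂) * (x₁ - x₂) ^ 2 = B + (y₁ * z₂ + y₂ * z₁) := by
    rw [hB]
    linear_combination (l * (x₁ - x₂) + (y₁ - y₂) + W.a₁ * (x₁ - x₂)) * h - p1 - p2 +
      (y₁ - y₂) * hz₁ - (y₁ - y₂) * hz₂ + (y₁ - y₂) * hA₁ - (y₁ - y₂) * hA₂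
  have m2 : (l' ^ 2 + W.a₁ * l' - W.a₂ - x₁ - x₂) * (x₁ - x₂) ^ 2 = B + (y₁ * y₂ + z₁ * z₂) := by
    have h'' : l' * (x₁ - x₂) = y₁ - z₂ := by rw [h', hz₂, hA₂]; ring
    rw [hB]
    linear_combination (l' * (x₁ - x₂) + (y₁ - z₂) + W.a₁ * (x₁ - x₂)) * h'' - p1 - p2 +
      (y₁ - z₂) * hz₁ - (y₁ - z₂) * hz₂ + (y₁ - z₂) * hA₁ - (y₁ - z₂) * hA₂
  have s : (y₁ * z₂ + y₂ * z₁) + (y₁ * y₂ + z₁ * z₂) = A₁ * A₂ := by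
    rw [hz₁, hz₂]; ring
  have p : (y₁ * z₂ + y₂ * z₁) * (y₁ * y₂ + z₁ * z₂) =
      -f₂ * (A₁ ^ 2 + 2 * f₁) - f₁ * (A₂ ^ 2 + 2 * f₂) := by
    have q1 : y₁ ^ 2 + z₁ ^ 2 = A₁ ^ 2 + 2 * f₁ := by
      linear_combination (z₁ + y₁ - A₁) * hz₁ - 2 * p1
    have q2 : y₂ ^ 2 + z₂ ^ 2 = A₂ ^ 2 + 2 * f₂ := by
      linear_combination (z₂ + y₂ - A₂) * hz₂ - 2 * p2
    linear_combination (y₁ ^ 2 + z₁ ^ 2) * p2 + (y₂ ^ 2 + z₂ ^ 2) * p1 - f₂ * q1 - f₁ * q2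
  constructor
  · have : (l ^ 2 + W.a₁ * l - W.a₂ - x₁ - x₂) * (l' ^ 2 + W.a₁ * l' - W.a₂ - x₁ - x₂) *
        (x₁ - x₂) ^ 4 = B ^ 2 + B * (A₁ * A₂) +
          (-f₂ * (A₁ ^ 2 + 2 * f₁) - f₁ * (A₂ ^ 2 + 2 * f₂)) := by
      rw [← s, ← p]
      linear_combination (l' ^ 2 + W.a₁ * l' - W.a₂ - x₁ - x₂) * (x₁ - x₂) ^ 2 * m1 +
        (B + (y₁ * z₂ + y₂ * z₁)) * m2
    rw [this, hB, hf₁, hf₂, hA₁, hA₂]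
    simp only [addSubS, b₄, b₆, b₈]
    ring
  · have : (l ^ 2 + W.a₁ * l - W.a₂ - x₁ - x₂ + (l' ^ 2 + W.a₁ * l' - W.a₂ - x₁ - x₂)) *
        (x₁ - x₂) ^ 2 = 2 * B + A₁ * A₂ := by
      linear_combination m1 + m2 + s
    rw [this, hB, hf₁, hf₂, hA₁, hA₂]
    simp only [addSubT, b₂, b₄, b₆]
    ring

/-- The addition-and-subtraction map computes the unordered pair of the `x`-coordinates of
`P + Q` and `P - Q` from that of `P` and `Q`. -/
theorem sym2x_add_sub (P Q : W.Point) : ∃ k : F, k ≠ 0 ∧ sym2x (P + Q) (P - Q) = k •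
    ![addSubS W (sym2x P Q 0) (sym2x P Q 1) (sym2x P Q 2),
      addSubT W (sym2x P Q 0) (sym2x P Q 1) (sym2x P Q 2),
      addSubU (sym2x P Q 0) (sym2x P Q 1) (sym2x P Q 2)] := by
  rcases P with _ | ⟨x₁, y₁, h₁⟩
  · rw [← zero_def, zero_add, zero_sub, sym2x_neg_right]
    exact sym2x_zero_self Q
  rcases Q with _ | ⟨x₂, y₂, h₂⟩
  · rw [← zero_def, add_zero, sub_zero, sym2x_comm (some x₁ y₁ h₁) 0]
    exact sym2x_zero_self _
  by_cases hx : x₁ = x₂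
  · rcases X_eq_iff.1 hx with h | h
    · rw [h, sub_self]
      simpa using sym2x_double h₂
    · rw [h, neg_add_cancel, sym2x_comm, ← neg_add', sym2x_neg_left, sym2x_neg_left]
      simpa using sym2x_double h₂
  · have hx' : x₁ - x₂ ≠ 0 := sub_ne_zero.2 hx
    refine ⟨((x₁ - x₂) ^ 2)⁻¹, inv_ne_zero (pow_ne_zero 2 hx'), ?_⟩
    rw [sub_eq_add_neg, neg_some, add_of_X_ne hx, add_of_X_ne hx]
    obtain ⟨e1, e2⟩ := addX_mul_addX_sub h₁.1 h₂.1 (l := W.slope x₁ x₂ y₁ y₂)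
      (l' := W.slope x₁ x₂ y₁ (W.negY x₂ y₂))
      (by rw [slope_of_X_ne hx, div_mul_cancel₀ _ hx'])
      (by rw [slope_of_X_ne hx, div_mul_cancel₀ _ hx'])
    have e1' := mul_right_cancel₀ (pow_ne_zero 2 hx') (e1.symm.trans (by ring :
      _ = W.addX x₁ x₂ (W.slope x₁ x₂ y₁ y₂) * W.addX x₁ x₂ (W.slope x₁ x₂ y₁ (W.negY x₂ y₂)) *
        (x₁ - x₂) ^ 2 * (x₁ - x₂) ^ 2))
    simp only [sym2x_some_some]
    ext i
    fin_cases i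
    · simp [e1']
      field_simp
    · simp [← e2]
      field_simp
    · simp [addSubU]
      field_simp
      ring

end AddSubPoint

/-! ### The multiplication-by-`n` map on `x`-coordinates -/

section MulPoly

/-- If `(a : b)` is a root, in lowest terms, of the quadratic form `U t² - T t + S`, the other
root is defined over the same ring. -/
lemma exists_cofactor_of_root {R : Type*} [CommRing R] [IsDomain R] {a b S T U : R}
    (hab : IsCoprime a b) (ha : a ≠ 0) (h : U * a ^ 2 - T * (a * b) + S * b ^ 2 = 0) :
    ∃ a' b', a * a' = S ∧ a * b' + a' * b = T ∧ b * b' = U := by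
  obtain ⟨a', ha'⟩ : a ∣ S :=
    (hab.pow_right (n := 2)).dvd_of_dvd_mul_right ⟨T * b - U * a, by linear_combination h⟩
  obtain ⟨b', hb'⟩ : b ∣ U :=
    (hab.symm.pow_right (n := 2)).dvd_of_dvd_mul_right ⟨T * a - S * b, by linear_combination h⟩
  by_cases hb : b = 0
  · subst hb
    have hu : IsUnit a := isCoprime_zero_right.1 hab
    obtain ⟨c, hc⟩ := hu.exists_right_inv
    exact ⟨a', c * T, ha'.symm, by linear_combination T * hc, by rw [hb']; ring⟩
  · refine ⟨a', b', ha'.symm, ?_, hb'.symm⟩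
    apply mul_left_cancel₀ (mul_ne_zero ha hb)
    rw [ha', hb'] at h
    linear_combination h

variable {L : Type*} [Field L] (W : WeierstrassCurve L)

/-- Degrees and leading coefficients of the forms `S` and `T` at `(a' X : a' + b' X : b')`, in terms
of `P = a'²`, `Q = a' b'` and `R = b'²`. -/
lemma coeff_addSub_aux {k : ℕ} {P Q R : L[X]} (hP : P.natDegree ≤ k + 2) (hQ : Q.natDegree ≤ k + 1)
    (hR : R.natDegree ≤ k) (c₂ c₄ c₆ c₈ : L) :
    ((X ^ 2 * P - C c₄ * (X * Q) - C c₆ * (Q + X * R) - C c₈ * R).natDegree ≤ k + 4 ∧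
      (X ^ 2 * P - C c₄ * (X * Q) - C c₆ * (Q + X * R) - C c₈ * R).coeff (k + 4) =
        P.coeff (k + 2)) ∧
    ((C 2 * (X * P) + C 2 * (X ^ 2 * Q) + C c₂ * (X * Q) + C c₄ * (Q + X * R) +
        C c₆ * R).natDegree ≤ k + 3 ∧
      (C 2 * (X * P) + C 2 * (X ^ 2 * Q) + C c₂ * (X * Q) + C c₄ * (Q + X * R) +
        C c₆ * R).coeff (k + 3) = 2 * P.coeff (k + 2) + 2 * Q.coeff (k + 1)) := by
  have p (i) (hi : k + 2 < i) : P.coeff i = 0 := coeff_eq_zero_of_natDegree_lt (by omega)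
  have q (i) (hi : k + 1 < i) : Q.coeff i = 0 := coeff_eq_zero_of_natDegree_lt (by omega)
  have r (i) (hi : k < i) : R.coeff i = 0 := coeff_eq_zero_of_natDegree_lt (by omega)
  refine ⟨⟨natDegree_le_iff_coeff_eq_zero.2 fun i hi => ?_, ?_⟩,
    ⟨natDegree_le_iff_coeff_eq_zero.2 fun i hi => ?_, ?_⟩⟩
  · obtain ⟨j, rfl⟩ : ∃ j, i = j + 2 := ⟨i - 2, by omega⟩
    simp only [coeff_sub, coeff_add, coeff_C_mul, coeff_X_pow_mul, coeff_X_mul]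
    rw [p _ (by omega), q (j + 1) (by omega), q (j + 2) (by omega), r (j + 1) (by omega),
      r (j + 2) (by omega)]
    simp
  · simp only [coeff_sub, coeff_add, coeff_C_mul, show k + 4 = k + 2 + 2 from rfl,
      coeff_X_pow_mul, coeff_X_mul]
    rw [q (k + 2 + 1) (by omega), q (k + 2 + 2) (by omega), r (k + 2 + 1) (by omega),
      r (k + 2 + 2) (by omega)]
    simp
  · obtain ⟨j, rfl⟩ : ∃ j, i = j + 2 := ⟨i - 2, by omega⟩
    simp only [coeff_add, coeff_C_mul, coeff_X_pow_mul, coeff_X_mul]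
    rw [p (j + 1) (by omega), q j (by omega), q (j + 1) (by omega), q (j + 2) (by omega),
      r (j + 1) (by omega), r (j + 2) (by omega)]
    simp
  · simp only [coeff_add, coeff_C_mul, show k + 3 = k + 1 + 2 from rfl, coeff_X_pow_mul,
      coeff_X_mul]
    rw [q (k + 1 + 1) (by omega), q (k + 1 + 2) (by omega), r (k + 1 + 1) (by omega),
      r (k + 1 + 2) (by omega)]
    simp

/-- The shape of the numerator `a` and denominator `b` of `x(nP)` as a rational function of `x(P)`:
in lowest terms, `a = x ^ n² + ⋯` and `b = n² x ^ (n² - 1) + ⋯`. -/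
structure IsMulPair (n : ℕ) (a b : L[X]) : Prop where
  coprime : IsCoprime a b
  monic : a.Monic
  natDegree_left : a.natDegree = n ^ 2
  natDegree_right : b.natDegree ≤ n ^ 2 - 1
  coeff_right : b.coeff (n ^ 2 - 1) = (n : L) ^ 2

/-- The relation between the `x`-coordinates of `(n - 1)P`, `nP` and `(n + 1)P`. -/
structure IsMulStep (a b a' b' a'' b'' : L[X]) : Prop where
  mul_left : a * a'' = addSubS (W.map C) (a' * X) (a' * 1 + b' * X) (b' * 1)
  cross : a * b'' + a'' * b = addSubT (W.map C) (a' * X) (a' * 1 + b' * X) (b' * 1)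
  mul_right : b * b'' = addSubU (a' * X) (a' * 1 + b' * X) (b' * 1)

/-- The construction of `x((n + 2)P)` from `x(nP)` and `x((n + 1)P)`: it is the second root of a
quadratic form whose first root is `x(nP)`. The resulting fraction is in lowest terms because the
coefficients of the form have no common zero. -/
lemma exists_isMulStep [W.IsElliptic] {n : ℕ} {a b a' b' : L[X]} (h : IsMulPair n a b)
    (h' : IsMulPair (n + 1) a' b') (htri : triForm (W.map C) a' b' X 1 a b = 0)
    (hn : n = 0 → b = 0) :
    ∃ a'' b'', IsMulStep W a b a' b' a'' b'' ∧ IsMulPair (n + 2) a'' b'' ∧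
      triForm (W.map C) a'' b'' X 1 a' b' = 0 := by
  obtain ⟨a'', b'', hS, hT, hU⟩ := exists_cofactor_of_root h.coprime h.monic.ne_zero htri
  refine ⟨a'', b'', ⟨hS, hT, hU⟩, ?_, ?_⟩
  · obtain ⟨k, hk⟩ : ∃ k, 2 * (n + 1) ^ 2 = k + 2 := ⟨2 * (n + 1) ^ 2 - 2, by
      have : 0 < (n + 1) ^ 2 := by positivity
      omega⟩
    have hm : 0 < (n + 1) ^ 2 := by positivity
    have hn2 : (n + 2) ^ 2 + n ^ 2 = k + 4 := by nlinarith
    have hn3 : 0 < (n + 2) ^ 2 := by positivity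
    have da := h'.natDegree_left.le
    have db := h'.natDegree_right
    have ca : a'.coeff ((n + 1) ^ 2) = 1 := by
      rw [← h'.natDegree_left]; exact h'.monic
    have hP : (a' * a').natDegree ≤ k + 2 := natDegree_mul_le.trans (by omega)
    have hQ : (a' * b').natDegree ≤ k + 1 := natDegree_mul_le.trans (by omega)
    have hR : (b' * b').natDegree ≤ k := natDegree_mul_le.trans (by omega)
    have cP : (a' * a').coeff (k + 2) = 1 := by
      rw [← hk, two_mul, coeff_mul_add_eq_of_natDegree_le da da, ca, one_mul]
    have cQ : (a' * b').coeff (k + 1) = ((n : L) + 1) ^ 2 := by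
      rw [show k + 1 = (n + 1) ^ 2 + ((n + 1) ^ 2 - 1) by omega,
        coeff_mul_add_eq_of_natDegree_le da db, ca, h'.coeff_right, one_mul]
      push_cast; rfl
    obtain ⟨⟨dS, cS⟩, dT, cT⟩ := coeff_addSub_aux hP hQ hR W.b₂ W.b₄ W.b₆ W.b₈
    have eS : a * a'' = X ^ 2 * (a' * a') - C W.b₄ * (X * (a' * b')) -
        C W.b₆ * ((a' * b') + X * (b' * b')) - C W.b₈ * (b' * b') := by
      rw [hS]; simp only [addSubS, map_b₄, map_b₆, map_b₈]; ring
    have eT : a * b'' + a'' * b = C 2 * (X * (a' * a')) + C 2 * (X ^ 2 * (a' * b')) +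
        C W.b₂ * (X * (a' * b')) + C W.b₄ * ((a' * b') + X * (b' * b')) + C W.b₆ * (b' * b') := by
      rw [hT]; simp only [addSubT, map_b₂, map_b₄, map_b₆, map_ofNat]; ring
    rw [← eS] at dS cS
    rw [← eT] at dT cT
    rw [cP] at cS
    rw [cP, cQ] at cT
    have mS : (a * a'').Monic := monic_of_natDegree_le_of_coeff_eq_one _ dS cS
    have ma : a''.Monic := h.monic.of_mul_monic_left mS
    have na : a''.natDegree = (n + 2) ^ 2 := by
      have h1 : (a * a'').natDegree = k + 4 :=
        le_antisymm dS (le_natDegree_of_ne_zero (by rw [cS]; exact one_ne_zero))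
      rw [h.monic.natDegree_mul ma, h.natDegree_left] at h1
      omega
    have hab : (a'' * b).natDegree ≤ k + 3 ∧ (a'' * b).coeff (k + 3) = (n : L) ^ 2 := by
      rcases Nat.eq_zero_or_pos n with h0 | h0
      · simp [hn h0, h0]
      · have hnp : 0 < n ^ 2 := by positivity
        have := h.natDegree_right
        refine ⟨natDegree_mul_le.trans (by omega), ?_⟩
        rw [show k + 3 = (n + 2) ^ 2 + (n ^ 2 - 1) by omega,
          coeff_mul_add_eq_of_natDegree_le na.le this, h.coeff_right, ← na,
          ma.coeff_natDegree, one_mul]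
    have hab' : (a * b'').natDegree ≤ k + 3 := by
      rw [show a * b'' = (a * b'' + a'' * b) - a'' * b by ring]
      exact (natDegree_sub_le_of_le dT hab.1).trans (max_self _).le
    have db'' : b''.natDegree ≤ (n + 2) ^ 2 - 1 := by
      by_cases hb : b'' = 0
      · simp [hb]
      rw [h.monic.natDegree_mul' hb, h.natDegree_left] at hab'
      omega
    refine ⟨?_, ma, na, db'', ?_⟩
    · let I := Ideal.span {a'', b''}
      have hI : a'' ∈ I ∧ b'' ∈ I := ⟨Ideal.subset_span (by simp), Ideal.subset_span (by simp)⟩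
      obtain ⟨-, h2, h3⟩ := pow_four_mem_of_addSub_mem (W.map C) (I := I)
        (hS ▸ I.mul_mem_left _ hI.1)
        (hT ▸ I.add_mem (I.mul_mem_left _ hI.2) (I.mul_mem_right _ hI.1))
        (hU ▸ I.mul_mem_left _ hI.2)
      have hc : IsCoprime ((a' * 1 + b' * X) ^ 4) ((b' * 1) ^ 4) := by
        refine IsCoprime.pow ?_
        rw [mul_one, mul_one]
        exact h'.coprime.add_mul_left_left X
      obtain ⟨u, v, huv⟩ := hc
      have : (1 : L[X]) ∈ I := huv ▸ I.add_mem (I.mul_mem_left _ h2) (I.mul_mem_left _ h3)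
      obtain ⟨u, v, huv⟩ := Ideal.mem_span_pair.1 this
      exact ⟨u, v, huv⟩
    · have e : (a * b'').coeff (k + 3) = b''.coeff ((n + 2) ^ 2 - 1) := by
        rw [show k + 3 = n ^ 2 + ((n + 2) ^ 2 - 1) by omega,
          coeff_mul_add_eq_of_natDegree_le h.natDegree_left.le db'', ← h.natDegree_left,
          h.monic.coeff_natDegree, one_mul]
      rw [coeff_add, e, hab.2] at cT
      push_cast
      linear_combination cT
  · rw [triForm_swap₁₃, triForm, ← hS, ← hT, ← hU]
    ring

/-- Polynomials `aₙ`, `bₙ` such that `x(nP) = aₙ(x(P)) / bₙ(x(P))` for all points `P`. -/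
theorem exists_mulPoly [W.IsElliptic] : ∃ a b : ℕ → L[X],
    a 0 = 1 ∧ b 0 = 0 ∧ a 1 = X ∧ b 1 = 1 ∧ (∀ n, IsMulPair n (a n) (b n)) ∧
    ∀ n, IsMulStep W (a n) (b n) (a (n + 1)) (b (n + 1)) (a (n + 2)) (b (n + 2)) := by
  let P (n : ℕ) (p : (L[X] × L[X]) × (L[X] × L[X])) : Prop :=
    IsMulPair n p.1.1 p.1.2 ∧ IsMulPair (n + 1) p.2.1 p.2.2 ∧
      triForm (W.map C) p.2.1 p.2.2 X 1 p.1.1 p.1.2 = 0 ∧ (n = 0 → p.1.2 = 0)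
  have h0 : P 0 ((1, 0), (X, 1)) := by
    refine ⟨⟨isCoprime_one_left, monic_one, by simp, by simp, by simp⟩,
      ⟨isCoprime_one_right, monic_X, by simp, by simp, by simp⟩, ?_, fun _ => rfl⟩
    simp only [triForm, addSubU, addSubS, addSubT]; ring
  have hs (n : ℕ) (p : {p // P n p}) : ∃ q : {q // P (n + 1) q}, q.1.1 = p.1.2 ∧
      IsMulStep W p.1.1.1 p.1.1.2 p.1.2.1 p.1.2.2 q.1.2.1 q.1.2.2 := by
    obtain ⟨⟨⟨a, b⟩, a', b'⟩, h1, h2, h3, h4⟩ := p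
    obtain ⟨a'', b'', h5, h6, h7⟩ := exists_isMulStep W h1 h2 h3 h4
    exact ⟨⟨((a', b'), (a'', b'')), h2, h6, h7, by simp⟩, rfl, h5⟩
  choose f hf using hs
  let g (n : ℕ) : {p // P n p} := Nat.rec ⟨_, h0⟩ (fun n p => f n p) n
  have hg (n : ℕ) : (g (n + 1)).1.1 = (g n).1.2 := (hf n (g n)).1
  refine ⟨fun n => (g n).1.1.1, fun n => (g n).1.1.2, rfl, rfl, ?_, ?_, fun n => (g n).2.1,
    fun n => ?_⟩
  · exact congrArg Prod.fst (hg 0)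
  · exact congrArg Prod.snd (hg 0)
  · have := (hf n (g n)).2
    change IsMulStep W _ _ _ _ (g (n + 1)).1.2.1 (g (n + 1)).1.2.2 at this
    rw [← hg (n + 1), ← hg n] at this
    exact this

/-- If the products of linear forms agree up to a scalar and one of the factors is the same,
then the other factors agree up to a scalar. -/
lemma exists_smul_of_sym2 {F : Type*} [Field F] {p q r s a b k : F}
    (hab : a ≠ 0 ∨ b ≠ 0) (h0 : p * a = k * (r * a)) (h1 : p * b + q * a = k * (r * b + s * a))
    (h2 : q * b = k * (s * b)) : p = k * r ∧ q = k * s := by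
  by_cases hb : b = 0
  · have ha : a ≠ 0 := hab.resolve_right (by simp [hb])
    refine ⟨mul_right_cancel₀ ha (by linear_combination h0), mul_right_cancel₀ ha ?_⟩
    rw [hb] at h1
    linear_combination h1
  · have hq : q = k * s := mul_right_cancel₀ hb (by linear_combination h2)
    refine ⟨mul_right_cancel₀ hb ?_, hq⟩
    rw [hq] at h1
    linear_combination h1

variable {W}

open Affine Point in
/-- The polynomials of `exists_mulPoly` compute `x(nP)` for every affine point `P` over every
extension field. -/
theorem xRep_nsmul [W.IsElliptic] {a b : ℕ → L[X]} (a0 : a 0 = 1) (b0 : b 0 = 0) (a1 : a 1 = X)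
    (b1 : b 1 = 1) (hp : ∀ n, IsMulPair n (a n) (b n))
    (hs : ∀ n, IsMulStep W (a n) (b n) (a (n + 1)) (b (n + 1)) (a (n + 2)) (b (n + 2)))
    {F : Type*} [Field F] [DecidableEq F] [Algebra L F] {x y : F} (h : (W⁄F).Nonsingular x y)
    (n : ℕ) : ∃ k : F, k ≠ 0 ∧
      xRep (n • (some x y h)) = k • ![aeval x (a n), aeval x (b n)] := by
  have : (W⁄F).IsElliptic := inferInstanceAs (W.map (algebraMap L F)).IsElliptic
  set P : (W⁄F).Point := some x y h
  have hne (n : ℕ) : aeval x (a n) ≠ 0 ∨ aeval x (b n) ≠ 0 := by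
    by_contra! hc
    obtain ⟨u, v, huv⟩ := (hp n).coprime
    have := congrArg (aeval x) huv
    simp [hc] at this
  suffices ∀ n : ℕ, (∃ k : F, k ≠ 0 ∧ xRep (n • P) = k • ![aeval x (a n), aeval x (b n)]) ∧
      ∃ k : F, k ≠ 0 ∧ xRep ((n + 1) • P) = k • ![aeval x (a (n + 1)), aeval x (b (n + 1))] from
    (this n).1
  intro n
  induction n with
  | zero =>
    refine ⟨⟨1, one_ne_zero, ?_⟩, ⟨1, one_ne_zero, ?_⟩⟩
    · simp [a0, b0]
    · simp [a1, b1, P]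
  | succ n ih =>
    refine ⟨ih.2, ?_⟩
    obtain ⟨⟨k, hk, e⟩, k', hk', e'⟩ := ih
    obtain ⟨l, hl, el⟩ := sym2x_add_sub ((n + 1) • P) P
    rw [← succ_nsmul, add_smul n 1, one_smul, add_sub_cancel_right] at el
    rw [add_smul n 1, one_smul] at e'
    have hS := congrArg (aeval x) (hs n).mul_left
    have hT := congrArg (aeval x) (hs n).cross
    have hU := congrArg (aeval x) (hs n).mul_right
    simp only [addSubS, addSubT, addSubU, map_mul, map_add, map_sub, map_pow, aeval_X, map_b₂,
      map_b₄, map_b₆, map_b₈, aeval_C, map_ofNat, map_one] at hS hT hU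
    have s0 := congrFun el 0
    have s1 := congrFun el 1
    have s2 := congrFun el 2
    simp only [sym2x, e, e', P, xRep_some] at s0 s1 s2
    simp [addSubS, addSubT, addSubU, WeierstrassCurve.baseChange] at s0 s1 s2
    set p := xRep ((n + 1 + 1) • P) 0
    set q := xRep ((n + 1 + 1) • P) 1
    obtain ⟨r1, r2⟩ := exists_smul_of_sym2 (p := p) (q := q) (r := aeval x (a (n + 2)))
      (s := aeval x (b (n + 2))) (k := l * k' ^ 2 / k) (hne n)
      (by field_simp; linear_combination s0 - l * k' ^ 2 * hS)
      (by field_simp; linear_combination s1 - l * k' ^ 2 * hT)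
      (by field_simp; linear_combination s2 - l * k' ^ 2 * hU)
    refine ⟨_, div_ne_zero (mul_ne_zero hl (pow_ne_zero 2 hk')) hk, ?_⟩
    ext i
    fin_cases i
    · exact r1
    · exact r2

variable (W) in
/-- The numerator `aₙ` of `x(nP) = aₙ(x(P)) / bₙ(x(P))`. -/
def mulNum [W.IsElliptic] : ℕ → L[X] := (exists_mulPoly W).choose

variable (W) in
/-- The denominator `bₙ` of `x(nP) = aₙ(x(P)) / bₙ(x(P))`. -/
def mulDen [W.IsElliptic] : ℕ → L[X] := (exists_mulPoly W).choose_spec.choose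

variable [W.IsElliptic]

lemma isMulPair_mul (n : ℕ) : IsMulPair n (mulNum W n) (mulDen W n) :=
  (exists_mulPoly W).choose_spec.choose_spec.2.2.2.2.1 n

lemma mul_aeval_ne_zero (n : ℕ) {F : Type*} [Field F] [Algebra L F] (x : F) :
    aeval x (mulNum W n) ≠ 0 ∨ aeval x (mulDen W n) ≠ 0 := by
  by_contra! hc
  obtain ⟨u, v, huv⟩ := (isMulPair_mul (W := W) n).coprime
  have := congrArg (aeval x) huv
  simp [hc] at this

section
variable {F : Type*} [Field F] [DecidableEq F] [Algebra L F] {x y : F}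
open Affine Point

lemma xRep_nsmul_eq (h : (W⁄F).Nonsingular x y) (n : ℕ) : ∃ k : F, k ≠ 0 ∧
    xRep (n • (some x y h)) = k • ![aeval x (mulNum W n), aeval x (mulDen W n)] := by
  obtain ⟨a0, b0, a1, b1, hp, hs⟩ := (exists_mulPoly W).choose_spec.choose_spec
  exact xRep_nsmul a0 b0 a1 b1 hp hs h n

lemma nsmul_some_eq_zero_iff (h : (W⁄F).Nonsingular x y) (n : ℕ) :
    n • (some x y h) = 0 ↔ aeval x (mulDen W n) = 0 := by
  obtain ⟨k, hk, e⟩ := xRep_nsmul_eq h n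
  have e1 := congrFun e 1
  cases hP : n • (some x y h) with
  | zero =>
    rw [hP, ← zero_def] at e1
    simpa [hk, ← zero_def, eq_comm] using e1
  | some x' y' h' =>
    rw [hP] at e1
    refine iff_of_false (some_ne_zero _) fun h0 => ?_
    simp [h0] at e1

lemma aeval_mulNum_of_nsmul_eq (h : (W⁄F).Nonsingular x y) {n : ℕ} {x' y' : F}
    {h' : (W⁄F).Nonsingular x' y'} (e : n • (some x y h) = some x' y' h') :
    aeval x (mulNum W n) = x' * aeval x (mulDen W n) := by
  obtain ⟨k, hk, e2⟩ := xRep_nsmul_eq h n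
  rw [e] at e2
  have e0 := congrFun e2 0
  have e1 := congrFun e2 1
  simp at e0 e1
  apply mul_left_cancel₀ hk
  linear_combination -e0 + x' * e1

end

end MulPoly

/-! ### Counting torsion points over a separably closed field -/

section TorsionCount

variable {L : Type*} [Field L] {W : Affine L} [W.IsElliptic]

lemma Ψ₂Sq_ne_zero : WeierstrassCurve.Ψ₂Sq W ≠ 0 := by
  intro h
  have h3 := congrArg (coeff · 3) h
  have h2 := congrArg (coeff · 2) h
  have h1 := congrArg (coeff · 1) h
  have h0 := congrArg (coeff · 0) h
  simp [Ψ₂Sq, coeff_X, coeff_C] at h0 h1 h2 h3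
  refine W.isUnit_Δ.ne_zero ?_
  rw [Δ, h2, h0]
  linear_combination -2 * W.b₄ ^ 3 * h3

omit [W.IsElliptic] in
lemma eval_Ψ₂Sq {x y : L} (h : W.Equation x y) :
    (WeierstrassCurve.Ψ₂Sq W).eval x = (2 * y + W.a₁ * x + W.a₃) ^ 2 := by
  rw [Affine.equation_iff] at h
  simp only [Ψ₂Sq, eval_add, eval_mul, eval_pow, eval_C, eval_X, b₂, b₄, b₆]
  linear_combination -4 * h

/-- Every `x` which is not the `x`-coordinate of a `2`-torsion point lifts to a point. -/
lemma exists_nonsingular [IsSepClosed L] {x : L} (hx : (WeierstrassCurve.Ψ₂Sq W).eval x ≠ 0) :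
    ∃ y, W.Nonsingular x y := by
  set B := W.a₁ * x + W.a₃ with hB
  set c := x ^ 3 + W.a₂ * x ^ 2 + W.a₄ * x + W.a₆ with hc
  have hd : B ^ 2 + 4 * c ≠ 0 := by
    convert hx using 1
    simp only [Ψ₂Sq, eval_add, eval_mul, eval_pow, eval_C, eval_X, b₂, b₄, b₆, hB, hc]
    ring
  let p : L[X] := X ^ 2 + C B * X - C c
  have hp : p.natDegree = 2 := by simp only [p]; compute_degree!
  have hsep : p.Separable := by
    refine ⟨C (-4 / (B ^ 2 + 4 * c)), C (1 / (B ^ 2 + 4 * c)) * (2 * X + C B), ?_⟩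
    have hder : derivative p = 2 * X + C B := by
      simp only [p, derivative_sub, derivative_add, derivative_X_pow, derivative_C_mul_X,
        derivative_C]
      simp [map_ofNat C 2]
    have h1 : C (1 / (B ^ 2 + 4 * c)) * (C B ^ 2 + 4 * C c) = 1 := by
      rw [← C_pow, ← map_ofNat C 4, ← C_mul, ← C_add, ← C_mul, div_mul_cancel₀ 1 hd, C_1]
    rw [hder, show -4 / (B ^ 2 + 4 * c) = -4 * (1 / (B ^ 2 + 4 * c)) by ring, C_mul]
    simp only [p, C_neg, map_ofNat]
    linear_combination h1
  obtain ⟨y, hy⟩ := IsSepClosed.exists_root p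
    (by rw [degree_eq_natDegree (by rintro h; simp [h] at hp), hp]; decide) hsep
  refine ⟨y, Affine.equation_iff_nonsingular.1 ((Affine.equation_iff ..).2 ?_)⟩
  simp [p, IsRoot.def] at hy
  linear_combination hy

variable (W) in
/-- The values `c` over which the count of points with `x(nP) = c` may fail: `c` is the
`x`-coordinate of a `2`-torsion point, or `aₙ/bₙ` takes the value `c` at a point, possibly over the
algebraic closure, where its derivative vanishes or which is the `x`-coordinate of a `2`-torsion
point. -/
def badValues (n : ℕ) : Set L :=
  {c | (WeierstrassCurve.Ψ₂Sq W).eval c = 0 ∨ ∃ r : AlgebraicClosure L,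
    aeval r ((derivative (mulNum W n) * mulDen W n - mulNum W n * derivative (mulDen W n)) *
      WeierstrassCurve.Ψ₂Sq W) = 0 ∧
    aeval r (mulNum W n) = algebraMap L _ c * aeval r (mulDen W n)}

/-- The leading term of the numerator of the derivative of `aₙ/bₙ` is `n² x ^ (2n² - 2)`. -/
lemma wronskian_ne_zero {n : ℕ} (hn : (n : L) ≠ 0) :
    derivative (mulNum W n) * mulDen W n - mulNum W n * derivative (mulDen W n) ≠ 0 := by
  obtain ⟨-, hm, ha, hb, hc⟩ := isMulPair_mul (W := W) n
  have hn0 : n ≠ 0 := by rintro rfl; simp at hn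
  obtain ⟨k, hk⟩ : ∃ k, n ^ 2 = k + 1 := Nat.exists_eq_add_one.2 (by positivity)
  rw [hk] at ha hb hc
  rw [Nat.add_sub_cancel] at hb hc
  have hL : (n : L) ^ 2 = k + 1 := by exact_mod_cast congrArg (Nat.cast (R := L)) hk
  have ca : (mulNum W n).coeff (k + 1) = 1 := by rw [← ha]; exact hm
  have hda : (derivative (mulNum W n)).natDegree ≤ k := by
    have := natDegree_derivative_le (mulNum W n); omega
  have key : (derivative (mulNum W n) * mulDen W n -
      mulNum W n * derivative (mulDen W n)).coeff (k + k) = (n : L) ^ 2 := by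
    rw [coeff_sub, coeff_mul_add_eq_of_natDegree_le hda hb, coeff_derivative, ca, hc]
    rcases Nat.eq_zero_or_pos k with rfl | hk0
    · have : derivative (mulDen W n) = 0 := derivative_of_natDegree_zero (by omega)
      rw [this]
      simp
    · have hdb : (derivative (mulDen W n)).natDegree ≤ k - 1 := by
        have := natDegree_derivative_le (mulDen W n); omega
      rw [show k + k = (k + 1) + (k - 1) by omega,
        coeff_mul_add_eq_of_natDegree_le ha.le hdb, coeff_derivative, ca,
        show k - 1 + 1 = k by omega, hc]
      have : ((k - 1 : ℕ) : L) + 1 = k := by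
        exact_mod_cast congrArg (Nat.cast (R := L)) (show k - 1 + 1 = k by omega)
      rw [this]
      ring
  intro h
  rw [h, coeff_zero] at key
  exact pow_ne_zero 2 hn key.symm

lemma finite_badValues {n : ℕ} (hn : (n : L) ≠ 0) : (badValues W n).Finite := by
  set Q := (derivative (mulNum W n) * mulDen W n - mulNum W n * derivative (mulDen W n)) *
      WeierstrassCurve.Ψ₂Sq W
  have hQ : Q ≠ 0 := mul_ne_zero (wronskian_ne_zero hn) Ψ₂Sq_ne_zero
  have h1 : {c : L | (WeierstrassCurve.Ψ₂Sq W).eval c = 0}.Finite :=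
    (finite_setOfPred_isRoot Ψ₂Sq_ne_zero)
  refine h1.union ?_
  have h2 : (Q.rootSet (AlgebraicClosure L)).Finite := rootSet_finite _ _
  refine Set.Finite.of_finite_image (f := algebraMap L (AlgebraicClosure L)) ((h2.image fun r =>
    aeval r (mulNum W n) / aeval r (mulDen W n)).subset ?_)
    (FaithfulSMul.algebraMap_injective L (AlgebraicClosure L)).injOn
  rintro _ ⟨c, ⟨r, hr, hc⟩, rfl⟩
  refine ⟨r, (mem_rootSet_of_ne hQ).2 hr, ?_⟩
  have : aeval r (mulDen W n) ≠ 0 := by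
    intro h0
    rw [h0, mul_zero] at hc
    rcases mul_aeval_ne_zero (W := W) n r with h | h
    · exact h hc
    · exact h h0
  simp only
  rw [hc, mul_div_cancel_right₀ _ this]

lemma natDegree_mulNum_sub {n : ℕ} (hn : n ≠ 0) (c : L) :
    (mulNum W n - C c * mulDen W n).natDegree = n ^ 2 := by
  obtain ⟨-, hm, ha, hb, hc⟩ := isMulPair_mul (W := W) n
  have : 0 < n ^ 2 := by positivity
  rw [natDegree_sub_eq_left_of_natDegree_lt, ha]
  rw [ha]
  exact (natDegree_C_mul_le _ _).trans_lt (by omega)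

lemma separable_mulNum_sub {n : ℕ} {c : L} (hc : c ∉ badValues W n) :
    (mulNum W n - C c * mulDen W n).Separable := by
  rw [Polynomial.Separable,
    isCoprime_iff_aeval_ne_zero_of_isAlgClosed L (AlgebraicClosure L)]
  intro r
  by_contra! h
  refine hc (Or.inr ⟨r, ?_, ?_⟩)
  · obtain ⟨h1, h2⟩ := h
    simp only [derivative_mul, derivative_C, zero_mul, zero_add, map_sub, map_mul,
      aeval_C] at h1 h2 ⊢
    linear_combination (aeval r (mulDen W n) * h2 - aeval r (derivative (mulDen W n)) * h1) *
      aeval r (WeierstrassCurve.Ψ₂Sq W)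
  · have := h.1
    simp only [map_sub, map_mul, aeval_C] at this
    linear_combination this

section Extension

variable [DecidableEq L] (F : Type*) [Field F] [DecidableEq F] [Algebra L F]

open Affine Point

variable (W) in
omit [W.IsElliptic] in
/-- The inclusion of the points over `L` into the points over an extension field. -/
def constPoint : W.Point →+ (W⁄F).Point := Point.map (W' := W) (S := L) (F := L) (Algebra.ofId L F)

omit [W.IsElliptic] in
lemma constPoint_injective : Function.Injective (constPoint W F) := Point.map_injective _

omit [DecidableEq L] [DecidableEq F] [W.IsElliptic] in
lemma nonsingular_algebraMap {x y : L} (h : W.Nonsingular x y) :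
    (W⁄F).Nonsingular (algebraMap L F x) (algebraMap L F y) :=
  (W.map_nonsingular (FaithfulSMul.algebraMap_injective L F) x y).2 h

omit [W.IsElliptic] in
lemma constPoint_some {x y : L} (h : W.Nonsingular x y) :
    constPoint W F (some x y h) = some _ _ (nonsingular_algebraMap F h) := rfl

end Extension

variable [DecidableEq L]

open Affine Point

omit [DecidableEq L] [W.IsElliptic] in
lemma some_ne_neg {x y : L} (h : W.Nonsingular x y) (hx : (WeierstrassCurve.Ψ₂Sq W).eval x ≠ 0) :
    some x y h ≠ -some x y h := by
  intro h'
  rw [neg_some, some.injEq] at h'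
  have := h'.2
  rw [negY] at this
  apply hx
  rw [eval_Ψ₂Sq h.1, show 2 * y + W.a₁ * x + W.a₃ = 0 by linear_combination this]
  ring

/-- Away from finitely many `x`-coordinates, the fibres of multiplication by `n` have `n²`
elements. -/
lemma card_fibre [IsSepClosed L] {n : ℕ} (hn : n ≠ 0) {c d : L} (h : W.Nonsingular c d)
    (hc : c ∉ badValues W n) : Nat.card {P : W.Point // n • P = some c d h} = n ^ 2 := by
  classical
  set C₀ := some c d h
  set p := mulNum W n - C c * mulDen W n with hp
  have hsep : p.Separable := separable_mulNum_sub hc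
  have hcard : p.roots.toFinset.card = n ^ 2 := by
    rw [Multiset.toFinset_card_of_nodup (nodup_roots hsep),
      ← (IsSepClosed.splits_of_separable p hsep).natDegree_eq_card_roots,
      natDegree_mulNum_sub hn]
  have hp0 : p ≠ 0 := hsep.ne_zero
  rw [← hcard, ← Nat.card_eq_finsetCard]
  have hC : C₀ ≠ -C₀ := some_ne_neg h fun h0 => hc (Or.inl h0)
  have hroot {x y : L} (hxy : W.Nonsingular x y) (e : n • some x y hxy = C₀) : p.IsRoot x := by
    have := aeval_mulNum_of_nsmul_eq (W := W) (F := L) hxy e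
    simp only [coe_aeval_eq_eval] at this
    simp [hp, IsRoot.def, this]
  have hn0 (P : W.Point) (hP : n • P = C₀) : P ≠ 0 := by
    rintro rfl
    rw [smul_zero] at hP
    exact some_ne_zero h hP.symm
  refine Nat.card_eq_of_bijective (fun P => ⟨xRep P.1 0, ?_⟩) ⟨?_, ?_⟩
  · obtain ⟨_ | ⟨x, y, hxy⟩, hP⟩ := P
    · exact absurd rfl (hn0 _ hP)
    · simpa [hp0] using hroot hxy hP
  · rintro ⟨P, hP⟩ ⟨Q, hQ⟩ hPQ
    rcases P with _ | ⟨x, y, hxy⟩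
    · exact absurd rfl (hn0 _ hP)
    rcases Q with _ | ⟨x', y', hxy'⟩
    · exact absurd rfl (hn0 _ hQ)
    simp only [Subtype.mk.injEq, xRep_some, Matrix.cons_val_zero] at hPQ
    rcases X_eq_iff (h₁ := hxy) (h₂ := hxy').1 hPQ with h1 | h1
    · exact Subtype.ext h1
    · rw [h1, smul_neg, hQ] at hP
      exact absurd hP.symm hC
  · rintro ⟨r, hr⟩
    have hr' : p.eval r = 0 := by simpa [hp0] using hr
    have hr2 : (mulNum W n).eval r = c * (mulDen W n).eval r := by
      simp [hp] at hr'; linear_combination hr'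
    have hΨ : (WeierstrassCurve.Ψ₂Sq W).eval r ≠ 0 := by
      intro h0
      refine hc (Or.inr ⟨algebraMap L _ r, ?_, ?_⟩)
      · rw [aeval_algebraMap_apply, coe_aeval_eq_eval, eval_mul, h0, mul_zero, _root_.map_zero]
      · simp only [aeval_algebraMap_apply, coe_aeval_eq_eval, hr2, map_mul]
    obtain ⟨y, hy⟩ := exists_nonsingular hΨ
    have hx : ∃ (y' : L) (h' : W.Nonsingular c y'), n • some r y hy = some c y' h' := by
      obtain ⟨k, hk, e⟩ := xRep_nsmul_eq (W := W) (F := L) hy n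
      simp only [coe_aeval_eq_eval, hr2] at e
      have hne := mul_aeval_ne_zero (W := W) n r
      simp only [coe_aeval_eq_eval, hr2] at hne
      have hne' : (mulDen W n).eval r ≠ 0 := by
        intro h0; simp [h0] at hne
      have e0 := congrFun e 0
      have e1 := congrFun e 1
      cases hP : n • (some r y hy : (W⁄L).Point) with
      | zero =>
        rw [hP, ← zero_def] at e1
        simp [hk, hne'] at e1
      | some x' y' h' =>
        rw [hP] at e0 e1
        simp at e0 e1
        have : x' = c := by rw [e0]; linear_combination c * (-e1)
        subst this
        exact ⟨y', h', hP⟩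
    obtain ⟨y', h', e⟩ := hx
    rcases X_eq_iff (h₁ := h') (h₂ := h).1 rfl with h1 | h1
    · exact ⟨⟨some r y hy, e.trans h1⟩, by simp⟩
    · exact ⟨⟨-some r y hy, by rw [smul_neg, e, h1, neg_neg]⟩, by simp⟩

omit [DecidableEq L] in
lemma exists_point_notMem [IsSepClosed L] {s : Set L} (hs : s.Finite) :
    ∃ (x y : L) (_ : W.Nonsingular x y), x ∉ s := by
  have : Infinite L := by
    rw [← not_finite_iff_infinite]
    intro hf
    exact not_finite_iff_infinite.2 (IsAlgClosed.instInfinite (K := L)) hf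
  obtain ⟨x, hx⟩ := (hs.union (finite_setOfPred_isRoot (Ψ₂Sq_ne_zero (W := W)))).exists_notMem
  rw [Set.mem_union, not_or] at hx
  obtain ⟨y, hy⟩ := exists_nonsingular (W := W) hx.2
  exact ⟨x, y, hy, hx.1⟩

omit [DecidableEq L] [W.IsElliptic] in
/-- Only finitely many points have their `x`-coordinate in a given finite set. -/
lemma finite_setOf_xRep_mem {s : Set L} (hs : s.Finite) :
    {P : W.Point | P = 0 ∨ xRep P 0 ∈ s}.Finite := by
  have h (x : L) : {P : W.Point | xRep P = ![x, 1]}.Finite := by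
    rcases Set.eq_empty_or_nonempty {P : W.Point | xRep P = ![x, 1]} with h | ⟨P, hP⟩
    · rw [h]; exact Set.finite_empty
    · refine (Set.toFinite {P, -P}).subset fun Q hQ => ?_
      exact eq_or_eq_neg_of_xRep_eq_xRep (Eq.trans hQ (Eq.symm hP))
  refine ((Set.finite_singleton 0).union (hs.biUnion fun x _ => h x)).subset ?_
  rintro (_ | ⟨x, y, hxy⟩) (hP | hP)
  · exact Or.inl rfl
  · exact Or.inl rfl
  · exact absurd hP (some_ne_zero _)
  · exact Or.inr (Set.mem_biUnion hP (by simp))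

omit [DecidableEq L] in
variable (W) in
lemma infinite_point [IsSepClosed L] : Infinite W.Point := by
  rw [← not_finite_iff_infinite]
  intro hf
  obtain ⟨x, y, h, hx⟩ := exists_point_notMem (W := W)
    ((Set.finite_univ (α := W.Point)).image fun P => xRep P 0)
  exact hx ⟨some x y h, trivial, by simp⟩

/-- Multiplication by `n` is surjective on points over a separably closed field. -/
theorem nsmul_surjective [IsSepClosed L] {n : ℕ} (hn : (n : L) ≠ 0) :
    Function.Surjective fun P : W.Point => n • P := by
  have hn0 : n ≠ 0 := by rintro rfl; simp at hn
  have hbad := finite_setOf_xRep_mem (W := W) (finite_badValues (W := W) hn)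
  have hgood (C₀ : W.Point) (h : C₀ ∉ {P : W.Point | P = 0 ∨ xRep P 0 ∈ badValues W n}) :
      ∃ P, n • P = C₀ := by
    rcases C₀ with _ | ⟨x, y, hxy⟩
    · exact absurd (Or.inl rfl) h
    · have := card_fibre hn0 hxy fun hx => h (Or.inr (by simpa using hx))
      have h2 : Nat.card {P : W.Point // n • P = some x y hxy} ≠ 0 := by
        rw [this]; positivity
      obtain ⟨⟨P, hP⟩⟩ := (Nat.card_ne_zero.1 h2).1
      exact ⟨P, hP⟩
  intro T
  have := infinite_point W
  -- Both `Q` and `T - Q` can be chosen with well behaved fibres.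
  obtain ⟨Q, hQ⟩ := (hbad.union (hbad.image (T - ·))).exists_notMem
  rw [Set.mem_union, not_or] at hQ
  obtain ⟨P₁, h₁⟩ := hgood Q hQ.1
  obtain ⟨P₂, h₂⟩ := hgood (T - Q) fun h => hQ.2 ⟨_, h, sub_sub_cancel T Q⟩
  exact ⟨P₁ + P₂, by simp only [smul_add, h₁, h₂, add_sub_cancel]⟩

/-- All fibres of multiplication by `n` have `n²` elements. -/
theorem card_nsmul_eq [IsSepClosed L] {n : ℕ} (hn : (n : L) ≠ 0) (T : W.Point) :
    Nat.card {P : W.Point // n • P = T} = n ^ 2 := by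
  have hn0 : n ≠ 0 := by rintro rfl; simp at hn
  obtain ⟨x, y, h, hx⟩ := exists_point_notMem (W := W) (finite_badValues (W := W) hn)
  rw [← card_fibre hn0 h hx]
  obtain ⟨P₁, h₁⟩ := nsmul_surjective hn T
  obtain ⟨P₂, h₂⟩ := nsmul_surjective hn (some x y h)
  refine Nat.card_congr ((Equiv.addRight (P₂ - P₁)).subtypeEquiv fun P => ?_)
  simp only [Equiv.coe_addRight] at h₁ h₂ ⊢
  rw [smul_add, smul_sub, h₁, h₂, ← sub_eq_zero, ← sub_eq_zero (b := some x y h)]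
  congr! 1
  abel

lemma finite_nsmul_eq [IsSepClosed L] {n : ℕ} (hn : (n : L) ≠ 0) (T : W.Point) :
    {P : W.Point | n • P = T}.Finite := by
  have hn0 : n ≠ 0 := by rintro rfl; simp at hn
  refine Set.finite_coe_iff.1 (Nat.finite_of_card_ne_zero ?_)
  have : Nat.card {P : W.Point // n • P = T} ≠ 0 := by
    rw [card_nsmul_eq hn]; positivity
  exact this

/-- The denominator of `x(nP)` splits, its roots being the `x`-coordinates of the nonzero
`n`-torsion points. -/
theorem exists_root_of_mulDen [IsSepClosed L] {n : ℕ} (hn : (n : L) ≠ 0) :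
    (mulDen W n).Splits ∧ ∀ r, (mulDen W n).eval r = 0 →
      ∃ (y : L) (h : W.Nonsingular r y), n • (some r y h : W.Point) = 0 := by
  classical
  let F := AlgebraicClosure L
  have hinj := FaithfulSMul.algebraMap_injective L F
  have : (W⁄F).IsElliptic := inferInstanceAs (W.map (algebraMap L F)).IsElliptic
  have hnF : (n : F) ≠ 0 := by
    rw [← map_natCast (algebraMap L F)]
    exact (_root_.map_ne_zero _).2 hn
  -- Both groups of `n`-torsion points have `n²` elements, so all torsion is defined over `L`.
  have htors (Q : (W⁄F).Point) (hQ : n • Q = 0) : ∃ P : W.Point, n • P = 0 ∧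
      constPoint W F P = Q := by
    have : Finite {P : W.Point // n • P = 0} := (finite_nsmul_eq (W := W) hn 0).to_subtype
    have : Finite {Q : (W⁄F).Point // n • Q = 0} := (finite_nsmul_eq hnF 0).to_subtype
    let φ : {P : W.Point // n • P = 0} → {Q : (W⁄F).Point // n • Q = 0} := fun P =>
      ⟨constPoint W F P.1, by rw [← map_nsmul, P.2, _root_.map_zero]⟩
    have hφ : Function.Injective φ := fun P Q h =>
      Subtype.ext (constPoint_injective F (congrArg Subtype.val h))
    have hbij : Function.Bijective φ := (Nat.bijective_iff_injective_and_card φ).2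
      ⟨hφ, by rw [card_nsmul_eq hn, card_nsmul_eq hnF]⟩
    obtain ⟨P, hP⟩ := hbij.2 ⟨Q, hQ⟩
    exact ⟨P.1, P.2, congrArg Subtype.val hP⟩
  have hroot (r : F) (hr : aeval r (mulDen W n) = 0) :
      ∃ (x y : L) (h : W.Nonsingular x y), n • (some x y h : W.Point) = 0 ∧
        algebraMap L F x = r := by
    obtain ⟨s, hs⟩ : ∃ s, (W⁄F).Nonsingular r s := by
      let p : F[X] := X ^ 2 + C ((W⁄F).a₁ * r + (W⁄F).a₃) * X -
        C (r ^ 3 + (W⁄F).a₂ * r ^ 2 + (W⁄F).a₄ * r + (W⁄F).a₆)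
      have hp : p.natDegree = 2 := by simp only [p]; compute_degree!
      obtain ⟨y, hy⟩ := IsAlgClosed.exists_root p
        (by rw [degree_eq_natDegree (by rintro h; simp [h] at hp), hp]; decide)
      refine ⟨y, Affine.equation_iff_nonsingular.1 ((Affine.equation_iff ..).2 ?_)⟩
      simp only [p, IsRoot.def, eval_add, eval_sub, eval_mul, eval_pow, eval_X, eval_C] at hy
      linear_combination hy
    obtain ⟨P, hP, e⟩ := htors (some r s hs) ((nsmul_some_eq_zero_iff (W := W) hs n).2 hr)
    rcases P with _ | ⟨x, y, h⟩
    · exact absurd e.symm (some_ne_zero _)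
    · exact ⟨x, y, h, hP, (some.inj e).1⟩
  refine ⟨?_, fun r hr => ?_⟩
  · refine Splits.of_splits_map (algebraMap L F) (IsAlgClosed.splits _) fun r hr => ?_
    have hr0 : aeval r (mulDen W n) = 0 := by
      rw [← eval_map_algebraMap]; exact isRoot_of_mem_roots hr
    obtain ⟨x, -, -, -, h⟩ := hroot r hr0
    exact ⟨x, h⟩
  · obtain ⟨x, y, h, h1, h2⟩ := hroot (algebraMap L F r)
      (by rw [aeval_algebraMap_apply, coe_aeval_eq_eval, hr, _root_.map_zero])
    obtain rfl := hinj h2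
    exact ⟨y, h, h1⟩

end TorsionCount

/-! ### The function field and the place at infinity -/

section FunctionField

variable {L : Type*} [Field L] (W : Affine L)

open Affine CoordinateRing

instance : DecidableEq W.FunctionField := Classical.decEq _

/-- The coordinate function `x`. -/
def xF : W.FunctionField := algebraMap W.CoordinateRing _ (mk W (C X))

/-- The coordinate function `y`. -/
def yF : W.FunctionField := algebraMap W.CoordinateRing _ (mk W X)

lemma algebraMap_mk_C (p : L[X]) :
    algebraMap W.CoordinateRing W.FunctionField (mk W (C p)) = aeval (xF W) p := by
  have h : algebraMap W.CoordinateRing W.FunctionField (mk W (C p)) =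
      ((algebraMap W.CoordinateRing W.FunctionField).comp ((CoordinateRing.mk W).comp C)) p := rfl
  rw [h]
  induction p using Polynomial.induction_on' with
  | add p q hp hq => simp only [map_add, hp rfl, hq rfl]
  | monomial n a =>
    rw [← C_mul_X_pow_eq_monomial]
    simp only [map_mul, map_pow, aeval_X, aeval_C]
    rfl

variable {W}

lemma algebraMap_smul_add_smul (p q : L[X]) :
    algebraMap W.CoordinateRing W.FunctionField (p • 1 + q • mk W X) =
      aeval (xF W) p + aeval (xF W) q * yF W := by
  rw [CoordinateRing.smul, CoordinateRing.smul, mul_one, map_add, map_mul, algebraMap_mk_C,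
    algebraMap_mk_C]
  rfl

lemma exists_eq_add_mul_y (a : W.CoordinateRing) : ∃ p q : L[X],
    algebraMap W.CoordinateRing W.FunctionField a = aeval (xF W) p + aeval (xF W) q * yF W := by
  obtain ⟨p, q, rfl⟩ := exists_smul_basis_eq a
  exact ⟨p, q, algebraMap_smul_add_smul p q⟩

lemma algebraMap_coordinateRing_injective :
    Function.Injective (algebraMap W.CoordinateRing W.FunctionField) :=
  IsFractionRing.injective _ _

lemma aeval_xF_eq_zero {p : L[X]} : aeval (xF W) p = 0 ↔ p = 0 := by
  refine ⟨fun h => ?_, fun h => by simp [h]⟩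
  rw [← algebraMap_mk_C, ← map_zero (algebraMap W.CoordinateRing W.FunctionField)] at h
  have := algebraMap_coordinateRing_injective h
  refine (smul_basis_eq_zero (W' := W) (p := p) (q := 0) ?_).1
  rw [CoordinateRing.smul, this]
  simp

lemma xF_sub_ne_zero (c : L) : xF W - algebraMap L _ c ≠ 0 := by
  have := (aeval_xF_eq_zero (W := W) (p := X - C c)).not.2 (X_sub_C_ne_zero c)
  simpa using this

lemma xF_ne_algebraMap (c : L) : xF W ≠ algebraMap L _ c := sub_ne_zero.1 (xF_sub_ne_zero c)

lemma equation_xF_yF : (W⁄W.FunctionField).Equation (xF W) (yF W) := by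
  have h : algebraMap W.CoordinateRing W.FunctionField (mk W W.polynomial) = 0 := by
    rw [AdjoinRoot.mk_self, map_zero]
  rw [equation_iff]
  have e : mk W W.polynomial = mk W X ^ 2 + mk W (C (C W.a₁ * X + C W.a₃)) * mk W X -
      mk W (C (X ^ 3 + C W.a₂ * X ^ 2 + C W.a₄ * X + C W.a₆)) := by
    rw [← map_pow, ← map_mul, ← map_add, ← map_sub]; rfl
  rw [e, map_sub, map_add, map_mul, map_pow, algebraMap_mk_C, algebraMap_mk_C] at h
  simp only [map_add, map_mul, map_pow, aeval_X, aeval_C] at h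
  change yF W ^ 2 + (algebraMap L _ W.a₁ * xF W + algebraMap L _ W.a₃) * yF W - _ = 0 at h
  change yF W ^ 2 + algebraMap L _ W.a₁ * xF W * yF W + algebraMap L _ W.a₃ * yF W =
    xF W ^ 3 + algebraMap L _ W.a₂ * xF W ^ 2 + algebraMap L _ W.a₄ * xF W + algebraMap L _ W.a₆
  linear_combination h

instance [W.IsElliptic] (F : Type*) [Field F] [Algebra L F] : (W⁄F).IsElliptic :=
  inferInstanceAs (W.map (algebraMap L F)).IsElliptic

variable (W) in
/-- The generic point of the curve, defined over the function field. -/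
def genericPoint [W.IsElliptic] : (W⁄W.FunctionField).Point :=
  .some (xF W) (yF W) (equation_iff_nonsingular.1 equation_xF_yF)

instance : Module.Finite L[X] W.CoordinateRing := .of_basis (CoordinateRing.basis W)

variable (W) in
/-- The pole order at infinity of a regular function on the affine curve, written as a valuation. It
is the degree of the norm to `L[X]`. -/
def ordInfAffine : Valuation W.CoordinateRing (WithZero (Multiplicative ℤ)) where
  toFun a := if a = 0 then 0 else WithZero.exp ((Algebra.norm L[X] a).natDegree : ℤ)
  map_zero' := by simp
  map_one' := by simp
  map_mul' a b := by
    by_cases ha : a = 0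
    · simp [ha]
    by_cases hb : b = 0
    · simp [hb]
    have ha' : Algebra.norm L[X] a ≠ 0 := Algebra.norm_ne_zero_iff.2 ha
    have hb' : Algebra.norm L[X] b ≠ 0 := Algebra.norm_ne_zero_iff.2 hb
    simp only [mul_eq_zero, ha, hb, or_self, if_false, map_mul, natDegree_mul ha' hb',
      Nat.cast_add, WithZero.exp_add]
  map_add_le_max' a b := by
    by_cases ha : a = 0
    · simp [ha]
    by_cases hb : b = 0
    · simp [hb]
    by_cases hab : a + b = 0
    · simp [hab]
    simp only [ha, hb, hab, if_false, le_max_iff, WithZero.exp_le_exp, Nat.cast_le]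
    suffices H : (Algebra.norm L[X] (a + b)).degree ≤
        max (Algebra.norm L[X] a).degree (Algebra.norm L[X] b).degree from
      (le_max_iff.1 H).imp natDegree_le_natDegree natDegree_le_natDegree
    clear ha hb hab
    obtain ⟨p, q, rfl⟩ := exists_smul_basis_eq a
    obtain ⟨r, s, rfl⟩ := exists_smul_basis_eq b
    have e : p • (1 : W.CoordinateRing) + q • mk W X + (r • 1 + s • mk W X) =
        (p + r) • 1 + (q + s) • mk W X := by
      rw [add_smul, add_smul]; abel
    rw [e, degree_norm_smul_basis, degree_norm_smul_basis, degree_norm_smul_basis]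
    have h1 := degree_add_le p r
    have h2 := degree_add_le q s
    have mono {u v w : WithBot ℕ} (h : u ≤ max v w) : 2 • u ≤ max (2 • v) (2 • w) := by
      rcases le_max_iff.1 h with h | h
      · exact (nsmul_le_nsmul_right h 2).trans (le_max_left _ _)
      · exact (nsmul_le_nsmul_right h 2).trans (le_max_right _ _)
    refine max_le ((mono h1).trans ?_) ?_
    · exact max_le_max (le_max_left _ _) (le_max_left _ _)
    · calc 2 • (q + s).degree + 3 ≤ max (2 • q.degree) (2 • s.degree) + 3 := by
            gcongr; exact mono h2
        _ = max (2 • q.degree + 3) (2 • s.degree + 3) := by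
            rcases le_total (2 • q.degree) (2 • s.degree) with h | h
            · rw [max_eq_right h, max_eq_right (by gcongr)]
            · rw [max_eq_left h, max_eq_left (by gcongr)]
        _ ≤ _ := max_le_max (le_max_right _ _) (le_max_right _ _)

variable (W) in
/-- The valuation of the function field at the point at infinity, normalised such that a function
with a pole of order `k` has valuation `exp k`. -/
def ordInf : Valuation W.FunctionField (WithZero (Multiplicative ℤ)) :=
  (ordInfAffine W).extendToLocalization (S := W.CoordinateRing⁰) (fun a ha => by
    change ordInfAffine W a ≠ 0
    simp [ordInfAffine, nonZeroDivisors.ne_zero ha]) W.FunctionField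

lemma ordInf_algebraMap {a : W.CoordinateRing} (ha : a ≠ 0) :
    ordInf W (algebraMap _ _ a) = WithZero.exp ((Algebra.norm L[X] a).natDegree : ℤ) := by
  rw [ordInf, Valuation.extendToLocalization_apply_map_apply]
  exact if_neg ha

lemma ordInf_aeval {p : L[X]} (hp : p ≠ 0) :
    ordInf W (aeval (xF W) p) = WithZero.exp (2 * p.natDegree : ℤ) := by
  have h0 : mk W (C p) ≠ 0 := by
    intro h
    refine hp ((aeval_xF_eq_zero (W := W)).1 ?_)
    rw [← algebraMap_mk_C, h, map_zero]
  rw [← algebraMap_mk_C, ordInf_algebraMap h0]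
  have : mk W (C p) = p • 1 + (0 : L[X]) • mk W X := by simp [CoordinateRing.smul]
  rw [this, norm_smul_basis]
  simp

lemma ordInf_xF_sub (c : L) : ordInf W (xF W - algebraMap L _ c) = WithZero.exp 2 := by
  have := ordInf_aeval (W := W) (X_sub_C_ne_zero c)
  simpa using this

lemma ordInf_const {c : L} (hc : c ≠ 0) : ordInf W (algebraMap L _ c) = 1 := by
  have := ordInf_aeval (W := W) (C_ne_zero.2 hc)
  simpa using this

lemma ordInf_yF : ordInf W (yF W) = WithZero.exp 3 := by
  have e : mk W X = (0 : L[X]) • 1 + (1 : L[X]) • mk W X := by simp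
  have h0 : mk W X ≠ 0 := fun h => by
    have := smul_basis_eq_zero (e.symm.trans h)
    exact one_ne_zero this.2
  rw [yF, ordInf_algebraMap h0]
  congr 1
  have := degree_norm_smul_basis (W' := W) 0 1
  rw [← e] at this
  have : (Algebra.norm L[X] (mk W X)).natDegree = 3 := by
    apply natDegree_eq_of_degree_eq_some
    rw [this]; simp
  exact_mod_cast this

/-- A regular function without pole at infinity is constant. -/
lemma exists_const_of_ordInf_le_one {a : W.CoordinateRing}
    (h : ordInf W (algebraMap _ _ a) ≤ 1) :
    ∃ c : L, algebraMap _ W.FunctionField a = algebraMap L _ c := by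
  by_cases ha : a = 0
  · exact ⟨0, by simp [ha]⟩
  rw [ordInf_algebraMap ha, ← WithZero.exp_zero, WithZero.exp_le_exp] at h
  have hd : (Algebra.norm L[X] a).degree ≤ 0 := natDegree_eq_zero_iff_degree_le_zero.1 (by omega)
  obtain ⟨p, q, rfl⟩ := exists_smul_basis_eq a
  rw [degree_norm_smul_basis, max_le_iff] at hd
  have hq : q = 0 := by
    by_contra hq
    rw [degree_eq_natDegree hq] at hd
    have := hd.2
    norm_cast at this
  have hp : p.degree ≤ 0 := by
    by_contra hp
    have h2 : p.degree ≤ 2 • p.degree := by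
      rw [two_nsmul]; exact le_add_of_nonneg_left (not_le.1 hp).le
    exact hp (h2.trans hd.1)
  refine ⟨p.coeff 0, ?_⟩
  rw [algebraMap_smul_add_smul, hq, eq_C_of_degree_le_zero hp]
  simp

/-- The valuations of polynomials in an element of the valuation ring are at most `1`. -/
lemma ordInf_aeval_le_one {z : W.FunctionField} (hz : ordInf W z ≤ 1) (p : L[X]) :
    ordInf W (aeval z p) ≤ 1 := by
  have hc (c : L) : ordInf W (algebraMap L _ c) ≤ 1 := by
    by_cases h : c = 0
    · simp [h]
    · exact (ordInf_const h).le
  induction p using Polynomial.induction_on' with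
  | add p q hp hq => rw [map_add]; exact (Valuation.map_add _ _ _).trans (max_le hp hq)
  | monomial n a =>
    rw [aeval_monomial, map_mul, map_pow]
    exact mul_le_one' (hc a) (pow_le_one' hz n)

lemma ordInf_const_le_one (c : L) : ordInf W (algebraMap L _ c) ≤ 1 := by
  simpa using ordInf_aeval_le_one (W := W) (z := 0) (by simp) (C c)

/-- A function taking a constant value at infinity without being constant is transcendental. -/
lemma transcendental_of_ordInf_sub_lt_one {z : W.FunctionField} {c : L}
    (hz : z ≠ algebraMap L _ c) (h : ordInf W (z - algebraMap L _ c) < 1) :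
    Transcendental L z := by
  intro hal
  set u := z - algebraMap L _ c with hu
  have hu0 : u ≠ 0 := sub_ne_zero.2 hz
  have hint : IsIntegral L u := (hal.sub (isAlgebraic_algebraMap c)).isIntegral
  have h0 := minpoly.coeff_zero_ne_zero hint hu0
  have h1 := minpoly.aeval L u
  rw [← divX_mul_X_add (minpoly L u)] at h1
  simp only [map_add, map_mul, aeval_X, aeval_C] at h1
  have h2 : ordInf W (aeval u (minpoly L u).divX * u) < 1 := by
    rw [map_mul]
    calc _ ≤ 1 * ordInf W u := mul_le_mul_left (ordInf_aeval_le_one h.le _) _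
      _ < 1 := by rwa [one_mul]
  rw [eq_neg_of_add_eq_zero_left h1, Valuation.map_neg, ordInf_const h0] at h2
  exact lt_irrefl _ h2

end FunctionField

/-! ### Translations of the function field -/

section Translation

variable {L : Type*} [Field L] {W : Affine L}

open Affine CoordinateRing Point

/-- A homomorphism on the coordinate ring is injective once the image of `x` is transcendental, as
every nonzero regular function divides a nonzero polynomial in `x`. -/
lemma injective_of_transcendental {B : Type*} [CommRing B] [IsDomain B] [Algebra L B]
    (f : W.CoordinateRing →ₐ[L] B)
    (h : Transcendental L (f (CoordinateRing.mk W (C X)))) : Function.Injective f := by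
  have : Algebra.IsIntegral L[X] W.CoordinateRing := inferInstance
  rw [injective_iff_map_eq_zero]
  have key : RingHom.ker f.toRingHom = ⊥ := by
    refine Ideal.eq_bot_of_comap_eq_bot (R := L[X]) ?_
    rw [eq_bot_iff]
    intro p hp
    have e : f (CoordinateRing.mk W (C p)) = aeval (f (CoordinateRing.mk W (C X))) p := by
      have e1 : CoordinateRing.mk W (C p) = aeval (CoordinateRing.mk W (C X)) p := by
        apply algebraMap_coordinateRing_injective
        rw [algebraMap_mk_C, ← aeval_algebraMap_apply]; rfl
      rw [e1, ← aeval_algHom_apply]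
    have hp' : f (CoordinateRing.mk W (C p)) = 0 := hp
    rw [e] at hp'
    exact (transcendental_iff.1 h) p hp'
  intro a ha
  have : a ∈ RingHom.ker f.toRingHom := ha
  rwa [key] at this

variable [W.IsElliptic]

/-- A point of the curve over its function field with transcendental `x`-coordinate is the image of
the generic point under an endomorphism of the function field. -/
lemma exists_algHom {x y : W.FunctionField} (h : (W⁄W.FunctionField).Nonsingular x y)
    (hx : Transcendental L x) : ∃ φ : W.FunctionField →ₐ[L] W.FunctionField,
      Point.map (W' := W) φ (genericPoint W) = .some x y h := by
  have h0 : W.polynomial.eval₂ (aeval x : L[X] →ₐ[L] W.FunctionField).toRingHom y = 0 := by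
    have := (equation_iff ..).1 h.1
    simp only [Affine.polynomial, eval₂_add, eval₂_sub, eval₂_mul, eval₂_pow, eval₂_X, eval₂_C]
    simp only [AlgHom.toRingHom_eq_coe, RingHom.coe_coe, map_add, map_mul, map_pow, aeval_X,
      aeval_C]
    change y ^ 2 + algebraMap L _ W.a₁ * x * y + algebraMap L _ W.a₃ * y =
      x ^ 3 + algebraMap L _ W.a₂ * x ^ 2 + algebraMap L _ W.a₄ * x + algebraMap L _ W.a₆ at this
    linear_combination this
  let f : W.CoordinateRing →ₐ[L] W.FunctionField :=
    AdjoinRoot.liftAlgHom W.polynomial (aeval x) y h0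
  have fx : f (CoordinateRing.mk W (C X)) = x :=
    (AdjoinRoot.liftAlgHom_of W.polynomial (aeval x) y h0 X).trans (aeval_X x)
  have fy : f (CoordinateRing.mk W X) = y :=
    AdjoinRoot.liftAlgHom_root W.polynomial (aeval x) y h0
  have hf : Function.Injective f := injective_of_transcendental f (by rwa [fx])
  refine ⟨IsFractionRing.liftAlgHom (K := W.FunctionField) hf, ?_⟩
  rw [genericPoint, map_some, some.injEq]
  refine ⟨?_, ?_⟩
  · rw [← fx]; exact IsFractionRing.lift_algebraMap hf _
  · rw [← fy]; exact IsFractionRing.lift_algebraMap hf _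

lemma algHom_ext_genericPoint {B : Type*} [Field B] [Algebra L B] [DecidableEq B]
    {φ ψ : W.FunctionField →ₐ[L] B}
    (h : Point.map (W' := W) φ (genericPoint W) = Point.map (W' := W) ψ (genericPoint W)) :
    φ = ψ := by
  rw [genericPoint, map_some, map_some, some.injEq] at h
  have ha (a : W.CoordinateRing) : φ (algebraMap _ _ a) = ψ (algebraMap _ _ a) := by
    obtain ⟨p, q, e⟩ := exists_eq_add_mul_y a
    rw [e, map_add, map_add, map_mul, map_mul, ← aeval_algHom_apply, ← aeval_algHom_apply,
      ← aeval_algHom_apply, ← aeval_algHom_apply, h.1, h.2]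
  refine AlgHom.ext fun z => ?_
  obtain ⟨a, b, hb, rfl⟩ := IsFractionRing.div_surjective (A := W.CoordinateRing) z
  rw [map_div₀, map_div₀, ha, ha]

omit [W.IsElliptic] in
lemma transcendental_xF : Transcendental L (xF W) :=
  transcendental_iff.2 fun _ hp => aeval_xF_eq_zero.1 hp

variable (W) in
lemma exists_conj : ∃ φ : W.FunctionField →ₐ[L] W.FunctionField,
    Point.map (W' := W) φ (genericPoint W) = -genericPoint W :=
  exists_algHom _ transcendental_xF

variable (W) in
/-- The automorphism of the function field induced by `P ↦ -P`. -/
def conj : W.FunctionField →ₐ[L] W.FunctionField := (exists_conj W).choose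

lemma map_conj : Point.map (W' := W) (conj W) (genericPoint W) = -genericPoint W :=
  (exists_conj W).choose_spec

lemma conj_xF : conj W (xF W) = xF W := by
  have := map_conj (W := W)
  rw [genericPoint, map_some, neg_some, some.injEq] at this
  exact this.1

lemma conj_yF : conj W (yF W) = -yF W - algebraMap L _ W.a₁ * xF W - algebraMap L _ W.a₃ := by
  have := map_conj (W := W)
  rw [genericPoint, map_some, neg_some, some.injEq] at this
  exact this.2

lemma conj_algebraMap (p q : L[X]) :
    conj W (algebraMap W.CoordinateRing _ (p • 1 + q • CoordinateRing.mk W X)) =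
      algebraMap W.CoordinateRing _ ((p - q * (C W.a₁ * X + C W.a₃)) • 1 +
        (-q) • CoordinateRing.mk W X) := by
  rw [algebraMap_smul_add_smul, algebraMap_smul_add_smul, map_add, map_mul, ← aeval_algHom_apply,
    ← aeval_algHom_apply, conj_xF, conj_yF]
  simp only [map_sub, map_mul, map_add, map_neg, aeval_X, aeval_C]
  ring

lemma ordInf_conj (z : W.FunctionField) : ordInf W (conj W z) = ordInf W z := by
  have ha (a : W.CoordinateRing) :
      ordInf W (conj W (algebraMap _ _ a)) = ordInf W (algebraMap _ _ a) := by
    by_cases h0 : a = 0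
    · simp [h0]
    obtain ⟨p, q, rfl⟩ := exists_smul_basis_eq a
    have h1 : conj W (algebraMap W.CoordinateRing _ (p • 1 + q • CoordinateRing.mk W X)) ≠ 0 := by
      rwa [Ne, map_eq_zero, map_eq_zero_iff _ algebraMap_coordinateRing_injective]
    rw [conj_algebraMap] at h1 ⊢
    rw [Ne, map_eq_zero_iff _ algebraMap_coordinateRing_injective] at h1
    rw [ordInf_algebraMap h0, ordInf_algebraMap h1, norm_smul_basis, norm_smul_basis]
    congr 3
    ring
  obtain ⟨a, b, hb, rfl⟩ := IsFractionRing.div_surjective (A := W.CoordinateRing) z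
  rw [map_div₀, map_div₀, map_div₀, ha, ha]

variable [DecidableEq L]

/-- The function `x - x(P)`, where `-1` stands in for it if `P = 0`. -/
def lin (P : W.Point) : W.FunctionField :=
  xF W * algebraMap L _ (xRep P 1) - algebraMap L _ (xRep P 0)

omit [W.IsElliptic] [DecidableEq L] in
lemma lin_zero : lin (0 : W.Point) = -1 := by simp [lin]

omit [W.IsElliptic] [DecidableEq L] in
lemma lin_some {x y : L} (h : W.Nonsingular x y) : lin (.some x y h) = xF W - algebraMap L _ x := by
  simp [lin]

omit [W.IsElliptic] in
lemma ordInf_lin (P : W.Point) : ordInf W (lin P) = WithZero.exp (if P = 0 then 0 else 2) := by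
  rcases P with _ | ⟨x, y, h⟩
  · rw [← zero_def, lin_zero, if_pos rfl, Valuation.map_neg, map_one, WithZero.exp_zero]
  · rw [lin_some, if_neg (some_ne_zero h), ordInf_xF_sub]

omit [W.IsElliptic] in
lemma lin_ne_zero (P : W.Point) : lin P ≠ 0 := by
  intro h
  have := ordInf_lin P
  rw [h, _root_.map_zero] at this
  exact WithZero.exp_ne_zero this.symm

/-- The form `triForm`, as a polynomial in its first argument, has the zeros `x(R + C)` and
`x(R - C)`. -/
lemma lin_add_mul_lin_sub (R C : W.Point) : ∃ k : L, k ≠ 0 ∧ lin (R + C) * lin (R - C) =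
    algebraMap L _ k * triForm (W⁄W.FunctionField) (xF W) 1 (algebraMap L _ (xRep R 0))
      (algebraMap L _ (xRep R 1)) (algebraMap L _ (xRep C 0)) (algebraMap L _ (xRep C 1)) := by
  obtain ⟨k, hk, h⟩ := sym2x_add_sub R C
  refine ⟨k, hk, ?_⟩
  have h0 := congrArg (algebraMap L W.FunctionField) (congrFun h 0)
  have h1 := congrArg (algebraMap L W.FunctionField) (congrFun h 1)
  have h2 := congrArg (algebraMap L W.FunctionField) (congrFun h 2)
  simp only [sym2x, Pi.smul_apply, Matrix.cons_val_zero, Matrix.cons_val_one, Matrix.cons_val,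
    smul_eq_mul, map_mul, map_add, map_sub, map_pow, addSubS, addSubT, addSubU, map_ofNat]
    at h0 h1 h2
  have b2 : (W⁄W.FunctionField).b₂ = algebraMap L _ W.b₂ := W.map_b₂ _
  have b4 : (W⁄W.FunctionField).b₄ = algebraMap L _ W.b₄ := W.map_b₄ _
  have b6 : (W⁄W.FunctionField).b₆ = algebraMap L _ W.b₆ := W.map_b₆ _
  have b8 : (W⁄W.FunctionField).b₈ = algebraMap L _ W.b₈ := W.map_b₈ _
  simp only [lin, triForm, addSubS, addSubT, addSubU, b2, b4, b6, b8]
  linear_combination h0 - xF W * h1 + xF W ^ 2 * h2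

/-- `(x(P + R) - x(C)) (x(P - R) - x(C)) (x(P) - x(R))²` is a constant multiple of
`(x(P) - x(R + C)) (x(P) - x(R - C))`, where `P` is the generic point. -/
lemma sub_mul_sub_mul_lin_sq {R C : W.Point} {X₁ Y₁ X₂ Y₂ : W.FunctionField}
    {h₁ : (W⁄W.FunctionField).Nonsingular X₁ Y₁} {h₂ : (W⁄W.FunctionField).Nonsingular X₂ Y₂}
    (e₁ : genericPoint W + constPoint W _ R = .some X₁ Y₁ h₁)
    (e₂ : genericPoint W - constPoint W _ R = .some X₂ Y₂ h₂) :
    ∃ k : L, k ≠ 0 ∧ (X₁ * algebraMap L _ (xRep C 1) - algebraMap L _ (xRep C 0)) *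
      (X₂ * algebraMap L _ (xRep C 1) - algebraMap L _ (xRep C 0)) * lin R ^ 2 =
        algebraMap L _ k * (lin (R + C) * lin (R - C)) := by
  obtain ⟨k', hk', h'⟩ := lin_add_mul_lin_sub R C
  refine ⟨k'⁻¹, inv_ne_zero hk', ?_⟩
  rw [h', ← mul_assoc, ← map_mul, inv_mul_cancel₀ hk', map_one, one_mul]
  obtain ⟨k, hk, h⟩ := sym2x_add_sub (genericPoint W) (constPoint W _ R)
  have r0 : xRep (constPoint W W.FunctionField R) 0 = algebraMap L _ (xRep R 0) := by
    rcases R with _ | ⟨x, y, hR⟩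
    · simp [← zero_def]
    · simp [constPoint_some]
  have r1 : xRep (constPoint W W.FunctionField R) 1 = algebraMap L _ (xRep R 1) := by
    rcases R with _ | ⟨x, y, hR⟩
    · simp [← zero_def]
    · simp [constPoint_some]
  rw [e₁, e₂] at h
  have h0 := congrFun h 0
  have h1 := congrFun h 1
  have h2 := congrFun h 2
  simp only [sym2x, r0, r1, xRep_some, genericPoint, Pi.smul_apply, Matrix.cons_val_zero,
    Matrix.cons_val_one, Matrix.cons_val, smul_eq_mul] at h0 h1 h2
  simp only [lin, triForm]
  set c0 := algebraMap L W.FunctionField (xRep C 0)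
  set c1 := algebraMap L W.FunctionField (xRep C 1)
  have hU : addSubU (xF W * algebraMap L _ (xRep R 0))
      (xF W * algebraMap L _ (xRep R 1) + 1 * algebraMap L _ (xRep R 0))
      (1 * algebraMap L _ (xRep R 1)) =
      (xF W * algebraMap L _ (xRep R 1) - algebraMap L _ (xRep R 0)) ^ 2 := by
    rw [addSubU]; ring
  rw [hU] at h2 ⊢
  refine mul_left_cancel₀ hk ?_
  linear_combination c1 ^ 2 * h0 - c0 * c1 * h1 + c0 ^ 2 * h2 -
    (X₁ * X₂ * c1 ^ 2 - (X₁ + X₂) * c0 * c1 + c0 ^ 2) * h2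

end Translation

section Places

variable {L : Type*} [Field L] {W : Affine L} [W.IsElliptic] [DecidableEq L]

open Affine CoordinateRing Point

omit [W.IsElliptic] in
lemma map_constPoint (φ : W.FunctionField →ₐ[L] W.FunctionField) (P : W.Point) :
    Point.map (W' := W) φ (constPoint W _ P) = constPoint W _ P := by
  rcases P with _ | ⟨x, y, h⟩
  · rfl
  · rw [constPoint_some, map_some, some.injEq]
    exact ⟨φ.commutes x, φ.commutes y⟩

lemma genericPoint_ne_constPoint (P : W.Point) : genericPoint W ≠ constPoint W _ P := by
  rcases P with _ | ⟨x, y, h⟩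
  · exact some_ne_zero _
  · rw [genericPoint, constPoint_some, Ne, some.injEq]
    exact fun h => xF_ne_algebraMap x h.1

lemma map_conj_add (R : W.Point) :
    Point.map (W' := W) (conj W) (genericPoint W + constPoint W _ R) =
      -(genericPoint W - constPoint W _ R) := by
  rw [map_add, map_conj, map_constPoint]; abel

variable (W) in
/-- That `x(P + R)` is transcendental is seen from its value at infinity, which is the constant
`x(R)`. -/
lemma exists_trans (R : W.Point) : ∃ φ : W.FunctionField →ₐ[L] W.FunctionField,
    Point.map (W' := W) φ (genericPoint W) = genericPoint W + constPoint W _ R := by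
  rcases R with _ | ⟨x, y, h⟩
  · refine ⟨AlgHom.id L _, ?_⟩
    rw [← zero_def, _root_.map_zero, add_zero]; rfl
  set R : W.Point := .some x y h with hR
  rcases e₁ : genericPoint W + constPoint W _ R with _ | ⟨X₁, Y₁, h₁⟩
  · exfalso
    refine genericPoint_ne_constPoint (-R) ?_
    rw [map_neg]; exact eq_neg_of_add_eq_zero_left e₁
  rcases e₂ : genericPoint W - constPoint W _ R with _ | ⟨X₂, Y₂, h₂⟩
  · exact absurd (sub_eq_zero.1 e₂) (genericPoint_ne_constPoint R)
  refine exists_algHom h₁ ?_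
  have hc := map_conj_add R
  rw [e₁, e₂, map_some, neg_some, some.injEq] at hc
  obtain ⟨k, hk, hkk⟩ := sub_mul_sub_mul_lin_sq (C := R) e₁ e₂
  rw [sub_self, lin_zero] at hkk
  have hne := mul_ne_zero ((map_ne_zero (algebraMap L W.FunctionField)).2 hk)
    (mul_ne_zero (lin_ne_zero (R + R)) (neg_ne_zero.2 one_ne_zero))
  have h3 : X₁ - algebraMap L _ x ≠ 0 := by
    intro h0
    refine hne ?_
    rw [← hkk, hR, xRep_some]
    simp [h0]
  refine transcendental_of_ordInf_sub_lt_one (c := x) (sub_ne_zero.1 h3) ?_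
  have hv := congrArg (ordInf W) hkk
  have h4 : X₂ - algebraMap L W.FunctionField x = conj W (X₁ - algebraMap L _ x) := by
    rw [map_sub, hc.1, AlgHom.commutes]
  have hx0 : xRep R 0 = x := by rw [hR, xRep_some]; rfl
  have hx1 : xRep R 1 = 1 := by rw [hR, xRep_some]; rfl
  rw [hx0, hx1, map_one, mul_one, mul_one, h4] at hv
  simp only [map_mul, map_pow, ordInf_conj, ordInf_const hk, one_mul, ordInf_lin, Valuation.map_neg,
    map_one, mul_one, hR, if_neg (some_ne_zero h)] at hv
  obtain ⟨m, hm⟩ : ∃ m : ℤ, ordInf W (X₁ - algebraMap L _ x) = WithZero.exp m :=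
    ⟨_, (WithZero.exp_log ((ordInf W).ne_zero_iff.2 h3)).symm⟩
  rw [hm, ← WithZero.exp_add, ← WithZero.exp_nsmul, ← WithZero.exp_add, WithZero.exp_inj] at hv
  rw [hm, ← WithZero.exp_zero, WithZero.exp_lt_exp]
  simp only [nsmul_eq_mul] at hv
  split_ifs at hv <;> push_cast at hv <;> omega

/-- The translation `f ↦ (P ↦ f(P + R))` on the function field. -/
def trans (R : W.Point) : W.FunctionField →ₐ[L] W.FunctionField := (exists_trans W R).choose

lemma map_trans (R : W.Point) :
    Point.map (W' := W) (trans R) (genericPoint W) = genericPoint W + constPoint W _ R :=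
  (exists_trans W R).choose_spec

/-- The slope of the chord through the generic point and the point `(x, y)`. -/
def chord (x y : L) : W.FunctionField := (yF W - algebraMap L _ y) / (xF W - algebraMap L _ x)

lemma trans_some {x y : L} (h : W.Nonsingular x y) :
    trans (.some x y h) (xF W) = chord x y ^ 2 + algebraMap L _ W.a₁ * chord x y -
      algebraMap L _ W.a₂ - xF W - algebraMap L _ x ∧
    trans (.some x y h) (yF W) = -(chord x y * (trans (.some x y h) (xF W) - xF W) + yF W) -
      algebraMap L _ W.a₁ * trans (.some x y h) (xF W) - algebraMap L _ W.a₃ := by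
  have hx : xF W ≠ algebraMap L _ x := xF_ne_algebraMap x
  have ht := map_trans (.some x y h)
  rw [genericPoint, constPoint_some, map_some, add_of_X_ne hx, some.injEq,
    slope_of_X_ne hx] at ht
  exact ⟨ht.1, by rw [ht.1]; exact ht.2⟩

lemma trans_trans (R S : W.Point) (z : W.FunctionField) :
    trans R (trans S z) = trans (R + S) z := by
  have : (trans R).comp (trans S) = trans (R + S) := by
    apply algHom_ext_genericPoint
    rw [← Point.map_map, map_trans, map_add, map_trans, map_constPoint, map_trans, map_add,
      add_assoc]
  exact DFunLike.congr_fun this z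

lemma trans_zero (z : W.FunctionField) : trans (0 : W.Point) z = z := by
  have : trans (0 : W.Point) = AlgHom.id L _ := by
    apply algHom_ext_genericPoint
    rw [map_trans, _root_.map_zero, add_zero]; rfl
  exact DFunLike.congr_fun this z

lemma trans_conj (R : W.Point) (z : W.FunctionField) :
    trans R (conj W z) = conj W (trans (-R) z) := by
  have : (trans R).comp (conj W) = (conj W).comp (trans (-R)) := by
    apply algHom_ext_genericPoint
    rw [← Point.map_map, map_conj, map_neg, map_trans, ← Point.map_map, map_trans, map_conj_add,
      map_neg, sub_neg_eq_add]
  exact DFunLike.congr_fun this z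

/-! ### The places of the function field -/

/-- The valuation at the point `P`: a function with a zero of order `k` at `P` has the value
`exp (-k)`. It is obtained from the place at infinity by translation. -/
def ordAt (P : W.Point) : Valuation W.FunctionField (WithZero (Multiplicative ℤ)) :=
  (ordInf W).comap (trans P).toRingHom

lemma ordAt_zero (z : W.FunctionField) : ordAt (0 : W.Point) z = ordInf W z :=
  congrArg (ordInf W) (trans_zero z)

lemma ordAt_trans (P S : W.Point) (z : W.FunctionField) : ordAt P (trans S z) = ordAt (P + S) z :=
  congrArg (ordInf W) (trans_trans P S z)

lemma ordAt_conj (P : W.Point) (z : W.FunctionField) : ordAt P (conj W z) = ordAt (-P) z :=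
  (congrArg (ordInf W) (trans_conj P z)).trans (ordInf_conj _)

lemma ordAt_const (P : W.Point) {c : L} (hc : c ≠ 0) : ordAt P (algebraMap L _ c) = 1 :=
  (congrArg (ordInf W) ((trans P).commutes c)).trans (ordInf_const hc)

lemma ordAt_const_le_one (P : W.Point) (c : L) : ordAt P (algebraMap L _ c) ≤ 1 := by
  by_cases hc : c = 0
  · simp [hc]
  · exact (ordAt_const P hc).le

omit [DecidableEq L] in
lemma conj_lin (C : W.Point) : conj W (lin C) = lin C := by
  rw [lin, map_sub, map_mul, conj_xF, AlgHom.commutes, AlgHom.commutes]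

lemma trans_lin_mul (R C : W.Point) : ∃ k : L, k ≠ 0 ∧
    trans R (lin C) * trans (-R) (lin C) * lin R ^ 2 =
      algebraMap L _ k * (lin (R + C) * lin (R - C)) := by
  rcases e₁ : genericPoint W + constPoint W _ R with _ | ⟨X₁, Y₁, h₁⟩
  · exfalso
    refine genericPoint_ne_constPoint (-R) ?_
    rw [map_neg]; exact eq_neg_of_add_eq_zero_left e₁
  rcases e₂ : genericPoint W - constPoint W _ R with _ | ⟨X₂, Y₂, h₂⟩
  · exact absurd (sub_eq_zero.1 e₂) (genericPoint_ne_constPoint R)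
  obtain ⟨k, hk, h⟩ := sub_mul_sub_mul_lin_sq (C := C) e₁ e₂
  refine ⟨k, hk, ?_⟩
  have t₁ := map_trans R
  have t₂ := map_trans (-R)
  rw [e₁, genericPoint, map_some, some.injEq] at t₁
  rw [map_neg, ← sub_eq_add_neg, e₂, genericPoint, map_some, some.injEq] at t₂
  rw [← h]
  congr 2
  · rw [lin, map_sub, map_mul, AlgHom.commutes, AlgHom.commutes, t₁.1]
  · rw [lin, map_sub, map_mul, AlgHom.commutes, AlgHom.commutes, t₂.1]

/-- As `x - x(C)` is even, it has the same order at `R` and `-R`, so that `trans_lin_mul` reduces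
the order at `R` to orders at infinity. -/
lemma ordAt_lin (R C : W.Point) : ordAt R (lin C) = WithZero.exp
    ((if C = R then 0 else 1) + (if C = -R then 0 else 1) - 2 * (if R = 0 then 0 else 1) : ℤ) := by
  obtain ⟨k, hk, h⟩ := trans_lin_mul R C
  have hv := congrArg (ordInf W) h
  have h1 : ordInf W (trans R (lin C)) = ordAt R (lin C) := rfl
  have h2 : ordInf W (trans (-R) (lin C)) = ordAt R (lin C) := by
    change ordAt (-R) (lin C) = _
    rw [← ordAt_conj, conj_lin]
  obtain ⟨m, hm⟩ : ∃ m : ℤ, ordAt R (lin C) = WithZero.exp m :=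
    ⟨_, (WithZero.exp_log ((ordAt R).ne_zero_iff.2 (lin_ne_zero C))).symm⟩
  simp only [map_mul, map_pow, h1, h2, hm, ordInf_const hk, one_mul, ordInf_lin,
    ← WithZero.exp_add, ← WithZero.exp_nsmul, WithZero.exp_inj, nsmul_eq_mul] at hv
  rw [hm, WithZero.exp_inj]
  have i1 : R + C = 0 ↔ C = -R := by rw [add_comm]; exact add_eq_zero_iff_eq_neg
  have i2 : R - C = 0 ↔ C = R := by rw [sub_eq_zero]; exact eq_comm
  simp only [i1, i2] at hv
  split_ifs at hv ⊢ <;> push_cast at hv <;> omega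

lemma ordAt_lin_of_ne_zero {P : W.Point} (hP : P ≠ 0) (C : W.Point) : ordAt P (lin C) =
    WithZero.exp (-((if C = P then 1 else 0) + (if C = -P then 1 else 0)) : ℤ) := by
  rw [ordAt_lin, if_neg hP]
  congr 1
  split_ifs <;> simp

lemma ordAt_lin_le_one {P : W.Point} (hP : P ≠ 0) (C : W.Point) : ordAt P (lin C) ≤ 1 := by
  rw [ordAt_lin_of_ne_zero hP, ← WithZero.exp_zero, WithZero.exp_le_exp]
  split_ifs <;> simp

lemma ordAt_xF_sub_lt_one {x y : L} (h : W.Nonsingular x y) :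
    ordAt (.some x y h) (xF W - algebraMap L _ x) < 1 := by
  rw [← lin_some h, ordAt_lin_of_ne_zero (some_ne_zero h), ← WithZero.exp_zero, WithZero.exp_lt_exp,
    if_pos rfl]
  split_ifs <;> simp

lemma ordAt_xF_le_one {P : W.Point} (hP : P ≠ 0) : ordAt P (xF W) ≤ 1 := by
  rcases P with _ | ⟨x, y, h⟩
  · exact absurd rfl hP
  have h1 := ordAt_xF_sub_lt_one h
  have h2 := (ordAt (.some x y h)).map_add (xF W - algebraMap L _ x) (algebraMap L _ x)
  rw [sub_add_cancel] at h2
  exact h2.trans (max_le h1.le (ordAt_const_le_one _ _))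

lemma ordAt_aeval_le_one {P : W.Point} {z : W.FunctionField} (hz : ordAt P z ≤ 1) (p : L[X]) :
    ordAt P (aeval z p) ≤ 1 := by
  change ordInf W (trans P (aeval z p)) ≤ 1
  rw [← aeval_algHom_apply]
  exact ordInf_aeval_le_one hz p

omit [W.IsElliptic] [DecidableEq L] in
lemma yF_mul_eq : yF W * (yF W + (algebraMap L _ W.a₁ * xF W + algebraMap L _ W.a₃)) =
    aeval (xF W) (X ^ 3 + C W.a₂ * X ^ 2 + C W.a₄ * X + C W.a₆) := by
  have := (equation_iff ..).1 (equation_xF_yF (W := W))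
  change yF W ^ 2 + algebraMap L _ W.a₁ * xF W * yF W + algebraMap L _ W.a₃ * yF W =
    xF W ^ 3 + algebraMap L _ W.a₂ * xF W ^ 2 + algebraMap L _ W.a₄ * xF W + algebraMap L _ W.a₆
    at this
  simp only [map_add, map_mul, map_pow, aeval_X, aeval_C]
  linear_combination this

lemma ordAt_yF_le_one {P : W.Point} (hP : P ≠ 0) : ordAt P (yF W) ≤ 1 := by
  by_contra! h
  have hx := ordAt_xF_le_one hP
  have h1 := ordAt_aeval_le_one hx (X ^ 3 + C W.a₂ * X ^ 2 + C W.a₄ * X + C W.a₆)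
  have h2 := ordAt_aeval_le_one hx (C W.a₁ * X + C W.a₃)
  simp only [map_add, map_mul, aeval_X, aeval_C] at h2
  have h3 : ordAt P (yF W + (algebraMap L _ W.a₁ * xF W + algebraMap L _ W.a₃)) =
    ordAt P (yF W) := Valuation.map_add_eq_of_lt_left _ (h2.trans_lt h)
  rw [← yF_mul_eq, map_mul, h3] at h1
  exact absurd (one_lt_mul'' h h) h1.not_gt

lemma ordAt_algebraMap_le_one {P : W.Point} (hP : P ≠ 0) (a : W.CoordinateRing) :
    ordAt P (algebraMap _ _ a) ≤ 1 := by
  obtain ⟨p, q, e⟩ := exists_eq_add_mul_y a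
  rw [e]
  refine (Valuation.map_add _ _ _).trans (max_le (ordAt_aeval_le_one (ordAt_xF_le_one hP) p) ?_)
  rw [map_mul]
  exact mul_le_one' (ordAt_aeval_le_one (ordAt_xF_le_one hP) q) (ordAt_yF_le_one hP)

/-- With `R = (x, y)` and `P` the generic point, the point `-(P + R)` lies on the chord through `P`
and `R`. Hence the quotient of `y(-(P + R)) - y(R)` by `x(P + R) - x(R)` is the slope of the chord,
which has a simple pole at infinity. -/
lemma ordAt_neg_yF_sub {x y : L} (h : W.Nonsingular x y) :
    ordAt (-.some x y h) (yF W - algebraMap L _ y) =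
      WithZero.exp 1 * ordAt (.some x y h) (xF W - algebraMap L _ x) := by
  have hk : trans (.some x y h) (conj W (yF W) - algebraMap L _ y) * (xF W - algebraMap L _ x) =
      trans (.some x y h) (xF W - algebraMap L _ x) * (yF W - algebraMap L _ y) := by
    have hs : chord x y * (xF W - algebraMap L _ x) = yF W - algebraMap L _ y :=
      div_mul_cancel₀ _ (xF_sub_ne_zero x)
    rw [conj_yF]
    simp only [map_sub, map_neg, map_mul, AlgHom.commutes, (trans_some h).2]
    linear_combination (trans (.some x y h) (xF W) - xF W) * hs
  have hv := congrArg (ordInf W) hk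
  rw [map_mul, map_mul] at hv
  change ordAt (.some x y h) (conj W (yF W) - algebraMap L _ y) * _ =
    ordAt (.some x y h) _ * _ at hv
  have e1 : conj W (yF W) - algebraMap L _ y = conj W (yF W - algebraMap L _ y) := by
    rw [map_sub, AlgHom.commutes]
  rw [e1, ordAt_conj, ordInf_xF_sub] at hv
  have e2 : ordInf W (yF W - algebraMap L _ y) = WithZero.exp 3 := by
    refine (Valuation.map_sub_eq_of_lt_left _ ?_).trans ordInf_yF
    rw [ordInf_yF]
    refine (ordInf_const_le_one y).trans_lt ?_
    rw [← WithZero.exp_zero, WithZero.exp_lt_exp]; norm_num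
  rw [e2] at hv
  have e3 : (WithZero.exp 3 : WithZero (Multiplicative ℤ)) = WithZero.exp 1 * WithZero.exp 2 := by
    rw [← WithZero.exp_add]; norm_num
  rw [e3, ← mul_assoc] at hv
  rw [mul_right_cancel₀ WithZero.exp_ne_zero hv, mul_comm]

lemma ordAt_yF_sub_lt_one {x y : L} (h : W.Nonsingular x y) :
    ordAt (.some x y h) (yF W - algebraMap L _ y) < 1 := by
  have hn := ordAt_neg_yF_sub h
  by_cases h2 : .some x y h = -(.some x y h : W.Point)
  · rw [← h2, ← lin_some h, ordAt_lin_of_ne_zero (some_ne_zero h), if_pos rfl, if_pos h2,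
      ← WithZero.exp_add] at hn
    rw [hn, ← WithZero.exp_zero, WithZero.exp_lt_exp]
    norm_num
  rw [← lin_some h, ordAt_lin_of_ne_zero (some_ne_zero h), if_pos rfl, if_neg h2,
    ← WithZero.exp_add, ← ordAt_conj] at hn
  set p : L[X] := C y ^ 2 + C y * (C W.a₁ * X + C W.a₃) -
    (X ^ 3 + C W.a₂ * X ^ 2 + C W.a₄ * X + C W.a₆) with hp
  have hprod : (yF W - algebraMap L _ y) * conj W (yF W - algebraMap L _ y) = aeval (xF W) p := by
    have := yF_mul_eq (W := W)
    rw [hp, map_sub _ (C y ^ 2 + _) _, ← this, map_sub, conj_yF, AlgHom.commutes]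
    simp only [map_add, map_mul, map_pow, aeval_X, aeval_C]
    ring
  have hroot : p.IsRoot x := by
    have := (equation_iff ..).1 h.1
    simp only [hp, IsRoot.def, eval_sub, eval_add, eval_mul, eval_pow, eval_C, eval_X]
    linear_combination this
  obtain ⟨q, hq⟩ := dvd_iff_isRoot.2 hroot
  have hv := congrArg (ordAt (.some x y h)) hprod
  rw [map_mul, hn, hq, map_mul, map_mul] at hv
  have e : aeval (xF W) (X - C x) = xF W - algebraMap L _ x := by simp
  rw [e] at hv
  norm_num at hv
  rw [hv]
  exact mul_lt_one_of_lt_of_le (ordAt_xF_sub_lt_one h)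
    (ordAt_aeval_le_one (ordAt_xF_le_one (some_ne_zero h)) q)

end Places

/-! ### Functions determined by their poles -/

section Regular

variable {L : Type*} [Field L] {W : Affine L} [W.IsElliptic] [DecidableEq L]

open Affine CoordinateRing Point

lemma eq_zero_of_ordAt_lt_one {P : W.Point} {c : L} (h : ordAt P (algebraMap L _ c) < 1) :
    c = 0 := by
  by_contra hc
  exact (ordAt_const P hc).not_lt h

lemma ordAt_self_lin_lt_one {C : W.Point} (hC : C ≠ 0) : ordAt C (lin C) < 1 := by
  rw [ordAt_lin_of_ne_zero hC, ← WithZero.exp_zero, WithZero.exp_lt_exp, if_pos rfl]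
  split_ifs <;> simp

lemma ordAt_neg_lin (P C : W.Point) : ordAt (-P) (lin C) = ordAt P (lin C) := by
  rw [← ordAt_conj, conj_lin]

/-- A function of the form `α + β y` that vanishes at `±C` to the same order as `x - x(C)` is zero.
If `C` is a `2`-torsion point, then `y - y(C)` has a simple zero at `C`, but `x - x(C)` a double
one. -/
lemma eq_zero_of_ordAt_le {x y : L} (h : W.Nonsingular x y) {α β : L}
    (h₁ : ordAt (.some x y h) (algebraMap L _ α + algebraMap L _ β * yF W) ≤
      ordAt (.some x y h) (lin (.some x y h)))
    (h₂ : ordAt (-.some x y h) (algebraMap L _ α + algebraMap L _ β * yF W) ≤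
      ordAt (.some x y h) (lin (.some x y h))) : α = 0 ∧ β = 0 := by
  have hlt := ordAt_self_lin_lt_one (some_ne_zero h)
  by_cases hβ : β = 0
  · subst hβ
    rw [_root_.map_zero, zero_mul, add_zero] at h₁
    exact ⟨eq_zero_of_ordAt_lt_one (h₁.trans_lt hlt), rfl⟩
  exfalso
  have hmul (P : W.Point) : ordAt P (algebraMap L _ α + algebraMap L _ β * yF W) =
      ordAt P (yF W + algebraMap L _ (α / β)) := by
    rw [← one_mul (ordAt P (yF W + _)), ← ordAt_const P hβ, ← map_mul, mul_add, ← map_mul,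
      mul_div_cancel₀ _ hβ, add_comm]
  rw [hmul] at h₁ h₂
  have key {x' y' : L} (h' : W.Nonsingular x' y')
      (hv : ordAt (.some x' y' h') (yF W + algebraMap L _ (α / β)) < 1) : α / β = -y' := by
    have := (ordAt (.some x' y' h')).map_sub (yF W + algebraMap L _ (α / β))
      (yF W - algebraMap L _ y')
    have e : yF W + algebraMap L _ (α / β) - (yF W - algebraMap L _ y') =
        algebraMap L _ (α / β + y') := by rw [map_add]; ring
    rw [e] at this
    exact eq_neg_of_add_eq_zero_left
      (eq_zero_of_ordAt_lt_one (this.trans_lt (max_lt hv (ordAt_yF_sub_lt_one h'))))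
  have e₁ := key h (h₁.trans_lt hlt)
  have hn := ordAt_neg_yF_sub h
  rw [e₁, map_neg, ← sub_eq_add_neg, hn, ← lin_some h] at h₂
  have h0 : (0 : WithZero (Multiplicative ℤ)) < ordAt (.some x y h) (lin (.some x y h)) :=
    zero_lt_iff.2 ((ordAt (.some x y h)).ne_zero_iff.2 (lin_ne_zero (.some x y h)))
  refine absurd h₂ (not_le.2 ?_)
  calc _ = 1 * ordAt (.some x y h) (lin (.some x y h)) := (one_mul _).symm
    _ < _ := by
      refine mul_lt_mul_of_pos_right ?_ h0
      rw [← WithZero.exp_zero, WithZero.exp_lt_exp]; norm_num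

lemma exists_eq_lin_mul {C : W.Point} {a : W.CoordinateRing}
    (h₁ : ordAt C (algebraMap _ _ a) ≤ ordAt C (lin C))
    (h₂ : ordAt (-C) (algebraMap _ _ a) ≤ ordAt C (lin C)) :
    ∃ b : W.CoordinateRing, algebraMap _ W.FunctionField a = lin C * algebraMap _ _ b := by
  rcases C with _ | ⟨x, y, h⟩
  · exact ⟨-a, by rw [← zero_def, lin_zero, map_neg]; ring⟩
  obtain ⟨p, q, e⟩ := exists_eq_add_mul_y a
  obtain ⟨p', hp⟩ := X_sub_C_dvd_sub_C_eval (p := p) (a := x)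
  obtain ⟨q', hq⟩ := X_sub_C_dvd_sub_C_eval (p := q) (a := x)
  have hb := algebraMap_smul_add_smul (W := W) p' q'
  set b := p' • (1 : W.CoordinateRing) + q' • CoordinateRing.mk W X
  have hab : algebraMap _ W.FunctionField a = lin (.some x y h) * algebraMap _ _ b +
      (algebraMap L _ (p.eval x) + algebraMap L _ (q.eval x) * yF W) := by
    have hp' := congrArg (aeval (xF W)) hp
    have hq' := congrArg (aeval (xF W)) hq
    simp only [map_sub, map_mul, aeval_X, aeval_C] at hp' hq'
    rw [e, hb, lin_some]
    linear_combination hp' + yF W * hq'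
  have hr {P : W.Point} (hP : P ≠ 0) (h' : ordAt P (lin (.some x y h)) =
      ordAt (.some x y h) (lin (.some x y h)))
      (hv : ordAt P (algebraMap _ _ a) ≤ ordAt (.some x y h) (lin (.some x y h))) :
      ordAt P (algebraMap L _ (p.eval x) + algebraMap L _ (q.eval x) * yF W) ≤
        ordAt (.some x y h) (lin (.some x y h)) := by
    rw [eq_sub_of_add_eq' hab.symm]
    refine (Valuation.map_sub _ _ _).trans (max_le hv ?_)
    rw [map_mul, h']
    exact mul_le_of_le_one_right' (ordAt_algebraMap_le_one hP b)
  obtain ⟨e₁, e₂⟩ := eq_zero_of_ordAt_le h (hr (some_ne_zero h) rfl h₁)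
    (hr (neg_ne_zero.2 (some_ne_zero h)) (ordAt_neg_lin _ _) h₂)
  exact ⟨b, by rw [hab, e₁, e₂]; simp⟩

variable (W) in
/-- The ring of functions obtained from the coordinate ring by inverting the functions `x - x(P)`.
It is stable under translations. -/
def puncturedRing : Subalgebra L W.FunctionField :=
  Algebra.adjoin L ({xF W, yF W} ∪ Set.range fun P : W.Point => (lin P)⁻¹)

lemma xF_mem : xF W ∈ puncturedRing W := Algebra.subset_adjoin (by simp)

lemma yF_mem : yF W ∈ puncturedRing W := Algebra.subset_adjoin (by simp)

lemma lin_inv_mem (P : W.Point) : (lin P)⁻¹ ∈ puncturedRing W := Algebra.subset_adjoin (by simp)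

lemma lin_mem (P : W.Point) : lin P ∈ puncturedRing W :=
  sub_mem (mul_mem xF_mem (algebraMap_mem _ _)) (algebraMap_mem _ _)

lemma algebraMap_mem_puncturedRing (a : W.CoordinateRing) :
    algebraMap _ _ a ∈ puncturedRing W := by
  obtain ⟨p, q, e⟩ := exists_eq_add_mul_y a
  have h (p : L[X]) : aeval (xF W) p ∈ puncturedRing W :=
    Algebra.adjoin_le (by simpa using xF_mem) (aeval_mem_adjoin_singleton L (xF W))
  rw [e]
  exact add_mem (h p) (mul_mem (h q) yF_mem)

lemma trans_xF_mem (R : W.Point) : trans R (xF W) ∈ puncturedRing W ∧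
    trans R (yF W) ∈ puncturedRing W := by
  rcases R with _ | ⟨x, y, h⟩
  · rw [← zero_def, trans_zero, trans_zero]; exact ⟨xF_mem, yF_mem⟩
  have hl : chord x y ∈ puncturedRing W := by
    rw [chord, div_eq_mul_inv, ← lin_some h]
    exact mul_mem (sub_mem yF_mem (algebraMap_mem _ _)) (lin_inv_mem _)
  have hX : trans (.some x y h) (xF W) ∈ puncturedRing W := by
    rw [(trans_some h).1]
    exact sub_mem (sub_mem (sub_mem (add_mem (pow_mem hl 2) (mul_mem (algebraMap_mem _ _) hl))
      (algebraMap_mem _ _)) xF_mem) (algebraMap_mem _ _)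
  refine ⟨hX, ?_⟩
  rw [(trans_some h).2]
  exact sub_mem (sub_mem (neg_mem (add_mem (mul_mem hl (sub_mem hX xF_mem)) yF_mem))
    (mul_mem (algebraMap_mem _ _) hX)) (algebraMap_mem _ _)

lemma trans_mem (R : W.Point) {z : W.FunctionField} (hz : z ∈ puncturedRing W) :
    trans R z ∈ puncturedRing W := by
  have hlin (R C : W.Point) : trans R (lin C) ∈ puncturedRing W := by
    rw [lin, map_sub, map_mul, AlgHom.commutes, AlgHom.commutes]
    exact sub_mem (mul_mem (trans_xF_mem R).1 (algebraMap_mem _ _)) (algebraMap_mem _ _)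
  have : puncturedRing W ≤ (puncturedRing W).comap (trans R) := by
    refine Algebra.adjoin_le ?_
    rintro _ ((rfl | rfl) | ⟨C, rfl⟩)
    · exact (trans_xF_mem R).1
    · exact (trans_xF_mem R).2
    · obtain ⟨k, hk, hkk⟩ := trans_lin_mul R C
      have hk' : algebraMap L W.FunctionField k ≠ 0 := (_root_.map_ne_zero _).2 hk
      have h1 : trans R (lin C) ≠ 0 := (_root_.map_ne_zero _).2 (lin_ne_zero C)
      have e : trans R (lin C)⁻¹ = algebraMap L _ k⁻¹ * (trans (-R) (lin C) * lin R ^ 2 *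
          ((lin (R + C))⁻¹ * (lin (R - C))⁻¹)) := by
        have h2 := lin_ne_zero (R + C)
        have h3 := lin_ne_zero (R - C)
        rw [map_inv₀, map_inv₀]
        field_simp
        linear_combination -hkk
      change trans R (lin C)⁻¹ ∈ puncturedRing W
      rw [e]
      exact mul_mem (algebraMap_mem _ _) (mul_mem (mul_mem (hlin _ _) (pow_mem (lin_mem R) 2))
        (mul_mem (lin_inv_mem _) (lin_inv_mem _)))
  exact this hz

lemma conj_mem {z : W.FunctionField} (hz : z ∈ puncturedRing W) :
    conj W z ∈ puncturedRing W := by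
  have : puncturedRing W ≤ (puncturedRing W).comap (conj W) := by
    refine Algebra.adjoin_le ?_
    rintro _ ((rfl | rfl) | ⟨C, rfl⟩)
    · change conj W (xF W) ∈ puncturedRing W
      rw [conj_xF]; exact xF_mem
    · change conj W (yF W) ∈ puncturedRing W
      rw [conj_yF]
      exact sub_mem (sub_mem (neg_mem yF_mem) (mul_mem (algebraMap_mem _ _) xF_mem))
        (algebraMap_mem _ _)
    · change conj W (lin C)⁻¹ ∈ puncturedRing W
      rw [map_inv₀, conj_lin]; exact lin_inv_mem C
  exact this hz

/-- The elements of `puncturedRing W` have denominators that are products of functions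
`x - x(P)`. -/
lemma exists_mul_prod_lin {z : W.FunctionField} (hz : z ∈ puncturedRing W) :
    ∃ (l : List W.Point) (a : W.CoordinateRing), z * (l.map lin).prod = algebraMap _ _ a := by
  have hp (l : List W.Point) :
      ∃ b : W.CoordinateRing, (l.map lin).prod = algebraMap _ W.FunctionField b := by
    induction l with
    | nil => exact ⟨1, by simp⟩
    | cons P l ih =>
      obtain ⟨b, hb⟩ := ih
      refine ⟨CoordinateRing.mk W (C (X * C (xRep P 1) - C (xRep P 0))) * b, ?_⟩
      rw [List.map_cons, List.prod_cons, hb, map_mul, algebraMap_mk_C]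
      simp only [lin, map_sub, map_mul, aeval_X, aeval_C]
  induction hz using Algebra.adjoin_induction with
  | mem z hz =>
    rcases hz with (rfl | rfl) | ⟨P, rfl⟩
    · exact ⟨[], _, by simp; rfl⟩
    · exact ⟨[], _, by simp; rfl⟩
    · exact ⟨[P], 1, by simp [lin_ne_zero]⟩
  | algebraMap r =>
    refine ⟨[], CoordinateRing.mk W (C (C r)), ?_⟩
    rw [algebraMap_mk_C]; simp
  | add z w _ _ h₁ h₂ =>
    obtain ⟨l, a, ha⟩ := h₁
    obtain ⟨m, b, hb⟩ := h₂
    obtain ⟨c, hc⟩ := hp l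
    obtain ⟨d, hd⟩ := hp m
    refine ⟨l ++ m, a * d + b * c, ?_⟩
    rw [List.map_append, List.prod_append, map_add, map_mul, map_mul, ← ha, ← hb, ← hc, ← hd]
    ring
  | mul z w _ _ h₁ h₂ =>
    obtain ⟨l, a, ha⟩ := h₁
    obtain ⟨m, b, hb⟩ := h₂
    refine ⟨l ++ m, a * b, ?_⟩
    rw [List.map_append, List.prod_append, map_mul, ← ha, ← hb]
    ring

lemma ordAt_list_prod_lin_le_one {P : W.Point} (hP : P ≠ 0) (l : List W.Point) :
    ordAt P (l.map lin).prod ≤ 1 := by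
  induction l with
  | nil => simp
  | cons Q l ih =>
    rw [List.map_cons, List.prod_cons, map_mul]
    exact mul_le_one' (ordAt_lin_le_one hP Q) ih

/-- A function without poles at affine points is regular. -/
theorem exists_algebraMap_eq {z : W.FunctionField} (hz : z ∈ puncturedRing W)
    (h : ∀ P : W.Point, P ≠ 0 → ordAt P z ≤ 1) :
    ∃ a : W.CoordinateRing, algebraMap _ _ a = z := by
  obtain ⟨l, a, ha⟩ := exists_mul_prod_lin hz
  induction l generalizing a with
  | nil => exact ⟨a, by simpa using ha.symm⟩
  | cons C l ih =>
    set w := z * (l.map lin).prod with hw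
    have hle {P : W.Point} (hP : P ≠ 0) : ordAt P w ≤ 1 := by
      rw [hw, map_mul]
      exact mul_le_one' (h P hP) (ordAt_list_prod_lin_le_one hP l)
    have hwa : lin C * w = algebraMap _ _ a := by
      rw [← ha, List.map_cons, List.prod_cons, hw]; ring
    by_cases hC : C = 0
    · refine ih (-a) ?_
      rw [hC, lin_zero] at hwa
      rw [map_neg, ← hwa]; ring
    obtain ⟨b, hb⟩ := exists_eq_lin_mul (C := C) (a := a) (by
        rw [← hwa, map_mul]; exact mul_le_of_le_one_right' (hle hC)) (by
        rw [← hwa, map_mul, ordAt_neg_lin]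
        exact mul_le_of_le_one_right' (hle (neg_ne_zero.2 hC)))
    exact ih b (mul_left_cancel₀ (lin_ne_zero C) (hwa.trans hb))

/-- A function without poles is constant. -/
theorem exists_const_of_ordAt_le_one {z : W.FunctionField} (hz : z ∈ puncturedRing W)
    (h : ∀ P : W.Point, ordAt P z ≤ 1) : ∃ c : L, z = algebraMap L _ c := by
  obtain ⟨a, rfl⟩ := exists_algebraMap_eq hz fun P _ => h P
  exact exists_const_of_ordInf_le_one ((ordAt_zero _).symm.trans_le (h 0))

end Regular

/-! ### Divisors of Weil functions -/

section Divisor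

variable {L : Type*} [Field L] {W : Affine L} [W.IsElliptic] [DecidableEq L]

open Affine CoordinateRing Point

/-- The invertible fractional ideal `J` has the divisor `-f`, as far as the affine points are
concerned; moreover `J` and its inverse consist of functions in `puncturedRing W`. -/
def HasDiv (f : W.Point → ℤ) (J : (FractionalIdeal W.CoordinateRing⁰ W.FunctionField)ˣ) : Prop :=
  (∀ z ∈ (J : FractionalIdeal W.CoordinateRing⁰ W.FunctionField),
    z ∈ puncturedRing W ∧ ∀ P : W.Point, P ≠ 0 → ordAt P z ≤ WithZero.exp (f P)) ∧
  (∀ z ∈ ((J⁻¹ : (FractionalIdeal W.CoordinateRing⁰ W.FunctionField)ˣ) :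
      FractionalIdeal W.CoordinateRing⁰ W.FunctionField),
    z ∈ puncturedRing W ∧ ∀ P : W.Point, P ≠ 0 → ordAt P z ≤ WithZero.exp (-f P))

lemma HasDiv.one : HasDiv (W := W) 0 1 := by
  have : ∀ z ∈ (1 : FractionalIdeal W.CoordinateRing⁰ W.FunctionField),
      z ∈ puncturedRing W ∧ ∀ P : W.Point, P ≠ 0 → ordAt P z ≤ WithZero.exp 0 := by
    intro z hz
    obtain ⟨a, rfl⟩ := (FractionalIdeal.mem_one_iff _).1 hz
    exact ⟨algebraMap_mem_puncturedRing a, fun P hP => ordAt_algebraMap_le_one hP a⟩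
  refine ⟨this, ?_⟩
  simpa using this

lemma HasDiv.inv {f : W.Point → ℤ} {J : (FractionalIdeal W.CoordinateRing⁰ W.FunctionField)ˣ}
    (h : HasDiv f J) : HasDiv (-f) J⁻¹ :=
  ⟨h.2, by simpa using h.1⟩

lemma HasDiv.mul {f₁ f₂ : W.Point → ℤ}
    {J₁ J₂ : (FractionalIdeal W.CoordinateRing⁰ W.FunctionField)ˣ}
    (h₁ : HasDiv f₁ J₁) (h₂ : HasDiv f₂ J₂) : HasDiv (f₁ + f₂) (J₁ * J₂) := by
  have key (I₁ I₂ : FractionalIdeal W.CoordinateRing⁰ W.FunctionField) (g₁ g₂ : W.Point → ℤ)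
      (k₁ : ∀ z ∈ I₁, z ∈ puncturedRing W ∧ ∀ P : W.Point, P ≠ 0 → ordAt P z ≤ WithZero.exp (g₁ P))
      (k₂ : ∀ z ∈ I₂, z ∈ puncturedRing W ∧ ∀ P : W.Point, P ≠ 0 → ordAt P z ≤ WithZero.exp (g₂ P))
      (z) (hz : z ∈ I₁ * I₂) :
      z ∈ puncturedRing W ∧ ∀ P : W.Point, P ≠ 0 → ordAt P z ≤ WithZero.exp (g₁ P + g₂ P) := by
    refine FractionalIdeal.mul_induction_on hz (fun i hi j hj => ?_) fun x y hx hy => ?_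
    · refine ⟨mul_mem (k₁ i hi).1 (k₂ j hj).1, fun P hP => ?_⟩
      rw [map_mul, WithZero.exp_add]
      exact mul_le_mul' ((k₁ i hi).2 P hP) ((k₂ j hj).2 P hP)
    · exact ⟨add_mem hx.1 hy.1, fun P hP =>
        (Valuation.map_add _ _ _).trans (max_le (hx.2 P hP) (hy.2 P hP))⟩
  refine ⟨key _ _ _ _ h₁.1 h₂.1, ?_⟩
  intro z hz
  rw [mul_inv, Units.val_mul] at hz
  have := key _ _ (-f₁) (-f₂) h₁.2 h₂.2 z hz
  refine ⟨this.1, fun P hP => (this.2 P hP).trans_eq ?_⟩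
  congr 1
  simp only [Pi.neg_apply, Pi.add_apply]; ring

lemma HasDiv.prod {ι : Type*} (s : Finset ι) {f : ι → W.Point → ℤ}
    {J : ι → (FractionalIdeal W.CoordinateRing⁰ W.FunctionField)ˣ}
    (h : ∀ i ∈ s, HasDiv (f i) (J i)) : HasDiv (∑ i ∈ s, f i) (∏ i ∈ s, J i) := by
  classical
  induction s using Finset.induction_on with
  | empty => simpa using HasDiv.one
  | insert i s hi ih =>
    rw [Finset.sum_insert hi, Finset.prod_insert hi]
    exact (h i (by simp)).mul (ih fun j hj => h j (by simp [hj]))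

lemma le_exp_neg_one {v : WithZero (Multiplicative ℤ)} (h : v < 1) : v ≤ WithZero.exp (-1) := by
  by_cases h0 : v = 0
  · simp [h0]
  rw [← WithZero.exp_log h0] at h ⊢
  rw [← WithZero.exp_zero, WithZero.exp_lt_exp] at h
  rw [WithZero.exp_le_exp]; omega

lemma algebraMap_XClass {x y : L} (h : W.Nonsingular x y) :
    algebraMap W.CoordinateRing W.FunctionField (XClass W x) = lin (.some x y h) := by
  rw [XClass, algebraMap_mk_C, lin_some]; simp

lemma mem_XYIdeal {x y : L} (h : W.Nonsingular x y) {a : W.CoordinateRing}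
    (ha : a ∈ XYIdeal W x (C y)) (P : W.Point) (hP : P ≠ 0) :
    ordAt P (algebraMap _ _ a) ≤ WithZero.exp (-if P = .some x y h then 1 else 0) := by
  split_ifs with hPQ
  · subst hPQ
    obtain ⟨u, v, rfl⟩ := Ideal.mem_span_pair.1 ha
    have hY : algebraMap W.CoordinateRing W.FunctionField (YClass W (C y)) =
        yF W - algebraMap L _ y := by
      rw [YClass, map_sub, map_sub, algebraMap_mk_C, aeval_C]; rfl
    rw [map_add, map_mul, map_mul, algebraMap_XClass h, hY]
    refine (Valuation.map_add _ _ _).trans (max_le ?_ ?_)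
    · rw [map_mul]
      refine (mul_le_of_le_one_left' (ordAt_algebraMap_le_one hP u)).trans
        (le_exp_neg_one (ordAt_self_lin_lt_one hP))
    · rw [map_mul]
      refine (mul_le_of_le_one_left' (ordAt_algebraMap_le_one hP v)).trans
        (le_exp_neg_one (ordAt_yF_sub_lt_one h))
  · exact ordAt_algebraMap_le_one hP a

lemma hasDiv_pointIdeal (Q : W.Point) :
    HasDiv (fun P => -if P = Q then 1 else 0) (pointIdeal W Q) := by
  rcases Q with _ | ⟨x, y, h⟩
  · have := HasDiv.one (W := W)
    refine ⟨fun z hz => ⟨(this.1 z hz).1, fun P hP => ?_⟩,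
      fun z hz => ⟨(this.2 z hz).1, fun P hP => ?_⟩⟩
    · beta_reduce; rw [← zero_def, if_neg hP]; exact (this.1 z hz).2 P hP
    · beta_reduce; rw [← zero_def, if_neg hP]; exact (this.2 z hz).2 P hP
  refine ⟨fun z hz => ?_, fun z hz => ?_⟩
  · obtain ⟨a, ha, rfl⟩ := (FractionalIdeal.mem_coeIdeal _).1 hz
    exact ⟨algebraMap_mem_puncturedRing a, mem_XYIdeal h ha⟩
  · have e : (((pointIdeal W (.some x y h))⁻¹ :
        (FractionalIdeal W.CoordinateRing⁰ W.FunctionField)ˣ) :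
        FractionalIdeal W.CoordinateRing⁰ W.FunctionField) =
        FractionalIdeal.spanSingleton _ (lin (.some x y h))⁻¹ *
          (XYIdeal W x (C (W.negY x y)) :
            FractionalIdeal W.CoordinateRing⁰ W.FunctionField) := by
      rw [mul_comm, ← FractionalIdeal.spanSingleton_inv, ← algebraMap_XClass h,
        ← FractionalIdeal.coeIdeal_span_singleton]
      rfl
    rw [e] at hz
    obtain ⟨w, hw, rfl⟩ := FractionalIdeal.mem_singleton_mul.1 hz
    obtain ⟨a, ha, rfl⟩ := (FractionalIdeal.mem_coeIdeal _).1 hw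
    refine ⟨mul_mem (lin_inv_mem _) (algebraMap_mem_puncturedRing a), fun P hP => ?_⟩
    rw [map_mul, map_inv₀, ordAt_lin_of_ne_zero hP, ← WithZero.exp_neg]
    refine (mul_le_mul_right (mem_XYIdeal ((nonsingular_neg ..).mpr h) ha P hP) _).trans ?_
    rw [← neg_some h, ← WithZero.exp_add, WithZero.exp_le_exp]
    simp only [eq_comm (a := Point.some x y h) (b := P), eq_neg_iff_add_eq_zero (b := P),
      eq_neg_iff_add_eq_zero (a := P), add_comm (Point.some x y h) P]
    split_ifs <;> simp

/-- The units of the coordinate ring have order zero at infinity. -/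
lemma ordInf_eq_one_of_isUnit {z : W.FunctionField}
    (h₁ : ∃ a : W.CoordinateRing, algebraMap _ _ a = z)
    (h₂ : ∃ a : W.CoordinateRing, algebraMap _ _ a = z⁻¹) (hz : z ≠ 0) : ordInf W z = 1 := by
  obtain ⟨a, rfl⟩ := h₁
  obtain ⟨b, hb⟩ := h₂
  have hab : a * b = 1 := by
    apply algebraMap_coordinateRing_injective
    rw [map_mul, hb, mul_inv_cancel₀ hz, map_one]
  have hu : IsUnit (Algebra.norm L[X] a) := (IsUnit.of_mul_eq_one b hab).map _
  rw [ordInf_algebraMap (by rintro rfl; simp at hz), natDegree_eq_zero_of_isUnit hu]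
  rfl

end Divisor

section Weil

variable {L : Type*} [Field L] {W : Affine L} [W.IsElliptic] [DecidableEq L] [IsSepClosed L]

open Affine CoordinateRing Point

/-- The finite set of points with `n P = T`. -/
def fib {n : ℕ} (hn : (n : L) ≠ 0) (T : W.Point) : Finset W.Point := (finite_nsmul_eq hn T).toFinset

lemma mem_fib {n : ℕ} {hn : (n : L) ≠ 0} {T P : W.Point} : P ∈ fib hn T ↔ n • P = T := by
  simp [fib]

lemma card_fib {n : ℕ} (hn : (n : L) ≠ 0) (T : W.Point) : (fib hn T).card = n ^ 2 := by
  rw [← card_nsmul_eq hn T, fib]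
  exact (Nat.card_eq_card_finite_toFinset _).symm

/-- The fractional ideal of the divisor of a Weil function. -/
def weilIdeal {n : ℕ} (hn : (n : L) ≠ 0) (T : W.Point) :
    (FractionalIdeal W.CoordinateRing⁰ W.FunctionField)ˣ :=
  (∏ P ∈ fib hn T, pointIdeal W P) * (∏ P ∈ fib hn 0, pointIdeal W P)⁻¹

lemma isWeilFunction_iff {n : ℕ} (hn : (n : L) ≠ 0) {T : W.Point} {g : W.FunctionField} :
    IsWeilFunction W n T g ↔ FractionalIdeal.spanSingleton W.CoordinateRing⁰ g =
      (weilIdeal hn T : FractionalIdeal W.CoordinateRing⁰ W.FunctionField) := by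
  have h (T : W.Point) : ∏ᶠ (P : W.Point) (_ : n • P = T), pointIdeal W P =
      ∏ P ∈ fib hn T, pointIdeal W P :=
    finprod_mem_eq_finite_toFinset_prod _ (finite_nsmul_eq hn T)
  rw [IsWeilFunction, h, h]
  rfl

lemma sum_fib {n : ℕ} (hn : (n : L) ≠ 0) {T : W.Point} (hT : n • T = 0) :
    ∑ P ∈ fib hn T, P = ∑ P ∈ fib hn 0, P := by
  obtain ⟨P₀, h₀⟩ := nsmul_surjective hn T
  have : ∑ P ∈ fib hn T, P = ∑ P ∈ fib hn 0, (P₀ + P) := by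
    symm
    refine Finset.sum_bij (fun P _ => P₀ + P) (fun P hP => ?_) (fun P _ Q _ h => add_left_cancel h)
      (fun P hP => ⟨P - P₀, ?_, by abel⟩) (fun _ _ => rfl)
    · rw [mem_fib] at hP ⊢
      rw [nsmul_add, hP, add_zero]; exact h₀
    · rw [mem_fib] at hP ⊢
      rw [nsmul_sub, hP, sub_eq_zero]; exact h₀.symm
  rw [this, Finset.sum_add_distrib, Finset.sum_const, card_fib, pow_two, mul_nsmul]
  have h₀' : n • P₀ = T := h₀
  rw [h₀', hT, zero_add]

/-- A Weil function exists, as the sum of the points with `n P = T` is `n² P₀ = n T = 0` plus the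
sum of the `n`-torsion points. -/
lemma exists_isWeilFunction {n : ℕ} (hn : (n : L) ≠ 0) {T : W.Point} (hT : n • T = 0) :
    ∃ g, IsWeilFunction W n T g := by
  have h1 (Q : W.Point) : ClassGroup.mk W.FunctionField (pointIdeal W Q) = (toClass Q).toMul := by
    rcases Q with _ | ⟨x, y, h⟩
    · exact map_one _
    · rfl
  have h2 (S : W.Point) : ClassGroup.mk W.FunctionField (∏ P ∈ fib hn S, pointIdeal W P) =
      (toClass (∑ P ∈ fib hn S, P)).toMul := by
    rw [map_prod, map_sum, toMul_sum]
    exact Finset.prod_congr rfl fun P _ => h1 P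
  have h3 : ClassGroup.mk W.FunctionField 1 = ClassGroup.mk W.FunctionField (weilIdeal hn T) := by
    rw [weilIdeal, map_mul, map_inv, h2, h2, sum_fib hn hT, map_one, mul_inv_cancel]
  obtain ⟨x, hx⟩ := ClassGroup.mk_eq_mk.1 h3
  refine ⟨x, (isWeilFunction_iff hn).2 ?_⟩
  rw [← hx, one_mul, coe_toPrincipalIdeal]

/-- Minus the order at `P` of a Weil function with parameter `T`. -/
def weilOrd (n : ℕ) (T P : W.Point) : ℤ :=
  (if n • P = 0 then 1 else 0) - (if n • P = T then 1 else 0)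

lemma hasDiv_prod_fib {n : ℕ} (hn : (n : L) ≠ 0) (T : W.Point) :
    HasDiv (fun P => -if n • P = T then 1 else 0) (∏ P ∈ fib hn T, pointIdeal W P) := by
  have := HasDiv.prod (fib hn T) (fun Q _ => hasDiv_pointIdeal Q)
  convert this using 2 with P
  rw [Finset.sum_apply, Finset.sum_neg_distrib, Finset.sum_ite_eq]
  simp only [mem_fib]

lemma IsWeilFunction.ne_zero {n : ℕ} (hn : (n : L) ≠ 0) {T : W.Point} {g : W.FunctionField}
    (hg : IsWeilFunction W n T g) : g ≠ 0 := by
  rintro rfl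
  rw [isWeilFunction_iff hn, FractionalIdeal.spanSingleton_zero] at hg
  exact (weilIdeal hn T).ne_zero hg.symm

lemma IsWeilFunction.mem {n : ℕ} (hn : (n : L) ≠ 0) {T : W.Point} {g : W.FunctionField}
    (hg : IsWeilFunction W n T g) : g ∈ puncturedRing W ∧ g⁻¹ ∈ puncturedRing W ∧
      ∀ P : W.Point, P ≠ 0 → ordAt P g = WithZero.exp (weilOrd n T P) := by
  have h0 := hg.ne_zero hn
  rw [isWeilFunction_iff hn] at hg
  have hd : HasDiv (weilOrd n T) (weilIdeal hn T) := by
    have := (hasDiv_prod_fib hn T).mul (hasDiv_prod_fib hn 0).inv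
    convert this using 1
    · funext P
      change _ - _ = - _ + - - _
      ring
    · rfl
  have h1 := hd.1 g (by rw [← hg]; exact FractionalIdeal.mem_spanSingleton_self _ _)
  have h2 := hd.2 g⁻¹ (by
    rw [← toPrincipalIdeal_eq_iff.2 (show FractionalIdeal.spanSingleton W.CoordinateRing⁰
      ((Units.mk0 g h0 : W.FunctionFieldˣ) : W.FunctionField) = _ from hg), ← map_inv,
      coe_toPrincipalIdeal]
    exact FractionalIdeal.mem_spanSingleton_self _ _)
  refine ⟨h1.1, h2.1, fun P hP => le_antisymm (h1.2 P hP) ?_⟩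
  have h3 := h2.2 P hP
  rw [map_inv₀, WithZero.exp_neg] at h3
  exact (inv_le_inv₀ (zero_lt_iff.2 ((ordAt P).ne_zero_iff.2 h0)) WithZero.exp_pos).1 h3

lemma prod_exp {ι : Type*} (s : Finset ι) (f : ι → ℤ) :
    ∏ i ∈ s, WithZero.exp (f i) = WithZero.exp (∑ i ∈ s, f i) := by
  classical
  induction s using Finset.induction_on with
  | empty => simp
  | insert i s hi ih => rw [Finset.prod_insert hi, Finset.sum_insert hi, ih, WithZero.exp_add]

lemma ordAt_prod_lin {n : ℕ} (hn : (n : L) ≠ 0) (T : W.Point) {P : W.Point} (hP : P ≠ 0) :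
    ordAt P (∏ Q ∈ fib hn T, lin Q) = WithZero.exp
      (-((if n • P = T then 1 else 0) + if n • (-P) = T then 1 else 0) : ℤ) := by
  rw [map_prod]
  simp only [ordAt_lin_of_ne_zero hP]
  rw [prod_exp, Finset.sum_neg_distrib, Finset.sum_add_distrib, Finset.sum_ite_eq',
    Finset.sum_ite_eq']
  simp only [mem_fib]

lemma ordInf_prod_lin {n : ℕ} (hn : (n : L) ≠ 0) (T : W.Point) :
    ordInf W (∏ Q ∈ fib hn T, lin Q) = WithZero.exp
      (2 * n ^ 2 - 2 * (if T = 0 then 1 else 0) : ℤ) := by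
  rw [map_prod]
  simp only [ordInf_lin]
  rw [prod_exp]
  have e : ∀ Q : W.Point, (if Q = 0 then (0 : ℤ) else 2) = 2 - if Q = 0 then 2 else 0 := by
    intro Q; split_ifs <;> simp
  simp only [e]
  rw [Finset.sum_sub_distrib, Finset.sum_ite_eq', Finset.sum_const, card_fib]
  simp only [mem_fib, nsmul_zero, nsmul_eq_mul, eq_comm (a := (0 : W.Point))]
  congr 1
  split_ifs <;> push_cast <;> ring

/-- The order at infinity is found by comparing `g · (g ∘ [-1])` with a quotient of products of
functions `x - x(Q)`. -/
theorem IsWeilFunction.ordAt_eq {n : ℕ} (hn : (n : L) ≠ 0) {T : W.Point} {g : W.FunctionField}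
    (hg : IsWeilFunction W n T g) (P : W.Point) : ordAt P g = WithZero.exp (weilOrd n T P) := by
  obtain ⟨h1, h2, h3⟩ := hg.mem hn
  have h0 := hg.ne_zero hn
  by_cases hP : P = 0
  swap
  · exact h3 P hP
  subst hP
  rw [ordAt_zero]
  have hl (S : W.Point) : ∏ Q ∈ fib hn S, lin Q ≠ 0 :=
    Finset.prod_ne_zero_iff.2 fun Q _ => lin_ne_zero Q
  have hm (S : W.Point) : ∏ Q ∈ fib hn S, lin Q ∈ puncturedRing W := prod_mem fun Q _ => lin_mem Q
  have hm' (S : W.Point) : (∏ Q ∈ fib hn S, lin Q)⁻¹ ∈ puncturedRing W := by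
    rw [← Finset.prod_inv_distrib]
    exact prod_mem fun Q _ => lin_inv_mem Q
  set z := g * conj W g * (∏ Q ∈ fib hn T, lin Q)⁻¹ * ∏ Q ∈ fib hn 0, lin Q with hz
  have hz0 : z ≠ 0 := mul_ne_zero (mul_ne_zero (mul_ne_zero h0 ((_root_.map_ne_zero _).2 h0))
    (inv_ne_zero (hl T))) (hl 0)
  have hzm : z ∈ puncturedRing W := mul_mem (mul_mem (mul_mem h1 (conj_mem h1)) (hm' T)) (hm 0)
  have hzm' : z⁻¹ ∈ puncturedRing W := by
    rw [hz, mul_inv, mul_inv, mul_inv, inv_inv, ← map_inv₀]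
    exact mul_mem (mul_mem (mul_mem h2 (conj_mem h2)) (hm T)) (hm' 0)
  have hv (P : W.Point) (hP : P ≠ 0) : ordAt P z = 1 := by
    rw [hz, map_mul, map_mul, map_mul, map_inv₀, ordAt_conj, h3 P hP, h3 (-P) (neg_ne_zero.2 hP),
      ordAt_prod_lin hn T hP, ordAt_prod_lin hn 0 hP, ← WithZero.exp_neg, ← WithZero.exp_add,
      ← WithZero.exp_add, ← WithZero.exp_add, ← WithZero.exp_zero, WithZero.exp_inj, weilOrd,
      weilOrd]
    ring
  have hone := ordInf_eq_one_of_isUnit (exists_algebraMap_eq hzm fun P hP => (hv P hP).le)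
    (exists_algebraMap_eq hzm' fun P hP => by rw [map_inv₀, hv P hP, inv_one]) hz0
  obtain ⟨m, hm⟩ : ∃ m : ℤ, ordInf W g = WithZero.exp m :=
    ⟨_, (WithZero.exp_log ((ordInf W).ne_zero_iff.2 h0)).symm⟩
  rw [hz, map_mul, map_mul, map_mul, map_inv₀, ordInf_conj, hm, ordInf_prod_lin, ordInf_prod_lin,
    ← WithZero.exp_neg, ← WithZero.exp_add,
    ← WithZero.exp_add, ← WithZero.exp_add, ← WithZero.exp_zero, WithZero.exp_inj,
    if_pos rfl] at hone
  rw [hm, WithZero.exp_inj, weilOrd, nsmul_zero, if_pos rfl]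
  simp only [eq_comm (a := (0 : W.Point))]
  split_ifs at hone ⊢ <;> omega

end Weil

/-! ### The Weil pairing -/

section Value

variable {L : Type*} [Field L] {W : Affine L} [W.IsElliptic] [DecidableEq L]

open Affine CoordinateRing Point

lemma ordAt_sub_evalEval_lt_one {x y : L} (h : W.Nonsingular x y) (a : W.CoordinateRing) :
    ordAt (.some x y h) (algebraMap _ _ a - algebraMap L _ (AdjoinRoot.evalEval h.1 a)) < 1 := by
  have hx (p : L[X]) :
      ordAt (.some x y h) (aeval (xF W) p - algebraMap L _ (p.eval x)) < 1 := by
    obtain ⟨q, hq⟩ := X_sub_C_dvd_sub_C_eval (p := p) (a := x)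
    have := congrArg (aeval (xF W)) hq
    simp only [map_sub, map_mul, aeval_X, aeval_C] at this
    rw [this, map_mul]
    exact mul_lt_one_of_lt_of_le (ordAt_xF_sub_lt_one h)
      (ordAt_aeval_le_one (ordAt_xF_le_one (some_ne_zero h)) q)
  obtain ⟨p, q, rfl⟩ := exists_smul_basis_eq a
  have e : AdjoinRoot.evalEval h.1 (p • 1 + q • CoordinateRing.mk W X) =
      p.eval x + q.eval x * y := by
    rw [CoordinateRing.smul, CoordinateRing.smul, mul_one, map_add, map_mul]
    have key (f : L[X][X]) :
        AdjoinRoot.evalEval h.1 (CoordinateRing.mk W f) = f.evalEval x y :=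
      AdjoinRoot.evalEval_mk h.1 f
    rw [key, key, key]
    simp [evalEval_C]
  rw [e, algebraMap_smul_add_smul]
  have e2 : aeval (xF W) p + aeval (xF W) q * yF W - algebraMap L _ (p.eval x + q.eval x * y) =
      (aeval (xF W) p - algebraMap L _ (p.eval x)) +
        ((aeval (xF W) q - algebraMap L _ (q.eval x)) * yF W +
          algebraMap L _ (q.eval x) * (yF W - algebraMap L _ y)) := by
    rw [map_add, map_mul]; ring
  rw [e2]
  refine (Valuation.map_add _ _ _).trans_lt (max_lt (hx p)
    ((Valuation.map_add _ _ _).trans_lt (max_lt ?_ ?_)))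
  · rw [map_mul]
    exact mul_lt_one_of_lt_of_le (hx q) (ordAt_yF_le_one (some_ne_zero h))
  · rw [map_mul]
    rw [mul_comm]
    exact mul_lt_one_of_lt_of_le (ordAt_yF_sub_lt_one h) (ordAt_const_le_one _ _)

lemma ordAt_eq_one_iff {x y : L} (h : W.Nonsingular x y) (a : W.CoordinateRing) :
    ordAt (.some x y h) (algebraMap _ _ a) = 1 ↔ AdjoinRoot.evalEval h.1 a ≠ 0 := by
  have h1 := ordAt_sub_evalEval_lt_one h a
  constructor
  · intro h2 h3
    rw [h3, _root_.map_zero, sub_zero, h2] at h1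
    exact lt_irrefl _ h1
  · intro h2
    rw [← ordAt_const (.some x y h) h2]
    rw [← ordAt_const (.some x y h) h2] at h1
    have := Valuation.map_add_eq_of_lt_right _ h1
    rwa [sub_add_cancel] at this

lemma HasAffineValue.ordAt_sub_lt_one {g : W.FunctionField} {P : W.Point} {u : L}
    (h : HasAffineValue W g P u) : ordAt P (g - algebraMap L _ u) < 1 := by
  rcases P with _ | ⟨x, y, hP⟩
  · exact h.elim
  obtain ⟨a, b, e, hb, ha⟩ := h
  have hb1 := (ordAt_eq_one_iff hP b).2 hb
  have e2 : (g - algebraMap L _ u) * algebraMap _ _ b =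
      (algebraMap _ _ a - algebraMap L _ (AdjoinRoot.evalEval hP.1 a)) -
      algebraMap L _ u * (algebraMap _ _ b - algebraMap L _ (AdjoinRoot.evalEval hP.1 b)) := by
    rw [sub_mul, e, ha, map_mul]; ring
  have e3 := congrArg (ordAt (.some x y hP)) e2
  rw [map_mul, hb1, mul_one] at e3
  rw [e3]
  refine (Valuation.map_sub _ _ _).trans_lt (max_lt (ordAt_sub_evalEval_lt_one hP a) ?_)
  rw [map_mul, mul_comm]
  exact mul_lt_one_of_lt_of_le (ordAt_sub_evalEval_lt_one hP b) (ordAt_const_le_one _ _)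

lemma exists_hasAffineValue {z : W.FunctionField} (hz : z ∈ puncturedRing W) :
    ∃ s : Set W.Point, s.Finite ∧ ∀ P ∉ s, ∃ u, HasAffineValue W z P u := by
  obtain ⟨l, a, ha⟩ := exists_mul_prod_lin hz
  obtain ⟨b, hb⟩ := exists_algebraMap_eq (z := (l.map lin).prod)
    (list_prod_mem fun w hw => by
      obtain ⟨P, -, rfl⟩ := List.mem_map.1 hw
      exact lin_mem P) (fun P hP => ordAt_list_prod_lin_le_one hP l)
  refine ⟨{0} ∪ ({P | P ∈ l} ∪ {P | -P ∈ l}), (Set.finite_singleton 0).union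
    (l.finite_toSet.union (l.finite_toSet.preimage neg_injective.injOn)), fun P hP => ?_⟩
  simp only [Set.mem_union, Set.mem_singleton_iff, Set.mem_ofPred_eq, not_or] at hP
  have h1 : ordAt P ((l.map lin).prod) = 1 := by
    rw [map_list_prod]
    refine List.prod_eq_one fun w hw => ?_
    simp only [List.map_map, List.mem_map, Function.comp_apply] at hw
    obtain ⟨Q, hQ, rfl⟩ := hw
    rw [ordAt_lin_of_ne_zero hP.1, if_neg (by rintro rfl; exact hP.2.1 hQ),
      if_neg (by rintro rfl; exact hP.2.2 hQ)]
    simp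
  rcases P with _ | ⟨x, y, h⟩
  · exact absurd rfl hP.1
  rw [← hb, ordAt_eq_one_iff] at h1
  exact ⟨AdjoinRoot.evalEval h.1 a / AdjoinRoot.evalEval h.1 b, a, b, by rw [hb, ha], h1,
    (div_mul_cancel₀ _ h1).symm⟩

/-- A function is determined by its divisor up to a constant. -/
lemma exists_eq_const_mul {z w : W.FunctionField} (hz : z ∈ puncturedRing W)
    (hw : w⁻¹ ∈ puncturedRing W) (h0 : w ≠ 0) (h : ∀ P : W.Point, ordAt P z = ordAt P w) :
    ∃ c : L, z = algebraMap L _ c * w := by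
  obtain ⟨c, hc⟩ := exists_const_of_ordAt_le_one (mul_mem hz hw) fun P => by
    rw [map_mul, map_inv₀, h, mul_inv_cancel₀ ((ordAt P).ne_zero_iff.2 h0)]
  exact ⟨c, by rw [← hc, inv_mul_cancel_right₀ h0]⟩

end Value

section Pairing

variable {L : Type*} [Field L] {W : Affine L} [W.IsElliptic] [DecidableEq L]

open Affine CoordinateRing Point

/-- The function `g` has the divisor `∑_{nP = T} (P) - ∑_{nQ = O} (Q)`, expressed by valuations. -/
structure HasWeilDivisor (n : ℕ) (T : W.Point) (g : W.FunctionField) : Prop where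
  ne_zero : g ≠ 0
  mem : g ∈ puncturedRing W
  inv_mem : g⁻¹ ∈ puncturedRing W
  ordAt_eq : ∀ P : W.Point, ordAt P g = WithZero.exp (weilOrd n T P)

lemma HasWeilDivisor.exists_trans_eq {n : ℕ} {S T : W.Point} (hS : n • S = 0) {g : W.FunctionField}
    (hg : HasWeilDivisor n T g) : ∃ ζ : L, trans S g = algebraMap L _ ζ * g := by
  refine exists_eq_const_mul (trans_mem S hg.mem) hg.inv_mem hg.ne_zero fun P => ?_
  rw [ordAt_trans, hg.ordAt_eq, hg.ordAt_eq, weilOrd, weilOrd, nsmul_add, hS, add_zero]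

lemma HasWeilDivisor.eq_const_mul {n : ℕ} {T : W.Point} {g g' : W.FunctionField}
    (hg : HasWeilDivisor n T g) (hg' : HasWeilDivisor n T g') :
    ∃ c : L, g' = algebraMap L _ c * g :=
  exists_eq_const_mul hg'.mem hg.inv_mem hg.ne_zero fun P => by rw [hg.ordAt_eq, hg'.ordAt_eq]

lemma HasWeilDivisor.trans_eq {n : ℕ} {S T : W.Point} {g g' : W.FunctionField} {ζ : L}
    (hg : HasWeilDivisor n T g) (hg' : HasWeilDivisor n T g')
    (h : trans S g = algebraMap L _ ζ * g) : trans S g' = algebraMap L _ ζ * g' := by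
  obtain ⟨c, rfl⟩ := hg.eq_const_mul hg'
  rw [map_mul, h, AlgHom.commutes]; ring

/-- If `n P₁ = T₁`, then `g₁(P) g₂(P - P₁)` is a Weil function for `T₁ + T₂`; this gives the
additivity of the pairing in its second argument. -/
lemma HasWeilDivisor.mul_trans {n : ℕ} {T₁ T₂ P₁ : W.Point} (hP : n • P₁ = T₁)
    {g₁ g₂ : W.FunctionField} (h₁ : HasWeilDivisor n T₁ g₁) (h₂ : HasWeilDivisor n T₂ g₂) :
    HasWeilDivisor n (T₁ + T₂) (g₁ * trans (-P₁) g₂) where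
  ne_zero := mul_ne_zero h₁.ne_zero ((_root_.map_ne_zero _).2 h₂.ne_zero)
  mem := mul_mem h₁.mem (trans_mem _ h₂.mem)
  inv_mem := by
    rw [mul_inv, ← map_inv₀]
    exact mul_mem h₁.inv_mem (trans_mem _ h₂.inv_mem)
  ordAt_eq P := by
    rw [map_mul, ordAt_trans, h₁.ordAt_eq, h₂.ordAt_eq, ← WithZero.exp_add, WithZero.exp_inj]
    simp only [weilOrd, ← sub_eq_add_neg, nsmul_sub, hP, sub_eq_iff_eq_add, zero_add,
      add_comm T₂ T₁]
    ring

variable [IsSepClosed L]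

lemma IsWeilFunction.hasWeilDivisor {n : ℕ} (hn : (n : L) ≠ 0) {T : W.Point} {g : W.FunctionField}
    (hg : IsWeilFunction W n T g) : HasWeilDivisor n T g :=
  ⟨hg.ne_zero hn, (hg.mem hn).1, (hg.mem hn).2.1, hg.ordAt_eq hn⟩

/-- The values of a Weil function at `P` and `P + S` differ by the factor by which the translation
by `S` multiplies the function, and there are points at which both values are defined and
nonzero. -/
theorem weilPairing_eq {n : ℕ} (hn : (n : L) ≠ 0) {S T : W.Point} (hT : n • T = 0)
    {g : W.FunctionField} (hg : HasWeilDivisor n T g) {ζ : L}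
    (h : trans S g = algebraMap L _ ζ * g) : weilPairing W n S T = ζ := by
  have valid {g' : W.FunctionField} (hg' : IsWeilFunction W n T g') {P : W.Point} {u v : L}
      (hu : HasAffineValue W g' P u) (hv : HasAffineValue W g' (P + S) v) : v = ζ * u := by
    have hu' := hu.ordAt_sub_lt_one
    have hv' := hv.ordAt_sub_lt_one
    rw [← ordAt_trans, map_sub, AlgHom.commutes, hg.trans_eq (hg'.hasWeilDivisor hn) h] at hv'
    have e : algebraMap L W.FunctionField (v - ζ * u) =
        algebraMap L _ ζ * (g' - algebraMap L _ u) -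
          (algebraMap L _ ζ * g' - algebraMap L _ v) := by
      rw [map_sub, map_mul]; ring
    refine sub_eq_zero.1 (eq_zero_of_ordAt_lt_one (P := P) ?_)
    rw [e]
    refine (Valuation.map_sub _ _ _).trans_lt (max_lt ?_ hv')
    rw [map_mul, mul_comm]
    exact mul_lt_one_of_lt_of_le hu' (ordAt_const_le_one _ _)
  obtain ⟨g₀, hg₀⟩ := exists_isWeilFunction hn hT
  obtain ⟨g', hg', hval⟩ := Classical.epsilon_spec
    (p := fun ζ => ∃ g, IsWeilFunction W n T g ∧ ∀ (P : W.Point) (u v : L),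
      HasAffineValue W g P u → HasAffineValue W g (P + S) v → v = ζ * u)
    ⟨ζ, g₀, hg₀, fun P u v hu hv => valid hg₀ hu hv⟩
  change ∀ (P : W.Point) (u v : L), HasAffineValue W g' P u → HasAffineValue W g' (P + S) v →
    v = weilPairing W n S T * u at hval
  have hd := hg'.hasWeilDivisor hn
  obtain ⟨s, hs, hsv⟩ := exists_hasAffineValue hd.mem
  have := infinite_point W
  -- A point at which both values are defined and `g'` has neither a zero nor a pole.
  obtain ⟨P, hP⟩ := ((hs.union (hs.preimage (add_left_injective S).injOn)).union
    ((finite_nsmul_eq hn (0 : W.Point)).union (finite_nsmul_eq hn T))).exists_notMem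
  simp only [Set.mem_union, Set.mem_preimage, Set.mem_ofPred_eq, not_or] at hP
  obtain ⟨u, hu⟩ := hsv P hP.1.1
  obtain ⟨v, hv⟩ := hsv (P + S) hP.1.2
  have hu0 : u ≠ 0 := by
    rintro rfl
    have := hu.ordAt_sub_lt_one
    rw [_root_.map_zero, sub_zero, hd.ordAt_eq, weilOrd, if_neg hP.2.1, if_neg hP.2.2] at this
    exact lt_irrefl _ this
  exact mul_right_cancel₀ hu0 ((hval P u v hu hv).symm.trans (valid hg' hu hv))

lemma exists_hasWeilDivisor {n : ℕ} (hn : (n : L) ≠ 0) {T : W.Point} (hT : n • T = 0) :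
    ∃ g, HasWeilDivisor n T g :=
  (exists_isWeilFunction hn hT).imp fun _ hg => hg.hasWeilDivisor hn

lemma HasWeilDivisor.trans_eq_weilPairing {n : ℕ} (hn : (n : L) ≠ 0) {S T : W.Point}
    (hS : n • S = 0) (hT : n • T = 0) {g : W.FunctionField} (hg : HasWeilDivisor n T g) :
    trans S g = algebraMap L _ (weilPairing W n S T) * g := by
  obtain ⟨ζ, h⟩ := hg.exists_trans_eq hS
  rwa [weilPairing_eq hn hT hg h]

lemma weilPairing_add_left {n : ℕ} (hn : (n : L) ≠ 0) {S S' T : W.Point} (hS : n • S = 0)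
    (hS' : n • S' = 0) (hT : n • T = 0) :
    weilPairing W n (S + S') T = weilPairing W n S T * weilPairing W n S' T := by
  obtain ⟨g, hg⟩ := exists_hasWeilDivisor hn hT
  refine weilPairing_eq hn hT hg ?_
  rw [← trans_trans, hg.trans_eq_weilPairing hn hS' hT, map_mul, AlgHom.commutes,
    hg.trans_eq_weilPairing hn hS hT, map_mul]
  ring

lemma weilPairing_zero_left {n : ℕ} (hn : (n : L) ≠ 0) {T : W.Point} (hT : n • T = 0) :
    weilPairing W n 0 T = 1 := by
  obtain ⟨g, hg⟩ := exists_hasWeilDivisor hn hT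
  exact weilPairing_eq hn hT hg (by rw [trans_zero, map_one, one_mul])

lemma weilPairing_pow {n : ℕ} (hn : (n : L) ≠ 0) {S T : W.Point} (hS : n • S = 0) (hT : n • T = 0) :
    weilPairing W n S T ^ n = 1 := by
  have h (k : ℕ) : weilPairing W n (k • S) T = weilPairing W n S T ^ k := by
    induction k with
    | zero => rw [zero_nsmul, weilPairing_zero_left hn hT, pow_zero]
    | succ k ih =>
      rw [succ_nsmul, weilPairing_add_left hn (by rw [nsmul_left_comm, hS, nsmul_zero]) hS hT, ih,
        pow_succ]
  rw [← h, hS, weilPairing_zero_left hn hT]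

lemma weilPairing_add_right {n : ℕ} (hn : (n : L) ≠ 0) {S T T' : W.Point} (hS : n • S = 0)
    (hT : n • T = 0) (hT' : n • T' = 0) :
    weilPairing W n S (T + T') = weilPairing W n S T * weilPairing W n S T' := by
  obtain ⟨g, hg⟩ := exists_hasWeilDivisor hn hT
  obtain ⟨g', hg'⟩ := exists_hasWeilDivisor hn hT'
  obtain ⟨P, hP⟩ := nsmul_surjective hn T
  refine weilPairing_eq hn (by rw [nsmul_add, hT, hT', add_zero]) (hg.mul_trans hP hg') ?_
  rw [map_mul, trans_trans, add_comm, ← trans_trans, hg.trans_eq_weilPairing hn hS hT,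
    hg'.trans_eq_weilPairing hn hS hT', map_mul, AlgHom.commutes, map_mul]
  ring

end Pairing

/-! ### Galois equivariance of the Weil pairing -/

section Galois

variable {L : Type*} [Field L] {W : Affine L}

open Affine CoordinateRing Point

lemma ringHom_ext_functionField {B : Type*} [Field B] {φ ψ : W.FunctionField →+* B}
    (hc : ∀ c : L, φ (algebraMap L _ c) = ψ (algebraMap L _ c)) (hx : φ (xF W) = ψ (xF W))
    (hy : φ (yF W) = ψ (yF W)) : φ = ψ := by
  have hp (p : L[X]) : φ (aeval (xF W) p) = ψ (aeval (xF W) p) := by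
    rw [aeval_def, hom_eval₂, hom_eval₂, hx]
    congr 1
    exact RingHom.ext hc
  refine RingHom.ext fun z => ?_
  obtain ⟨a, b, hb, rfl⟩ := IsFractionRing.div_surjective (A := W.CoordinateRing) z
  have ha (a : W.CoordinateRing) : φ (algebraMap _ _ a) = ψ (algebraMap _ _ a) := by
    obtain ⟨p, q, e⟩ := exists_eq_add_mul_y a
    rw [e, map_add, map_add, map_mul, map_mul, hp, hp, hy]
  rw [map_div₀, map_div₀, ha, ha]

variable {K : Type*} [Field K] [Algebra K L] {E : Affine K}

lemma exists_galMap (σ : Gal(L/K)) :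
    ∃ φ : (E⁄L).FunctionField →+* (E⁄L).FunctionField, ∀ p q : L[X],
      φ (algebraMap (E⁄L).CoordinateRing _ (p • 1 + q • CoordinateRing.mk (E⁄L) X)) =
      algebraMap (E⁄L).CoordinateRing _ (p.map (σ : L →+* L) • 1 +
        q.map (σ : L →+* L) • CoordinateRing.mk (E⁄L) X) := by
  let i : L[X] →+* (E⁄L).FunctionField :=
    eval₂RingHom ((algebraMap L (E⁄L).FunctionField).comp (σ : L →+* L)) (xF (E⁄L))
  have hi (p : L[X]) : i p = aeval (xF (E⁄L)) (p.map (σ : L →+* L)) := by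
    rw [aeval_def, eval₂_map]; rfl
  have hσ (c : K) : (σ : L →+* L) (algebraMap K L c) = algebraMap K L c := σ.commutes c
  have h0 : (E⁄L).polynomial.eval₂ i (yF (E⁄L)) = 0 := by
    have := (equation_iff ..).1 (equation_xF_yF (W := E⁄L))
    simp only [Affine.polynomial, eval₂_add, eval₂_sub, eval₂_mul, eval₂_pow, eval₂_X, eval₂_C, hi]
    simp only [Polynomial.map_add, Polynomial.map_mul, Polynomial.map_pow, Polynomial.map_X,
      Polynomial.map_C, map_add, map_mul, map_pow, aeval_X, aeval_C]
    have h1 : (σ : L →+* L) (E⁄L).a₁ = (E⁄L).a₁ := hσ _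
    have h2 : (σ : L →+* L) (E⁄L).a₂ = (E⁄L).a₂ := hσ _
    have h3 : (σ : L →+* L) (E⁄L).a₃ = (E⁄L).a₃ := hσ _
    have h4 : (σ : L →+* L) (E⁄L).a₄ = (E⁄L).a₄ := hσ _
    have h6 : (σ : L →+* L) (E⁄L).a₆ = (E⁄L).a₆ := hσ _
    rw [h1, h2, h3, h4, h6]
    change yF (E⁄L) ^ 2 + algebraMap L _ (E⁄L).a₁ * xF (E⁄L) * yF (E⁄L) +
      algebraMap L _ (E⁄L).a₃ * yF (E⁄L) = xF (E⁄L) ^ 3 + algebraMap L _ (E⁄L).a₂ * xF (E⁄L) ^ 2 +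
        algebraMap L _ (E⁄L).a₄ * xF (E⁄L) + algebraMap L _ (E⁄L).a₆ at this
    linear_combination this
  let f : (E⁄L).CoordinateRing →+* (E⁄L).FunctionField := AdjoinRoot.lift i (yF (E⁄L)) h0
  have hf (p q : L[X]) : f (p • 1 + q • CoordinateRing.mk (E⁄L) X) =
      algebraMap (E⁄L).CoordinateRing _ (p.map (σ : L →+* L) • 1 +
        q.map (σ : L →+* L) • CoordinateRing.mk (E⁄L) X) := by
    have hC (p : L[X]) : f (CoordinateRing.mk (E⁄L) (C p)) = i p := AdjoinRoot.lift_of h0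
    have hX : f (CoordinateRing.mk (E⁄L) X) = yF (E⁄L) := AdjoinRoot.lift_root h0
    rw [CoordinateRing.smul, CoordinateRing.smul, mul_one, map_add, map_mul, hC, hC, hX, hi, hi,
      algebraMap_smul_add_smul]
  have hinj : Function.Injective f := by
    rw [injective_iff_map_eq_zero]
    intro a ha
    obtain ⟨p, q, rfl⟩ := exists_smul_basis_eq a
    rw [hf, map_eq_zero_iff _ algebraMap_coordinateRing_injective] at ha
    have := smul_basis_eq_zero ha
    have hs : Function.Injective (σ : L →+* L) := σ.injective
    rw [(Polynomial.map_eq_zero_iff hs).1 this.1, (Polynomial.map_eq_zero_iff hs).1 this.2]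
    simp
  refine ⟨IsFractionRing.lift hinj, fun p q => ?_⟩
  rw [← hf]
  exact IsFractionRing.lift_algebraMap hinj _

/-- The Galois action on the function field of a curve defined over `K`. -/
def galMap (σ : Gal(L/K)) : (E⁄L).FunctionField →+* (E⁄L).FunctionField := (exists_galMap σ).choose

lemma galMap_algebraMap (σ : Gal(L/K)) (p q : L[X]) :
    galMap σ (algebraMap (E⁄L).CoordinateRing (E⁄L).FunctionField
        (p • 1 + q • CoordinateRing.mk (E⁄L) X)) =
      algebraMap (E⁄L).CoordinateRing _ (p.map (σ : L →+* L) • 1 +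
        q.map (σ : L →+* L) • CoordinateRing.mk (E⁄L) X) := (exists_galMap σ).choose_spec p q

lemma galMap_xF (σ : Gal(L/K)) : galMap σ (xF (E⁄L)) = xF (E⁄L) := by
  have := galMap_algebraMap (E := E) σ X 0
  rw [algebraMap_smul_add_smul, algebraMap_smul_add_smul] at this
  simpa using this

lemma galMap_yF (σ : Gal(L/K)) : galMap σ (yF (E⁄L)) = yF (E⁄L) := by
  have := galMap_algebraMap (E := E) σ 0 1
  rw [algebraMap_smul_add_smul, algebraMap_smul_add_smul] at this
  simpa using this

lemma galMap_const (σ : Gal(L/K)) (c : L) :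
    galMap σ (algebraMap L (E⁄L).FunctionField c) = algebraMap L _ (σ c) := by
  have := galMap_algebraMap (E := E) σ (C c) 0
  rw [algebraMap_smul_add_smul, algebraMap_smul_add_smul] at this
  simpa using this

lemma galMap_const_base (σ : Gal(L/K)) (c : K) :
    galMap σ (algebraMap L (E⁄L).FunctionField (algebraMap K L c)) =
      algebraMap L _ (algebraMap K L c) := by
  rw [galMap_const, σ.commutes]

lemma ordInf_galMap (σ : Gal(L/K)) (z : (E⁄L).FunctionField) :
    ordInf (E⁄L) (galMap σ z) = ordInf (E⁄L) z := by
  have hs : Function.Injective (σ : L →+* L) := σ.injective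
  have ha (a : (E⁄L).CoordinateRing) :
      ordInf (E⁄L) (galMap σ (algebraMap _ _ a)) = ordInf (E⁄L) (algebraMap _ _ a) := by
    by_cases h0 : a = 0
    · simp [h0]
    have h1 : galMap σ (algebraMap _ (E⁄L).FunctionField a) ≠ 0 := by
      rwa [Ne, map_eq_zero, map_eq_zero_iff _ algebraMap_coordinateRing_injective]
    obtain ⟨p, q, rfl⟩ := exists_smul_basis_eq a
    rw [galMap_algebraMap] at h1 ⊢
    rw [Ne, map_eq_zero_iff _ algebraMap_coordinateRing_injective] at h1
    rw [ordInf_algebraMap h0, ordInf_algebraMap h1]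
    congr 2
    refine natDegree_eq_of_degree_eq ?_
    rw [degree_norm_smul_basis, degree_norm_smul_basis, degree_map_eq_of_injective hs,
      degree_map_eq_of_injective hs]
  obtain ⟨a, b, hb, rfl⟩ := IsFractionRing.div_surjective (A := (E⁄L).CoordinateRing) z
  rw [map_div₀, map_div₀, map_div₀, ha, ha]

variable [DecidableEq L] [E.IsElliptic]

omit [DecidableEq L] [E.IsElliptic] in
lemma nonsingular_apply (σ : Gal(L/K)) {x y : L} (h : (E⁄L).Nonsingular x y) :
    (E⁄L).Nonsingular (σ x) (σ y) :=
  (E.baseChange_nonsingular (σ : L →ₐ[K] L).injective ..).mpr h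

lemma smul_some (σ : Gal(L/K)) {x y : L} (h : (E⁄L).Nonsingular x y) :
    σ • (.some x y h : (E⁄L).Point) = .some (σ x) (σ y) (nonsingular_apply σ h) := rfl

lemma galMap_trans (σ : Gal(L/K)) (P : (E⁄L).Point) (z : (E⁄L).FunctionField) :
    galMap σ (trans P z) = trans (σ • P) (galMap σ z) := by
  rcases P with _ | ⟨x, y, h⟩
  · have h0 : σ • (Point.zero : (E⁄L).Point) = 0 := smul_zero σ
    rw [h0, ← zero_def, trans_zero, trans_zero]
  rw [smul_some]
  have hs := trans_some h
  have ht := trans_some (nonsingular_apply σ h)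
  have hl : galMap σ (chord (W := E⁄L) x y) = chord (σ x) (σ y) := by
    rw [chord, chord, map_div₀, map_sub, map_sub, galMap_xF, galMap_yF, galMap_const, galMap_const]
  have a₁ : galMap σ (algebraMap L (E⁄L).FunctionField (E⁄L).a₁) = algebraMap L _ (E⁄L).a₁ :=
    galMap_const_base σ _
  have a₂ : galMap σ (algebraMap L (E⁄L).FunctionField (E⁄L).a₂) = algebraMap L _ (E⁄L).a₂ :=
    galMap_const_base σ _
  have a₃ : galMap σ (algebraMap L (E⁄L).FunctionField (E⁄L).a₃) = algebraMap L _ (E⁄L).a₃ :=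
    galMap_const_base σ _
  have hx : galMap σ (trans (.some x y h) (xF (E⁄L))) =
      trans (.some (σ x) (σ y) (nonsingular_apply σ h)) (xF (E⁄L)) := by
    rw [hs.1, ht.1]
    simp only [map_sub, map_add, map_mul, map_pow, hl, a₁, a₂, galMap_xF, galMap_const]
  have hy : galMap σ (trans (.some x y h) (yF (E⁄L))) =
      trans (.some (σ x) (σ y) (nonsingular_apply σ h)) (yF (E⁄L)) := by
    rw [hs.2, ht.2]
    simp only [map_sub, map_add, map_mul, map_neg, hl, a₁, a₃, galMap_xF, galMap_yF, hx]
  have : (galMap σ).comp (trans (.some x y h)).toRingHom =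
      (trans (.some (σ x) (σ y) (nonsingular_apply σ h))).toRingHom.comp (galMap σ) := by
    refine ringHom_ext_functionField (fun c => ?_) ?_ ?_
    · change galMap σ (trans _ _) = trans _ (galMap σ _)
      rw [AlgHom.commutes, galMap_const, AlgHom.commutes]
    · change galMap σ (trans _ _) = trans _ (galMap σ _)
      rw [hx, galMap_xF]
    · change galMap σ (trans _ _) = trans _ (galMap σ _)
      rw [hy, galMap_yF]
  exact DFunLike.congr_fun this z

lemma ordAt_galMap (σ : Gal(L/K)) (P : (E⁄L).Point) (z : (E⁄L).FunctionField) :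
    ordAt (σ • P) (galMap σ z) = ordAt P z := by
  change ordInf _ (trans _ _) = ordInf _ (trans _ _)
  rw [← galMap_trans, ordInf_galMap]

lemma galMap_mem (σ : Gal(L/K)) {z : (E⁄L).FunctionField} (hz : z ∈ puncturedRing (E⁄L)) :
    galMap σ z ∈ puncturedRing (E⁄L) := by
  induction hz using Algebra.adjoin_induction with
  | mem z hz =>
    rcases hz with (rfl | rfl) | ⟨P, rfl⟩
    · rw [galMap_xF]; exact xF_mem
    · rw [galMap_yF]; exact yF_mem
    · have : galMap σ (lin P) = lin (σ • P) := by
        rcases P with _ | ⟨x, y, h⟩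
        · have h0 : σ • (Point.zero : (E⁄L).Point) = 0 := smul_zero σ
          rw [h0, ← zero_def, lin_zero, map_neg, map_one]
        · rw [smul_some, lin_some, lin_some, map_sub, galMap_xF, galMap_const]
      rw [map_inv₀, this]; exact lin_inv_mem _
  | algebraMap r => rw [galMap_const]; exact algebraMap_mem _ _
  | add z w _ _ h₁ h₂ => rw [map_add]; exact add_mem h₁ h₂
  | mul z w _ _ h₁ h₂ => rw [map_mul]; exact mul_mem h₁ h₂

lemma nsmul_smul_eq (σ : Gal(L/K)) (n : ℕ) (P : (E⁄L).Point) : n • (σ • P) = σ • (n • P) :=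
  (map_nsmul (DistribSMul.toAddMonoidHom _ σ) n P).symm

theorem weilPairing_smul [IsSepClosed L] {n : ℕ} (hn : (n : L) ≠ 0) (σ : Gal(L/K))
    {S T : (E⁄L).Point} (hS : n • S = 0) (hT : n • T = 0) :
    weilPairing (E⁄L) n (σ • S) (σ • T) = σ (weilPairing (E⁄L) n S T) := by
  obtain ⟨g, hg⟩ := exists_hasWeilDivisor hn hT
  have hg' : HasWeilDivisor n (σ • T) (galMap σ g) :=
    { ne_zero := (_root_.map_ne_zero _).2 hg.ne_zero
      mem := galMap_mem σ hg.mem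
      inv_mem := by rw [← map_inv₀]; exact galMap_mem σ hg.inv_mem
      ordAt_eq := fun P => by
        obtain ⟨Q, rfl⟩ : ∃ Q, P = σ • Q := ⟨σ⁻¹ • P, (smul_inv_smul σ P).symm⟩
        rw [ordAt_galMap, hg.ordAt_eq, weilOrd, weilOrd, nsmul_smul_eq]
        simp only [smul_eq_zero_iff_eq, smul_left_cancel_iff] }
  refine weilPairing_eq hn (by rw [nsmul_smul_eq, hT, smul_zero]) hg' ?_
  rw [← galMap_trans, hg.trans_eq_weilPairing hn hS hT, map_mul, galMap_const]

end Galois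

/-! ### Nondegeneracy of the Weil pairing -/

section Residue

variable {L : Type*} [Field L] {W : Affine L}

open Affine CoordinateRing Point

lemma exists_ordInf_aeval_sub_lt {p : L[X]} (hp : p ≠ 0) :
    ∃ c : L, c ≠ 0 ∧ ordInf W (aeval (xF W) p - algebraMap L _ c * xF W ^ p.natDegree) <
      WithZero.exp (2 * p.natDegree : ℤ) := by
  refine ⟨p.leadingCoeff, leadingCoeff_ne_zero.2 hp, ?_⟩
  have e : aeval (xF W) p - algebraMap L _ p.leadingCoeff * xF W ^ p.natDegree =
      aeval (xF W) p.eraseLead := by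
    rw [← self_sub_C_mul_X_pow]
    simp only [map_sub, map_mul, map_pow, aeval_X, aeval_C]
  rw [e]
  by_cases h0 : p.eraseLead = 0
  · rw [h0, _root_.map_zero, _root_.map_zero]; exact WithZero.exp_pos
  rw [ordInf_aeval h0, WithZero.exp_lt_exp]
  have := eraseLead_natDegree_lt_or_eraseLead_eq_zero p
  rcases this with h | h
  · omega
  · exact absurd h h0

/-- A regular function with a pole of order `m` at infinity is, up to a constant factor and lower
order terms, the monomial `x ^ i` or `x ^ i y` with a pole of this order. -/
lemma exists_ordInf_sub_monomial_lt {a : W.CoordinateRing} (ha : a ≠ 0) {m : ℤ}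
    (hm : ordInf W (algebraMap _ _ a) = WithZero.exp m) : ∃ c : L, c ≠ 0 ∧
      ordInf W (algebraMap _ _ a - algebraMap L _ c *
        (if Even m then xF W ^ (m / 2).toNat else xF W ^ ((m - 3) / 2).toNat * yF W)) <
      WithZero.exp m := by
  obtain ⟨p, q, e⟩ := exists_eq_add_mul_y a
  have hpq (p : L[X]) (hp : p ≠ 0) := exists_ordInf_aeval_sub_lt (W := W) hp
  have hvp (p : L[X]) (hp : p ≠ 0) := ordInf_aeval (W := W) hp
  have hvq (q : L[X]) (hq : q ≠ 0) : ordInf W (aeval (xF W) q * yF W) =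
      WithZero.exp (2 * q.natDegree + 3 : ℤ) := by
    rw [map_mul, ordInf_aeval hq, ordInf_yF, ← WithZero.exp_add]
  -- In both cases the dominant one of the terms `p(x)` and `q(x) y` is replaced by its leading
  -- term.
  have casep (hp : p ≠ 0) (hlt : ordInf W (aeval (xF W) q * yF W) < ordInf W (aeval (xF W) p)) :
      ∃ c : L, c ≠ 0 ∧ ordInf W (algebraMap _ _ a - algebraMap L _ c *
        (if Even m then xF W ^ (m / 2).toNat else xF W ^ ((m - 3) / 2).toNat * yF W)) <
      WithZero.exp m := by
    have hm' : m = 2 * p.natDegree := by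
      rw [e, Valuation.map_add_eq_of_lt_left _ hlt, hvp p hp, WithZero.exp_inj] at hm
      exact hm.symm
    obtain ⟨c, hc, hlc⟩ := hpq p hp
    refine ⟨c, hc, ?_⟩
    rw [if_pos (by rw [hm']; exact even_two_mul _)]
    have : (m / 2).toNat = p.natDegree := by omega
    rw [this, e, add_sub_right_comm, hm']
    rw [hvp p hp] at hlt
    exact (Valuation.map_add _ _ _).trans_lt (max_lt hlc hlt)
  have caseq (hq : q ≠ 0) (hlt : ordInf W (aeval (xF W) p) < ordInf W (aeval (xF W) q * yF W)) :
      ∃ c : L, c ≠ 0 ∧ ordInf W (algebraMap _ _ a - algebraMap L _ c *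
        (if Even m then xF W ^ (m / 2).toNat else xF W ^ ((m - 3) / 2).toNat * yF W)) <
      WithZero.exp m := by
    have hm' : m = 2 * q.natDegree + 3 := by
      rw [e, Valuation.map_add_eq_of_lt_right _ hlt, hvq q hq, WithZero.exp_inj] at hm
      exact hm.symm
    obtain ⟨c, hc, hlc⟩ := hpq q hq
    refine ⟨c, hc, ?_⟩
    rw [if_neg (by rw [hm', Int.not_even_iff_odd]; exact ⟨q.natDegree + 1, by ring⟩)]
    have : ((m - 3) / 2).toNat = q.natDegree := by omega
    rw [this, e, add_sub_assoc, hm', ← mul_assoc, ← sub_mul]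
    rw [hvq q hq] at hlt
    refine (Valuation.map_add _ _ _).trans_lt (max_lt hlt ?_)
    rw [map_mul, ordInf_yF, WithZero.exp_add]
    exact mul_lt_mul_of_pos_right hlc WithZero.exp_pos
  by_cases hp : p = 0
  · have hq : q ≠ 0 := by
      rintro rfl
      rw [hp] at e
      simp only [_root_.map_zero, zero_mul, add_zero] at e
      exact ha ((map_eq_zero_iff _ algebraMap_coordinateRing_injective).1 e)
    refine caseq hq ?_
    rw [hp, hvq q hq]
    simp
  by_cases hq : q = 0
  · refine casep hp ?_
    rw [hq, hvp p hp]
    simp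
  rcases lt_or_ge (2 * (p.natDegree : ℤ)) (2 * q.natDegree + 3) with h | h
  · exact caseq hq (by rw [hvp p hp, hvq q hq, WithZero.exp_lt_exp]; exact h)
  · exact casep hp (by rw [hvp p hp, hvq q hq, WithZero.exp_lt_exp]; omega)

/-- The residue field of the place at infinity is the constant field. -/
lemma exists_ordInf_sub_lt_one {z : W.FunctionField} (hz : ordInf W z ≤ 1) :
    ∃ c : L, ordInf W (z - algebraMap L _ c) < 1 := by
  rcases hz.lt_or_eq with h | h
  · exact ⟨0, by simpa using h⟩
  obtain ⟨a, b, hb, rfl⟩ := IsFractionRing.div_surjective (A := W.CoordinateRing) z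
  have hb0 : b ≠ 0 := nonZeroDivisors.ne_zero hb
  have hb1 : algebraMap _ W.FunctionField b ≠ 0 :=
    (map_ne_zero_iff _ algebraMap_coordinateRing_injective).2 hb0
  have ha0 : a ≠ 0 := by rintro rfl; simp at h
  have hv0 : ordInf W (algebraMap _ _ b) ≠ 0 := (ordInf W).ne_zero_iff.2 hb1
  rw [map_div₀, div_eq_one_iff_eq hv0] at h
  obtain ⟨c, hc, hac⟩ := exists_ordInf_sub_monomial_lt ha0 (h.trans (WithZero.exp_log hv0).symm)
  obtain ⟨d, hd, hbd⟩ := exists_ordInf_sub_monomial_lt hb0 (WithZero.exp_log hv0).symm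
  set u := (if Even (WithZero.log (ordInf W (algebraMap _ _ b))) then _ else _ : W.FunctionField)
  rw [WithZero.exp_log hv0] at hac hbd
  have hd' : algebraMap L W.FunctionField d ≠ 0 := (_root_.map_ne_zero _).2 hd
  refine ⟨c / d, ?_⟩
  have e : algebraMap _ _ a / algebraMap _ _ b - algebraMap L W.FunctionField (c / d) =
      ((algebraMap _ _ a - algebraMap L _ c * u) -
        algebraMap L _ (c / d) * (algebraMap _ _ b - algebraMap L _ d * u)) / algebraMap _ _ b := by
    rw [map_div₀]; field_simp; ring
  rw [e, map_div₀, div_lt_one₀ (zero_lt_iff.2 hv0)]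
  refine (Valuation.map_sub _ _ _).trans_lt (max_lt hac ?_)
  rw [map_mul, ordInf_const (div_ne_zero hc hd), one_mul]
  exact hbd

end Residue

section Invariant

variable {L : Type*} [Field L] {W : Affine L} [W.IsElliptic] [DecidableEq L]

open Affine CoordinateRing Point

variable (W) in
/-- The functions without poles outside `E[n]` that are invariant under translation by `E[n]`. -/
def invariants (n : ℕ) : Subalgebra L W.FunctionField where
  carrier := {z | z ∈ puncturedRing W ∧ (∀ P : W.Point, n • P ≠ 0 → ordAt P z ≤ 1) ∧
    ∀ S : W.Point, n • S = 0 → trans S z = z}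
  mul_mem' {z w} hz hw := ⟨mul_mem hz.1 hw.1, fun P hP => by
    rw [map_mul]; exact mul_le_one' (hz.2.1 P hP) (hw.2.1 P hP), fun S hS => by
    rw [map_mul, hz.2.2 S hS, hw.2.2 S hS]⟩
  add_mem' {z w} hz hw := ⟨add_mem hz.1 hw.1, fun P hP =>
    (Valuation.map_add _ _ _).trans (max_le (hz.2.1 P hP) (hw.2.1 P hP)), fun S hS => by
    rw [map_add, hz.2.2 S hS, hw.2.2 S hS]⟩
  algebraMap_mem' c := ⟨algebraMap_mem _ c, fun P _ => ordAt_const_le_one P c,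
    fun S _ => AlgHom.commutes _ c⟩

/-- If there is an invariant function `g` with a simple pole at `O`, then every invariant function
is a polynomial in `g`: its pole at `O` can be removed by subtracting powers of `g`. -/
lemma exists_eq_aeval {n : ℕ} {g : W.FunctionField} (hg : g ∈ invariants W n)
    (hv : ordInf W g = WithZero.exp 1) {z : W.FunctionField} (hz : z ∈ invariants W n) :
    ∃ p : L[X], z = aeval g p := by
  have hg0 : g ≠ 0 := by
    rintro rfl
    rw [_root_.map_zero] at hv
    exact WithZero.exp_ne_zero hv.symm
  have main (d : ℕ) : ∀ z ∈ invariants W n, ordInf W z ≤ WithZero.exp (d : ℤ) →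
      ∃ p : L[X], z = aeval g p := by
    induction d with
    | zero =>
      intro z hz hd
      obtain ⟨c, hc⟩ := exists_const_of_ordAt_le_one hz.1 fun P => by
        by_cases hP : n • P = 0
        · have : ordAt P z = ordInf W z := congrArg (ordInf W) (hz.2.2 P hP)
          rw [this]; simpa using hd
        · exact hz.2.1 P hP
      exact ⟨C c, by rw [hc, aeval_C]⟩
    | succ d ih =>
      intro z hz hd
      have hgd : ordInf W (g ^ (d + 1)) = WithZero.exp ((d : ℤ) + 1) := by
        rw [map_pow, hv, ← WithZero.exp_nsmul]
        congr 1; simp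
      have h0 : ordInf W (g ^ (d + 1)) ≠ 0 := by rw [hgd]; exact WithZero.exp_ne_zero
      obtain ⟨c, hc⟩ := exists_ordInf_sub_lt_one (z := z / g ^ (d + 1)) (by
        rw [map_div₀, div_le_one₀ (zero_lt_iff.2 h0), hgd]; exact_mod_cast hd)
      obtain ⟨p, hp⟩ := ih (z - algebraMap L _ c * g ^ (d + 1))
        (sub_mem hz (mul_mem (algebraMap_mem _ c) (pow_mem hg _))) (by
          have e : z - algebraMap L _ c * g ^ (d + 1) =
              (z / g ^ (d + 1) - algebraMap L _ c) * g ^ (d + 1) := by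
            rw [sub_mul, div_mul_cancel₀ _ (pow_ne_zero _ hg0)]
          rw [e, map_mul, hgd, WithZero.exp_add, mul_comm (WithZero.exp (d : ℤ)), ← mul_assoc]
          have h1 := mul_le_mul_left (le_exp_neg_one hc) (WithZero.exp (1 : ℤ))
          rw [← WithZero.exp_add, neg_add_cancel, WithZero.exp_zero] at h1
          exact mul_le_of_le_one_left' h1)
      refine ⟨p + C c * X ^ (d + 1), ?_⟩
      rw [map_add, ← hp, map_mul, map_pow, aeval_C, aeval_X]; ring
  by_cases h0 : z = 0
  · exact ⟨0, by simp [h0]⟩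
  refine main (WithZero.log (ordInf W z)).toNat z hz ?_
  rw [← WithZero.log_le_iff_le_exp ((ordInf W).ne_zero_iff.2 h0)]
  exact Int.self_le_toNat _

/-- If `g` has a simple pole at infinity, then a polynomial in `g` of degree `d` has a pole of order
`d`. -/
lemma ordInf_aeval_of_eq {g : W.FunctionField} (hv : ordInf W g = WithZero.exp 1) {p : L[X]}
    (hp : p ≠ 0) : ordInf W (aeval g p) = WithZero.exp (p.natDegree : ℤ) := by
  have key (d : ℕ) : ∀ p : L[X], p ≠ 0 → p.natDegree = d →
      ordInf W (aeval g p) = WithZero.exp (p.natDegree : ℤ) := by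
    induction d using Nat.strong_induction_on with
    | _ d ih =>
      intro p hp hd
      have e : aeval g p = aeval g p.eraseLead + algebraMap L _ p.leadingCoeff * g ^ d := by
        conv_lhs => rw [← eraseLead_add_C_mul_X_pow p]
        simp [hd]
      have hl : ordInf W (algebraMap L _ p.leadingCoeff * g ^ d) = WithZero.exp (d : ℤ) := by
        rw [map_mul, ordInf_const (leadingCoeff_ne_zero.2 hp), one_mul, map_pow, hv,
          ← WithZero.exp_nsmul]
        congr 1; simp
      rw [e, Valuation.map_add_eq_of_lt_right, hl, hd]
      rw [hl]
      by_cases h0 : p.eraseLead = 0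
      · rw [h0, _root_.map_zero, _root_.map_zero]; exact WithZero.exp_pos
      have hlt := (eraseLead_natDegree_lt_or_eraseLead_eq_zero p).resolve_right h0
      rw [ih _ (hd ▸ hlt) _ h0 rfl, WithZero.exp_lt_exp]
      omega
  exact key _ p hp rfl

end Invariant

section Genus

variable {L : Type*} [Field L] {W : Affine L} [W.IsElliptic]

open Affine

/-- An elliptic curve has no parametrisation by polynomials of degrees `2` and `3`: differentiating
the equation shows that one of the two partial derivatives divides the derivative of a
coordinate, which has a smaller degree. -/
lemma false_of_polynomial_point {p q : L[X]} (hp : p.natDegree = 2)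
    (h : q ^ 2 + C W.a₁ * p * q + C W.a₃ * q = p ^ 3 + C W.a₂ * p ^ 2 + C W.a₄ * p + C W.a₆) :
    False := by
  have hle1 (c d : L) : (C c * p + C d).natDegree ≤ 2 := by
    refine (natDegree_add_le _ _).trans (max_le ?_ (by simp))
    exact (natDegree_C_mul_le _ _).trans hp.le
  have hq : q.natDegree = 3 := by
    have hr : (p ^ 3 + C W.a₂ * p ^ 2 + C W.a₄ * p + C W.a₆).natDegree = 6 := by
      have e : p ^ 3 + C W.a₂ * p ^ 2 + C W.a₄ * p + C W.a₆ =
          (X ^ 3 + C W.a₂ * X ^ 2 + C W.a₄ * X + C W.a₆).comp p := by simp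
      have e3 : (X ^ 3 + C W.a₂ * X ^ 2 + C W.a₄ * X + C W.a₆).natDegree = 3 := by compute_degree!
      rw [e, natDegree_comp, e3, hp]
    have hl : q ^ 2 + C W.a₁ * p * q + C W.a₃ * q = q * (q + (C W.a₁ * p + C W.a₃)) := by ring
    rw [← h, hl] at hr
    rcases le_or_gt q.natDegree 2 with h2 | h2
    · have h3 := natDegree_mul_le (p := q) (q := q + (C W.a₁ * p + C W.a₃))
      have h4 := natDegree_add_le q (C W.a₁ * p + C W.a₃)
      have := hle1 W.a₁ W.a₃
      omega
    · have h3 : (q + (C W.a₁ * p + C W.a₃)).natDegree = q.natDegree :=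
        natDegree_add_eq_left_of_natDegree_lt ((hle1 _ _).trans_lt h2)
      have h4 : q ≠ 0 := by rintro rfl; simp at h2
      have h5 : q + (C W.a₁ * p + C W.a₃) ≠ 0 := by
        intro h0; rw [h0] at h3; simp at h3; omega
      rw [natDegree_mul h4 h5, h3] at hr
      omega
  set A := C 2 * q + (C W.a₁ * p + C W.a₃) with hA
  set B := C 3 * p ^ 2 + (C (2 * W.a₂) * p + C W.a₄ - C W.a₁ * q) with hB
  have hder : A * derivative q = B * derivative p := by
    have := congrArg derivative h
    simp only [derivative_add, derivative_mul, derivative_pow, derivative_C, Nat.cast_ofNat,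
      zero_mul, zero_add, add_zero] at this
    have c2 : (C 2 : L[X]) = 2 := rfl
    have c3 : (C 3 : L[X]) = 3 := rfl
    rw [hA, hB, C_mul, c2, c3]
    simp only [Nat.add_one_sub_one, pow_one, c2, c3] at this
    linear_combination this
  have hco : IsCoprime A B := by
    rw [isCoprime_iff_aeval_ne_zero_of_isAlgClosed L (AlgebraicClosure L)]
    intro r
    by_contra! hr
    have hE : (W⁄(AlgebraicClosure L)).Equation (aeval r p) (aeval r q) := by
      rw [equation_iff]
      have := congrArg (aeval r) h
      simp only [map_add, map_mul, map_pow, aeval_C] at this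
      exact this
    have hN := (equation_iff_nonsingular.1 hE).2
    simp only [hA, hB, map_add, map_sub, map_mul, map_pow, aeval_C, map_ofNat] at hr
    rw [evalEval_polynomialX, evalEval_polynomialY] at hN
    rcases hN with hN | hN
    · refine hN ?_
      change algebraMap L _ W.a₁ * aeval r q - (3 * aeval r p ^ 2 +
        2 * algebraMap L _ W.a₂ * aeval r p + algebraMap L _ W.a₄) = 0
      linear_combination -hr.2
    · refine hN ?_
      change 2 * aeval r q + algebraMap L _ W.a₁ * aeval r p + algebraMap L _ W.a₃ = 0
      linear_combination hr.1
  have hdp : (derivative p).natDegree ≤ 1 := (natDegree_derivative_le p).trans (by omega)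
  have hdq : (derivative q).natDegree ≤ 2 := (natDegree_derivative_le q).trans (by omega)
  -- `A` has degree `3 > deg p'` unless `2 = 0`, and then `B` has degree `4 > deg q'`.
  by_cases h2 : (2 : L) = 0
  · have h3 : (3 : L) ≠ 0 := by
      have : (3 : L) = 1 := by linear_combination h2
      rw [this]; exact one_ne_zero
    have hdvd : B ∣ derivative q := hco.symm.dvd_of_dvd_mul_left ⟨derivative p, hder⟩
    have hq0 : derivative q ≠ 0 := by
      intro h0
      have := congrArg (coeff · 2) h0
      simp only [coeff_derivative, coeff_zero] at this
      have hl : q.coeff 3 ≠ 0 := by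
        rw [← hq]; exact leadingCoeff_ne_zero.2 (by rintro rfl; simp at hq)
      rcases mul_eq_zero.1 this with h4 | h4
      · exact hl h4
      · refine h3 ?_
        norm_num at h4
        exact h4
    have hBd : B.natDegree = 4 := by
      have h4 : (C 3 * p ^ 2).natDegree = 4 := by
        rw [natDegree_C_mul h3, natDegree_pow, hp]
      rw [hB, natDegree_add_eq_left_of_natDegree_lt, h4]
      rw [h4]
      have h5 := natDegree_sub_le (C (2 * W.a₂) * p + C W.a₄) (C W.a₁ * q)
      have h6 := hle1 (2 * W.a₂) W.a₄
      have h7 := natDegree_C_mul_le W.a₁ q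
      omega
    have := natDegree_le_of_dvd hdvd hq0
    omega
  · have hdvd : A ∣ derivative p := hco.dvd_of_dvd_mul_left ⟨derivative q, hder.symm⟩
    have hp0 : derivative p ≠ 0 := by
      intro h0
      have := congrArg (coeff · 1) h0
      simp only [coeff_derivative, coeff_zero] at this
      have hl : p.coeff 2 ≠ 0 := by
        rw [← hp]; exact leadingCoeff_ne_zero.2 (by rintro rfl; simp at hp)
      rcases mul_eq_zero.1 this with h4 | h4
      · exact hl h4
      · refine h2 ?_
        norm_num at h4
        exact h4
    have hAd : A.natDegree = 3 := by
      have h4 : (C 2 * q).natDegree = 3 := by rw [natDegree_C_mul h2, hq]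
      rw [hA, natDegree_add_eq_left_of_natDegree_lt, h4]
      rw [h4]
      exact (hle1 _ _).trans_lt (by norm_num)
    have := natDegree_le_of_dvd hdvd hp0
    omega

/-- The ring `L[X]` is integrally closed, for monic quadratic equations. -/
lemma dvd_of_sq_add_mul_eq {s t u v : L[X]} (ht : t ≠ 0) (h : s ^ 2 + u * s * t = v * t ^ 2) :
    t ∣ s := by
  classical
  obtain ⟨s', hs⟩ := EuclideanDomain.gcd_dvd_left s t
  obtain ⟨t', ht'⟩ := EuclideanDomain.gcd_dvd_right s t
  have hb := EuclideanDomain.gcd_eq_gcd_ab s t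
  set d := EuclideanDomain.gcd s t
  have hd : d ≠ 0 := by intro h0; rw [h0, zero_mul] at ht'; exact ht ht'
  have hco : IsCoprime t' (s' ^ 2) := by
    refine IsCoprime.pow_right ⟨EuclideanDomain.gcdB s t, EuclideanDomain.gcdA s t, ?_⟩
    refine mul_left_cancel₀ hd ?_
    linear_combination -hb - EuclideanDomain.gcdB s t * ht' - EuclideanDomain.gcdA s t * hs
  have hdvd : t' ∣ s' ^ 2 * 1 := by
    refine ⟨v * t' - u * s', ?_⟩
    refine mul_left_cancel₀ (pow_ne_zero 2 hd) ?_
    rw [hs, ht'] at h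
    linear_combination h
  have hu : t' ∣ 1 := hco.dvd_of_dvd_mul_left hdvd
  obtain ⟨w, hw⟩ := hu
  refine ⟨w * s', ?_⟩
  linear_combination hs + d * s' * hw - w * s' * ht'

end Genus

section Nondegenerate

variable {L : Type*} [Field L] {W : Affine L} [W.IsElliptic] [DecidableEq L]

open Affine CoordinateRing Point

lemma prod_lin_inv_mem (l : List W.Point) : ((l.map lin).prod)⁻¹ ∈ puncturedRing W := by
  induction l with
  | nil => simp
  | cons P l ih =>
    rw [List.map_cons, List.prod_cons, mul_inv]
    exact mul_mem (lin_inv_mem P) ih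

variable [IsSepClosed L] {n : ℕ}

lemma natDegree_mulDen (hn : (n : L) ≠ 0) : (mulDen W n).natDegree = n ^ 2 - 1 := by
  obtain ⟨-, -, -, hd, hc⟩ := isMulPair_mul (W := W) n
  exact le_antisymm hd (le_natDegree_of_ne_zero (by rw [hc]; exact pow_ne_zero 2 hn))

lemma mulDen_ne_zero (hn : (n : L) ≠ 0) : mulDen W n ≠ 0 := by
  intro h0
  have := (isMulPair_mul (W := W) n).coeff_right
  rw [h0, coeff_zero] at this
  exact pow_ne_zero 2 hn this.symm

/-- The denominator of `x(nP)` is a product of functions `x - x(Q)` with `Q` in `E[n]`. -/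
lemma exists_mulDen_eq_prod_lin (hn : (n : L) ≠ 0) : ∃ (c : L) (l : List W.Point), c ≠ 0 ∧
    (∀ Q ∈ l, n • Q = 0) ∧ aeval (xF W) (mulDen W n) = algebraMap L _ c * (l.map lin).prod := by
  obtain ⟨hs, hr⟩ := exists_root_of_mulDen (W := W) hn
  have key (m : Multiset L) (hm : ∀ r ∈ m, (mulDen W n).eval r = 0) : ∃ l : List W.Point,
      (∀ Q ∈ l, n • Q = 0) ∧ aeval (xF W) (m.map fun r => X - C r).prod = (l.map lin).prod := by
    induction m using Multiset.induction_on with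
    | empty => exact ⟨[], by simp, by simp⟩
    | cons r m ih =>
      obtain ⟨l, hl, e⟩ := ih fun r h => hm r (Multiset.mem_cons_of_mem h)
      obtain ⟨y, h, hP⟩ := hr r (hm r (Multiset.mem_cons_self r m))
      refine ⟨.some r y h :: l, ?_, ?_⟩
      · intro Q hQ
        rcases List.mem_cons.1 hQ with rfl | hQ
        · exact hP
        · exact hl Q hQ
      · rw [Multiset.map_cons, Multiset.prod_cons, map_mul, e, List.map_cons, List.prod_cons,
          lin_some]
        simp
  obtain ⟨l, hl, e⟩ := key (mulDen W n).roots fun r h => (mem_roots'.1 h).2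
  refine ⟨(mulDen W n).leadingCoeff, l, leadingCoeff_ne_zero.2 (mulDen_ne_zero hn), hl, ?_⟩
  rw [← e]
  conv_lhs => rw [hs.eq_prod_roots]
  rw [map_mul, aeval_C]

/-- The function `x(nP)` has no poles outside `E[n]`, and a double pole at `O`. -/
lemma x_nsmul_mem_invariants (hn : (n : L) ≠ 0) {ξ η : W.FunctionField}
    {h : (W⁄W.FunctionField).Nonsingular ξ η} (e : n • genericPoint W = .some ξ η h)
    (hinv : ∀ S : W.Point, n • S = 0 → trans S ξ = ξ) :
    ξ ∈ invariants W n ∧ ordInf W ξ = WithZero.exp 2 := by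
  obtain ⟨c, l, hc, hl, hden⟩ := exists_mulDen_eq_prod_lin (W := W) hn
  have hx := aeval_mulNum_of_nsmul_eq _ e
  have hd0 : aeval (xF W) (mulDen W n) ≠ 0 := fun h0 => mulDen_ne_zero hn (aeval_xF_eq_zero.1 h0)
  have hξ : ξ = aeval (xF W) (mulNum W n) * (algebraMap L _ c⁻¹ * ((l.map lin).prod)⁻¹) := by
    rw [hx, map_inv₀, ← mul_inv, ← hden, mul_inv_cancel_right₀ hd0]
  refine ⟨⟨?_, fun P hP => ?_, hinv⟩, ?_⟩
  · rw [hξ, ← algebraMap_mk_C]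
    exact mul_mem (algebraMap_mem_puncturedRing _)
      (mul_mem (algebraMap_mem _ _) (prod_lin_inv_mem l))
  · have hP0 : P ≠ 0 := by rintro rfl; exact hP (nsmul_zero n)
    have h1 : ordAt P (l.map lin).prod = 1 := by
      rw [map_list_prod]
      refine List.prod_eq_one fun w hw => ?_
      simp only [List.map_map, List.mem_map, Function.comp_apply] at hw
      obtain ⟨Q, hQ, rfl⟩ := hw
      rw [ordAt_lin_of_ne_zero hP0, if_neg (by rintro rfl; exact hP (hl _ hQ)), if_neg]
      · simp
      · rintro rfl
        have := hl _ hQ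
        rw [_root_.smul_neg, neg_eq_zero] at this
        exact hP this
    rw [hξ, map_mul, map_mul, map_inv₀ (ordAt P), h1, inv_one, mul_one]
    exact mul_le_one' (ordAt_aeval_le_one (ordAt_xF_le_one hP0) _) (ordAt_const_le_one _ _)
  · obtain ⟨-, hm, hdeg, -, -⟩ := isMulPair_mul (W := W) n
    have hv := congrArg (ordInf W) hx
    have hn0 : 0 < n ^ 2 := by
      have : n ≠ 0 := by rintro rfl; simp at hn
      positivity
    have h0 : ξ ≠ 0 := by
      rintro rfl
      rw [zero_mul] at hx
      exact hm.ne_zero (aeval_xF_eq_zero.1 hx)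
    obtain ⟨m, hm'⟩ : ∃ m : ℤ, ordInf W ξ = WithZero.exp m :=
      ⟨_, (WithZero.exp_log ((ordInf W).ne_zero_iff.2 h0)).symm⟩
    rw [map_mul, hm', ordInf_aeval (mulDen_ne_zero hn), ordInf_aeval hm.ne_zero, hdeg,
      natDegree_mulDen hn, ← WithZero.exp_add, WithZero.exp_inj, Nat.cast_sub hn0] at hv
    rw [hm', WithZero.exp_inj]
    push_cast at hv
    linarith

/-- The coordinates of `nP` are invariant under translation by `n`-torsion points. -/
lemma trans_nsmul {S : W.Point} (hS : n • S = 0) {ξ η : W.FunctionField}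
    {h : (W⁄W.FunctionField).Nonsingular ξ η} (e : n • genericPoint W = .some ξ η h) :
    trans S ξ = ξ ∧ trans S η = η := by
  have : Point.map (W' := W) (trans S) (n • genericPoint W) = n • genericPoint W := by
    rw [map_nsmul, map_trans, nsmul_add, ← map_nsmul, hS, _root_.map_zero, add_zero]
  rw [e, map_some, some.injEq] at this
  exact this

/-- Every function invariant under `E[n]` is a quotient of functions in `invariants W n`: the
denominator can be replaced by the product of its translates. -/
lemma exists_mul_mem_invariants (hn : (n : L) ≠ 0) {z : W.FunctionField}
    (hz : ∀ S : W.Point, n • S = 0 → trans S z = z) :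
    ∃ t ∈ invariants W n, t ≠ 0 ∧ z * t ∈ invariants W n := by
  obtain ⟨a, b, hb, rfl⟩ := IsFractionRing.div_surjective (A := W.CoordinateRing) z
  set a' := algebraMap _ W.FunctionField a
  set b' := algebraMap _ W.FunctionField b with hb'
  have hb0 : b' ≠ 0 :=
    (map_ne_zero_iff _ algebraMap_coordinateRing_injective).2 (nonZeroDivisors.ne_zero hb)
  have hmem (s : Finset W.Point) : ∏ S ∈ s, trans S b' ∈ puncturedRing W :=
    prod_mem fun S _ => trans_mem S (algebraMap_mem_puncturedRing b)
  have hord (s : Finset W.Point) (hs : s ⊆ fib hn 0) {P : W.Point} (hP : n • P ≠ 0) :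
      ordAt P (∏ S ∈ s, trans S b') ≤ 1 := by
    rw [map_prod]
    refine Finset.prod_le_one' fun S hS => ?_
    rw [ordAt_trans]
    refine ordAt_algebraMap_le_one (fun h0 => hP ?_) b
    rw [← nsmul_zero n, ← h0, nsmul_add, mem_fib.1 (hs hS), add_zero]
  have hinv {R : W.Point} (hR : n • R = 0) :
      trans R (∏ S ∈ fib hn 0, trans S b') = ∏ S ∈ fib hn 0, trans S b' := by
    rw [map_prod]
    refine Finset.prod_bij (fun S _ => R + S) (fun S hS => ?_) (fun S _ S' _ h => add_left_cancel h)
      (fun S hS => ⟨S - R, ?_, by abel⟩) (fun S _ => trans_trans R S b')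
    · rw [mem_fib] at hS ⊢; rw [nsmul_add, hS, hR, add_zero]
    · rw [mem_fib] at hS ⊢; rw [nsmul_sub, hS, hR, sub_zero]
  have ht0 : ∏ S ∈ fib hn 0, trans S b' ≠ 0 :=
    Finset.prod_ne_zero_iff.2 fun S _ => (_root_.map_ne_zero _).2 hb0
  have hs : a' / b' * ∏ S ∈ fib hn 0, trans S b' = a' * ∏ S ∈ (fib hn 0).erase 0, trans S b' := by
    rw [← Finset.mul_prod_erase _ _ (mem_fib.2 (nsmul_zero n)), trans_zero, ← mul_assoc,
      div_mul_cancel₀ _ hb0]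
  refine ⟨∏ S ∈ fib hn 0, trans S b', ⟨hmem _, fun P hP => hord _ subset_rfl hP,
    fun R hR => hinv hR⟩, ht0, ?_, fun P hP => ?_, fun R hR => ?_⟩
  · rw [hs]; exact mul_mem (algebraMap_mem_puncturedRing a) (hmem _)
  · rw [hs, map_mul]
    exact mul_le_one' (ordAt_algebraMap_le_one (by rintro rfl; exact hP (nsmul_zero n)) a)
      (hord _ (Finset.erase_subset _ _) hP)
  · rw [map_mul, hz R hR, hinv hR]

/-- If `T ≠ 0` were in the kernel of the pairing, its Weil function `g` would generate the field of
functions invariant under `E[n]`, which contains the coordinates of `nP`. This is impossible, as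
this field has genus one. -/
theorem eq_zero_of_weilPairing_eq_one (hn : (n : L) ≠ 0) {T : W.Point} (hT : n • T = 0)
    (h : ∀ S : W.Point, n • S = 0 → weilPairing W n S T = 1) : T = 0 := by
  by_contra hT0
  obtain ⟨g, hg⟩ := exists_hasWeilDivisor hn hT
  have hgB : g ∈ invariants W n := by
    refine ⟨hg.mem, fun P hP => ?_, fun S hS => ?_⟩
    · rw [hg.ordAt_eq, weilOrd, if_neg hP, ← WithZero.exp_zero, WithZero.exp_le_exp]
      split_ifs <;> simp
    · rw [hg.trans_eq_weilPairing hn hS hT, h S hS, map_one, one_mul]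
  have hv : ordInf W g = WithZero.exp 1 := by
    rw [← ordAt_zero, hg.ordAt_eq, weilOrd, nsmul_zero, if_pos rfl, if_neg (Ne.symm hT0), sub_zero]
  have hinj {p q : L[X]} (hpq : aeval g p = aeval g q) : p = q := by
    by_contra hne
    have := ordInf_aeval_of_eq hv (sub_ne_zero.2 hne)
    rw [map_sub, hpq, sub_self, _root_.map_zero] at this
    exact WithZero.exp_ne_zero this.symm
  rcases e : n • genericPoint W with _ | ⟨ξ, η, hξη⟩
  · exact mulDen_ne_zero hn (aeval_xF_eq_zero.1 ((nsmul_some_eq_zero_iff _ n).1 e))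
  obtain ⟨hξ, hξv⟩ := x_nsmul_mem_invariants hn e fun S hS => (trans_nsmul hS e).1
  obtain ⟨t, ht, ht0, hs⟩ := exists_mul_mem_invariants hn (z := η) fun S hS =>
    (trans_nsmul hS e).2
  obtain ⟨p, hp⟩ := exists_eq_aeval hgB hv hξ
  obtain ⟨s', hs'⟩ := exists_eq_aeval hgB hv hs
  obtain ⟨t', ht'⟩ := exists_eq_aeval hgB hv ht
  have hp2 : p.natDegree = 2 := by
    have hp0 : p ≠ 0 := by
      rintro rfl
      rw [hp, _root_.map_zero, _root_.map_zero] at hξv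
      exact WithZero.exp_ne_zero hξv.symm
    rw [hp, ordInf_aeval_of_eq hv hp0, WithZero.exp_inj] at hξv
    exact_mod_cast hξv
  have hE := (equation_iff ..).1 hξη.1
  change η ^ 2 + algebraMap L _ W.a₁ * ξ * η + algebraMap L _ W.a₃ * η =
    ξ ^ 3 + algebraMap L _ W.a₂ * ξ ^ 2 + algebraMap L _ W.a₄ * ξ + algebraMap L _ W.a₆ at hE
  have ht'0 : t' ≠ 0 := by rintro rfl; rw [_root_.map_zero] at ht'; exact ht0 ht'
  obtain ⟨q, hq⟩ := dvd_of_sq_add_mul_eq ht'0 (s := s') (u := C W.a₁ * p + C W.a₃)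
    (v := p ^ 3 + C W.a₂ * p ^ 2 + C W.a₄ * p + C W.a₆) (by
      apply hinj
      simp only [map_add, map_mul, map_pow, aeval_C, ← hp, ← hs', ← ht']
      linear_combination t ^ 2 * hE)
  have hη : η = aeval g q := by
    rw [hq, map_mul, ← ht', mul_comm] at hs'
    exact mul_left_cancel₀ ht0 hs'
  refine false_of_polynomial_point (W := W) hp2 (q := q) ?_
  apply hinj
  simp only [map_add, map_mul, map_pow, aeval_C, ← hp, ← hη]
  exact hE

end Nondegenerate

/-! ### The kernel on cohomology -/

section ExactSequence

variable {K X L : Type*} [Field K] [Field L] [Algebra K L] [AddCommGroup X]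
  [DistribMulAction Gal(L/K) X] {n : ℕ}

lemma smul_del (σ : Gal(L/K)) (α : (Maps X L)ˣ) : σ • del X L α = del X L (σ • α) := by
  refine Units.ext (funext fun T => ?_)
  change σ (α.1 (σ⁻¹ • T.1) * α.1 (σ⁻¹ • T.2) / α.1 (σ⁻¹ • T.1 + σ⁻¹ • T.2)) =
    σ (α.1 (σ⁻¹ • T.1)) * σ (α.1 (σ⁻¹ • T.2)) / σ (α.1 (σ⁻¹ • (T.1 + T.2)))
  rw [_root_.map_div₀, map_mul, smul_add]

lemma mem_rootsOfUnity_iff_apply {α : (Maps X L)ˣ} :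
    α ∈ rootsOfUnity n (Maps X L) ↔ ∀ T, α.1 T ^ n = 1 := by
  rw [mem_rootsOfUnity, Units.ext_iff]
  exact funext_iff

lemma mem_Gam_iff {γ : (Maps X L)ˣ} :
    γ ∈ Gam K X L n ↔ γ ∈ rootsOfUnity n (Maps X L) ∧
      ∀ σ : Gal(L/K), σ • del X L γ = del X L γ := by
  rw [mem_rootsOfUnity_iff_apply]
  refine and_congr_right fun _ => forall_congr' fun σ => ⟨fun h => ?_, fun h T₁ T₂ => ?_⟩
  · refine Units.ext (funext fun T => ?_)
    have := h (σ⁻¹ • T.1) (σ⁻¹ • T.2)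
    rw [← smul_add, smul_inv_smul, smul_inv_smul, smul_inv_smul] at this
    rw [smul_add] at this
    exact this.symm
  · have : (σ • del X L γ).1 (σ • (T₁, T₂)) = (del X L γ).1 (σ • (T₁, T₂)) := by rw [h]
    rw [smul_units_apply, inv_smul_smul] at this
    rw [smul_add]
    exact this.symm

lemma mem_delMu_iff {ρ : (Maps (X × X) L)ˣ} :
    ρ ∈ delMu K X L n ↔ ∃ δ ∈ rootsOfUnity n (Maps X L), (∀ σ : Gal(L/K), σ • δ = δ) ∧
      del X L δ = ρ := by
  constructor
  · rintro ⟨_, ⟨r, hr, rfl⟩, rfl⟩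
    refine ⟨_, ?_, smul_map_units r, rfl⟩
    have hr' : r ^ n = 1 := hr
    rw [mem_rootsOfUnity, ← map_pow, hr', map_one]
  · rintro ⟨δ, hδ, hσ, rfl⟩
    refine ⟨δ, ⟨toEqUnits δ hσ, ?_, Units.ext rfl⟩, rfl⟩
    change _ ^ n = 1
    refine Units.ext (Subtype.ext ?_)
    exact congrArg Units.val hδ

/-- `(∂μ_n(R̄))^{G_K} = ∂Γ`. -/
lemma map_del_Gam : (Gam K X L n).map (del X L) = delMuBarInvariants K X L n := by
  ext ρ
  constructor
  · rintro ⟨γ, hγ, rfl⟩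
    obtain ⟨h1, h2⟩ := mem_Gam_iff.1 hγ
    exact ⟨⟨γ, h1, rfl⟩, h2⟩
  · rintro ⟨⟨γ, h1, rfl⟩, h2⟩
    exact ⟨γ, mem_Gam_iff.2 ⟨h1, h2⟩, rfl⟩

lemma delMu_le : delMu K X L n ≤ delMuBarInvariants K X L n := by
  intro ρ hρ
  obtain ⟨δ, h1, h2, rfl⟩ := mem_delMu_iff.1 hρ
  exact ⟨⟨δ, h1, rfl⟩, fun σ => by rw [smul_del, h2]⟩

variable (K X L n) in
/-- The surjection `Γ → (∂μ_n(R̄))^{G_K} / ∂μ_n(R)` induced by `∂`. -/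
def gamToQuotient : Additive (Gam K X L n) →+
    Additive (delMuBarInvariants K X L n ⧸
      (delMu K X L n).subgroupOf (delMuBarInvariants K X L n)) :=
  MonoidHom.toAdditive ((QuotientGroup.mk' _).comp
    (((del X L).comp (Gam K X L n).subtype).codRestrict (delMuBarInvariants K X L n) fun γ => by
      rw [← map_del_Gam]; exact ⟨γ, γ.2, rfl⟩))

lemma gamToQuotient_surjective : Function.Surjective (gamToQuotient K X L n) := by
  intro q
  obtain ⟨⟨ρ, hρ⟩, rfl⟩ := QuotientGroup.mk'_surjective _ q.toMul
  have hρ' := hρ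
  rw [← map_del_Gam] at hρ'
  obtain ⟨γ, hγ, rfl⟩ := hρ'
  exact ⟨Additive.ofMul ⟨γ, hγ⟩, rfl⟩

lemma gamToQuotient_eq_zero_iff (γ : Gam K X L n) :
    gamToQuotient K X L n (Additive.ofMul γ) = 0 ↔ del X L γ.1 ∈ delMu K X L n :=
  (QuotientGroup.eq_one_iff _).trans Subgroup.mem_subgroupOf

variable [TopologicalSpace X] [DiscreteTopology X] [Finite X]

instance : DiscreteTopology (Maps X L) := by
  let _ : TopologicalSpace L := ⊥
  have : DiscreteTopology L := ⟨rfl⟩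
  exact inferInstanceAs (DiscreteTopology (X → L))

variable (w : X →+[Gal(L/K)] MuBar X L n) (hinj : Function.Injective w)
  (hw : ∀ α : MuBar X L n, α ∈ Set.range w ↔ del X L α.toMul.1 = 1)

include hw in
lemma exists_eq_smul_div (γ : Gam K X L n) (σ : Gal(L/K)) :
    ∃ S, (w S).toMul.1 = σ • γ.1 / γ.1 := by
  obtain ⟨h1, h2⟩ := mem_Gam_iff.1 γ.2
  have h3 : σ • γ.1 / γ.1 ∈ rootsOfUnity n (Maps X L) := by
    rw [mem_rootsOfUnity] at h1 ⊢
    rw [div_pow, ← smul_pow', h1, smul_one, div_one]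
  obtain ⟨S, hS⟩ := (hw (Additive.ofMul ⟨_, h3⟩)).2 (by
    change del X L (σ • γ.1 / γ.1) = 1
    rw [_root_.map_div, ← smul_del, h2, div_self'])
  exact ⟨S, by rw [hS]; rfl⟩

variable [Algebra.IsIntegral K L] [SmoothAction K X L]

/-- For `γ ∈ Γ` the map `∂γ` is Galois invariant, so that `σγ/γ` lies in the kernel of `∂` on
`μ_n(R̄)`, which is the image of `w`; the cocycle attached to `γ` is `σ ↦ w⁻¹(σγ/γ)`. -/
def gamCocycle : Additive (Gam K X L n) →+ Z1 Gal(L/K) X where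
  toFun γ := ⟨fun σ => (exists_eq_smul_div w hw γ.toMul σ).choose, by
    have hs := fun σ => (exists_eq_smul_div w hw γ.toMul σ).choose_spec
    have hc : Continuous fun σ : Gal(L/K) => σ • γ.toMul.1 / γ.toMul.1 :=
      (continuous_orbit _).div' continuous_const
    have hl : IsLocallyConstant fun σ : Gal(L/K) => (σ • γ.toMul.1 / γ.toMul.1).1 :=
      IsLocallyConstant.iff_continuous _ |>.2 (Units.continuous_val.comp hc)
    refine IsLocallyConstant.continuous ((IsLocallyConstant.iff_eventually_eq _).2 fun σ => ?_)
    filter_upwards [(IsLocallyConstant.iff_eventually_eq _).1 hl σ] with τ hτ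
    refine hinj (Subtype.ext (Units.ext ?_))
    exact (congrArg Units.val (hs τ)).trans (hτ.trans (congrArg Units.val (hs σ)).symm), by
    have hs := fun σ => (exists_eq_smul_div w hw γ.toMul σ).choose_spec
    intro σ τ
    apply hinj
    rw [map_add, map_smul]
    refine Subtype.ext ((hs _).trans ?_)
    change _ = (w _).toMul.1 * σ • (w _).toMul.1
    rw [hs, hs, smul_div', mul_smul, mul_comm, div_mul_div_cancel]⟩
  map_zero' := by
    refine Subtype.ext (funext fun σ => hinj (Subtype.ext ?_))
    refine ((exists_eq_smul_div w hw _ σ).choose_spec).trans ?_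
    change σ • (1 : (Maps X L)ˣ) / 1 = (w 0).toMul.1
    rw [smul_one, div_one, map_zero]; rfl
  map_add' γ δ := by
    refine Subtype.ext (funext fun σ => hinj (Subtype.ext ?_))
    refine ((exists_eq_smul_div w hw _ σ).choose_spec).trans ?_
    change σ • (γ.toMul.1 * δ.toMul.1) / (γ.toMul.1 * δ.toMul.1) = (w (_ + _)).toMul.1
    rw [map_add]
    change _ = (w _).toMul.1 * (w _).toMul.1
    rw [(exists_eq_smul_div w hw γ.toMul σ).choose_spec,
      (exists_eq_smul_div w hw δ.toMul σ).choose_spec, smul_mul', mul_div_mul_comm]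

lemma gamCocycle_spec (γ : Gam K X L n) (σ : Gal(L/K)) :
    (w ((gamCocycle w hinj hw (Additive.ofMul γ)).1 σ)).toMul.1 = σ • γ.1 / γ.1 :=
  (exists_eq_smul_div w hw γ σ).choose_spec

lemma H1.map_mk_eq_zero_iff (c : Z1 Gal(L/K) X) :
    H1.map w continuous_of_discreteTopology (H1.mk _ _ c) = 0 ↔
      ∃ ζ ∈ rootsOfUnity n (Maps X L), ∀ σ : Gal(L/K), (w (c.1 σ)).toMul.1 = σ • ζ / ζ := by
  refine (QuotientAddGroup.eq_zero_iff _).trans ⟨?_, ?_⟩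
  · rintro ⟨ζ, hζ⟩
    exact ⟨ζ.toMul.1, ζ.toMul.2, fun σ => congrArg Subtype.val (hζ σ)⟩
  · rintro ⟨ζ, h, hζ⟩
    exact ⟨Additive.ofMul ⟨ζ, h⟩, fun σ => Subtype.ext (hζ σ)⟩

/-- The surjection `Γ → ker(H¹(K, X) → H¹(K, μ_n(R̄)))`. -/
def gamToKer : Additive (Gam K X L n) →+
    (H1.map w continuous_of_discreteTopology : H1 Gal(L/K) X →+ _).ker :=
  ((H1.mk _ _).comp (gamCocycle w hinj hw)).codRestrict _ fun γ =>
    (H1.map_mk_eq_zero_iff w _).2 ⟨γ.toMul.1, (mem_Gam_iff.1 γ.toMul.2).1,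
      gamCocycle_spec w hinj hw γ.toMul⟩

lemma gamToKer_surjective : Function.Surjective (gamToKer w hinj hw) := by
  rintro ⟨ξ, hξ⟩
  obtain ⟨c, rfl⟩ := QuotientAddGroup.mk'_surjective _ ξ
  obtain ⟨ζ, h1, h2⟩ := (H1.map_mk_eq_zero_iff w c).1 hξ
  have hγ : ζ ∈ Gam K X L n := mem_Gam_iff.2 ⟨h1, fun σ => by
    have := (hw _).1 ⟨c.1 σ, rfl⟩
    rwa [h2, _root_.map_div, ← smul_del, div_eq_one] at this⟩
  refine ⟨Additive.ofMul ⟨ζ, hγ⟩, Subtype.ext (congrArg (H1.mk _ _) (Subtype.ext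
    (funext fun σ => hinj (Subtype.ext ?_))))⟩
  exact (gamCocycle_spec w hinj hw ⟨ζ, hγ⟩ σ).trans (h2 σ).symm

/-- Both kernels consist of the products of an element of `μ_n(R)` and an element of the image
of `w`. -/
lemma ker_gamToKer : (gamToKer w hinj hw).ker = (gamToQuotient K X L n).ker := by
  ext γ
  obtain ⟨γ, rfl⟩ := Additive.ofMul.surjective γ
  rw [AddMonoidHom.mem_ker, AddMonoidHom.mem_ker, gamToQuotient_eq_zero_iff, mem_delMu_iff]
  have hγ := (mem_Gam_iff.1 γ.2).1
  refine (Subtype.ext_iff.trans (QuotientAddGroup.eq_zero_iff _)).trans ⟨?_, ?_⟩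
  · rintro ⟨S, hS⟩
    refine ⟨γ.1 / (w S).toMul.1, div_mem hγ (w S).toMul.2, fun σ => ?_, ?_⟩
    · have h := gamCocycle_spec w hinj hw γ σ
      have hS' : (gamCocycle w hinj hw (Additive.ofMul γ)).1 σ = σ • S - S := hS σ
      rw [hS', map_sub, map_smul] at h
      have h' : σ • (w S).toMul.1 / (w S).toMul.1 = σ • γ.1 / γ.1 := h
      rw [smul_div', div_eq_div_iff_mul_eq_mul]
      rw [div_eq_div_iff_mul_eq_mul] at h'
      rw [← h', mul_comm]
    · rw [_root_.map_div, (hw _).1 ⟨S, rfl⟩, div_one]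
  · rintro ⟨δ, hδ, hσ, e⟩
    obtain ⟨S, hS⟩ := (hw (Additive.ofMul ⟨γ.1 / δ, div_mem hγ hδ⟩)).2 (by
      change del X L (γ.1 / δ) = 1
      rw [_root_.map_div, e, div_self'])
    have hS' : (w S).toMul.1 = γ.1 / δ := by rw [hS]; rfl
    refine ⟨S, fun σ => hinj (Subtype.ext ((gamCocycle_spec w hinj hw γ σ).trans ?_))⟩
    rw [map_sub, map_smul]
    change _ = σ • (w S).toMul.1 / (w S).toMul.1
    rw [hS', smul_div', hσ, div_div_div_cancel_right]

/-- The kernel of `H¹(K, X) → H¹(K, μ_n(R̄))` for an equivariant isomorphism `w` of `X` with the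
kernel of `∂` on `μ_n(R̄)`. -/
def kerMapEquiv : (H1.map w continuous_of_discreteTopology : H1 Gal(L/K) X →+ _).ker ≃+
    Additive (delMuBarInvariants K X L n ⧸
      (delMu K X L n).subgroupOf (delMuBarInvariants K X L n)) :=
  isoOfKerEq (C := Additive (delMuBarInvariants K X L n ⧸
      (delMu K X L n).subgroupOf (delMuBarInvariants K X L n)))
    (gamToKer w hinj hw) (gamToQuotient K X L n) (gamToKer_surjective w hinj hw)
    gamToQuotient_surjective (ker_gamToKer w hinj hw)

end ExactSequence

/-! ### The Weil pairing as a homomorphism to `μ_n(R̄)` -/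

section Duality

/-- A bimultiplicative pairing on a finite abelian group with values in a group of sufficiently many
roots of unity which is nondegenerate on the right
identifies the group with its dual. -/
lemma bijective_of_pairing {G M : Type*} [CommGroup G] [Finite G] [CommMonoid M]
    [HasEnoughRootsOfUnity M (Monoid.exponent G)] (B : G →* G →* Mˣ)
    (hB : ∀ T, (∀ S, B S T = 1) → T = 1) : Function.Bijective B := by
  have hcard := CommGroup.card_monoidHom_of_hasEnoughRootsOfUnity G M
  have : Finite (G →* Mˣ) := Nat.finite_of_card_ne_zero (hcard ▸ Nat.card_pos.ne')
  have hflip : Function.Bijective B.flip := by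
    refine (Nat.bijective_iff_injective_and_card _).2 ⟨?_, hcard.symm⟩
    refine (injective_iff_map_eq_one _).2 fun T hT => hB T fun S => ?_
    exact DFunLike.congr_fun hT S
  refine (Nat.bijective_iff_injective_and_card _).2 ⟨?_, hcard.symm⟩
  refine (injective_iff_map_eq_one _).2 fun S hS => ?_
  by_contra hS1
  obtain ⟨φ, hφ⟩ := CommGroup.exists_apply_ne_one_of_hasEnoughRootsOfUnity G M hS1
  obtain ⟨T, rfl⟩ := hflip.2 φ
  exact hφ (DFunLike.congr_fun hS T)

end Duality

section WeilHom

open Affine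

variable {K L : Type*} [Field K] [Field L] [Algebra K L] [DecidableEq L] [IsSepClosed L]
  {E : Affine K} [E.IsElliptic] {n : ℕ}

lemma tors_nsmul_eq_zero (T : Tors E L n) : n • T.1 = 0 :=
  AddSubgroup.torsionBy.nsmul_iff.1 T.2

lemma finite_tors (hn : (n : L) ≠ 0) : Finite (Tors E L n) := by
  have hn0 : n ≠ 0 := by rintro rfl; simp at hn
  have h : Nat.card {P : (E⁄L).Point // n • P = 0} ≠ 0 := by
    rw [card_nsmul_eq hn]; positivity
  have := Nat.finite_of_card_ne_zero h
  exact Finite.of_injective (fun T : Tors E L n =>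
    (⟨T.1, (tors_nsmul_eq_zero T)⟩ : {P : (E⁄L).Point // n • P = 0}))
    fun S T h => Subtype.ext (congrArg Subtype.val h)

/-- The function `T ↦ e_n(S, T)` as an element of `μ_n(R̄)`. -/
def weilElement (hn : (n : L) ≠ 0) (S : Tors E L n) : MuBar (Tors E L n) L n :=
  Additive.ofMul ⟨Maps.mkUnit (fun T => weilPairing (E⁄L) n S.1 T.1) fun T h => by
      have hn0 : n ≠ 0 := by rintro rfl; simp at hn
      have := weilPairing_pow hn (tors_nsmul_eq_zero S) (tors_nsmul_eq_zero T)
      rw [h, zero_pow hn0] at this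
      exact zero_ne_one this,
    mem_rootsOfUnity_iff_apply.2 fun T =>
      weilPairing_pow hn (tors_nsmul_eq_zero S) (tors_nsmul_eq_zero T)⟩

/-- The homomorphism `w : E[n] → μ_n(R̄)` with `w(S)(T) = e_n(S, T)`. -/
def weilHom (hn : (n : L) ≠ 0) : Tors E L n →+[Gal(L/K)] MuBar (Tors E L n) L n where
  toFun := weilElement hn
  map_smul' σ S := by
    refine Subtype.ext (Units.ext (funext fun T => ?_))
    change weilPairing (E⁄L) n (σ • S.1) T.1 = σ (weilPairing (E⁄L) n S.1 (σ⁻¹ • T).1)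
    rw [← weilPairing_smul hn σ (tors_nsmul_eq_zero S) (tors_nsmul_eq_zero (σ⁻¹ • T))]
    change _ = weilPairing (E⁄L) n (σ • S.1) (σ • (σ⁻¹ • T.1))
    rw [smul_inv_smul]
  map_zero' := Subtype.ext (Units.ext (funext fun T =>
    weilPairing_zero_left hn (tors_nsmul_eq_zero T)))
  map_add' S S' := Subtype.ext (Units.ext (funext fun T =>
    weilPairing_add_left hn (tors_nsmul_eq_zero S) (tors_nsmul_eq_zero S') (tors_nsmul_eq_zero T)))

lemma weilHom_apply (hn : (n : L) ≠ 0) (S T : Tors E L n) :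
    (weilHom (E := E) hn S).toMul.1.1 T = weilPairing (E⁄L) n S.1 T.1 := rfl

/-- The kernel of `∂` consists of the homomorphisms. -/
lemma del_eq_one_iff {X L : Type*} [Field L] [AddCommGroup X] {α : (Maps X L)ˣ} :
    del X L α = 1 ↔ ∀ S T, α.1 (S + T) = α.1 S * α.1 T := by
  rw [Units.ext_iff]
  refine funext_iff.trans ⟨fun h S T => ?_, fun h T => ?_⟩
  · have : α.1 S * α.1 T / α.1 (S + T) = 1 := h (S, T)
    rw [div_eq_one_iff_eq (unit_apply_ne_zero _ _)] at this
    exact this.symm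
  · change α.1 T.1 * α.1 T.2 / α.1 (T.1 + T.2) = 1
    rw [div_eq_one_iff_eq (unit_apply_ne_zero _ _), h]

lemma del_weilHom (hn : (n : L) ≠ 0) (S : Tors E L n) :
    del _ L (weilHom (E := E) hn S).toMul.1 = 1 :=
  del_eq_one_iff.2 fun T T' =>
    weilPairing_add_right hn (tors_nsmul_eq_zero S) (tors_nsmul_eq_zero T) (tors_nsmul_eq_zero T')

/-- An element of the kernel of `∂` as a character. -/
def characterOfDel {X L : Type*} [Field L] [AddCommGroup X] (α : (Maps X L)ˣ)
    (h : del X L α = 1) : Multiplicative X →* Lˣ where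
  toFun T := Units.mk0 (α.1 T.toAdd) (unit_apply_ne_zero _ _)
  map_one' := by
    have := del_eq_one_iff.1 h 0 0
    rw [add_zero, left_eq_mul₀ (unit_apply_ne_zero _ _)] at this
    exact Units.ext this
  map_mul' S T := Units.ext (del_eq_one_iff.1 h S.toAdd T.toAdd)

/-- The Weil pairing as a pairing of `E[n]` with itself. -/
def weilPairingHom (hn : (n : L) ≠ 0) :
    Multiplicative (Tors E L n) →* Multiplicative (Tors E L n) →* Lˣ where
  toFun S := characterOfDel _ (del_weilHom hn S.toAdd)
  map_one' := MonoidHom.ext fun T => Units.ext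
    (weilPairing_zero_left hn (tors_nsmul_eq_zero T.toAdd))
  map_mul' S S' := MonoidHom.ext fun T => Units.ext
    (weilPairing_add_left hn (tors_nsmul_eq_zero S.toAdd) (tors_nsmul_eq_zero S'.toAdd)
      (tors_nsmul_eq_zero T.toAdd))

/-- Nondegeneracy of the Weil pairing. -/
theorem weilPairingHom_bijective (hn : (n : L) ≠ 0) :
    Function.Bijective (weilPairingHom (E := E) hn) := by
  have := finite_tors (E := E) hn
  have : NeZero (n : L) := ⟨hn⟩
  have hroots : HasEnoughRootsOfUnity L n := inferInstance
  have : HasEnoughRootsOfUnity L (Monoid.exponent (Multiplicative (Tors E L n))) := by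
    have : NeZero n := NeZero.of_neZero_natCast L
    refine hroots.of_dvd L (Monoid.exponent_dvd_of_forall_pow_eq_one fun S => ?_)
    exact Subtype.ext (tors_nsmul_eq_zero S.toAdd)
  refine bijective_of_pairing _ fun T hT => ?_
  refine Subtype.ext (eq_zero_of_weilPairing_eq_one (W := E⁄L) hn (tors_nsmul_eq_zero T.toAdd)
    fun S hS => ?_)
  exact congrArg Units.val (hT (Multiplicative.ofAdd ⟨S, AddSubgroup.torsionBy.nsmul_iff.2 hS⟩))

theorem weilHom_injective (hn : (n : L) ≠ 0) : Function.Injective (weilHom (E := E) hn) := by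
  intro S S' h
  refine Multiplicative.ofAdd.injective ((weilPairingHom_bijective hn).1 (MonoidHom.ext fun T =>
    Units.ext ?_))
  exact congrFun (congrArg (fun α : MuBar (Tors E L n) L n => α.toMul.1.1) h) T.toAdd

/-- The image of `w` is the kernel of `∂` on `μ_n(R̄)`. -/
theorem mem_range_weilHom_iff (hn : (n : L) ≠ 0) (α : MuBar (Tors E L n) L n) :
    α ∈ Set.range (weilHom (E := E) hn) ↔ del (Tors E L n) L α.toMul.1 = 1 := by
  constructor
  · rintro ⟨S, rfl⟩
    exact del_weilHom hn S
  · intro h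
    obtain ⟨S, hS⟩ := (weilPairingHom_bijective hn).2 (characterOfDel _ h)
    refine ⟨S.toAdd, Subtype.ext (Units.ext (funext fun T => ?_))⟩
    exact congrArg Units.val (DFunLike.congr_fun hS (Multiplicative.ofAdd T))

end WeilHom

section Kernel

variable {K L : Type*} [Field K] [Field L] [Algebra K L] [DecidableEq L] [IsSepClosure K L]
  {E : Affine K} {n : ℕ}

lemma ker_w1 (hn : (n : K) ≠ 0) (w : Tors E L n →+[Gal(L/K)] MuBar (Tors E L n) L n) :
    (w1 hn w).ker = (H1.map w continuous_of_discreteTopology).ker := by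
  ext ξ
  rw [AddMonoidHom.mem_ker, AddMonoidHom.mem_ker]
  exact AddEquiv.map_eq_zero_iff (kummerIso K (Tors E L n) L n fun h => hn
    ((algebraMap K L).injective (by rw [map_natCast, _root_.map_zero, h])))

end Kernel

end Descent

end

theorem mainTheorem7 {K : Type*} [Field K] {Kbar : Type*} [Field Kbar] [Algebra K Kbar]
    [IsSepClosure K Kbar] [DecidableEq Kbar] (E : WeierstrassCurve.Affine K) [E.IsElliptic]
    (n : ℕ) (hn : 2 ≤ n) (hnK : (n : K) ≠ 0) :
    ∃ w : Descent.Tors E Kbar n →+[Gal(Kbar/K)] Descent.MuBar (Descent.Tors E Kbar n) Kbar n,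
      (∀ S T : Descent.Tors E Kbar n, (w S).toMul.1.1 T = Descent.weilPairing (WeierstrassCurve.baseChange E Kbar) n S T) ∧
      Descent.delMuBarInvariants K (Descent.Tors E Kbar n) Kbar n =
        (Descent.Gam K (Descent.Tors E Kbar n) Kbar n).map (Descent.del (Descent.Tors E Kbar n) Kbar) ∧
      Descent.delMu K (Descent.Tors E Kbar n) Kbar n ≤ Descent.delMuBarInvariants K (Descent.Tors E Kbar n) Kbar n ∧
      Nonempty ((Descent.w1 hnK w).ker ≃+
        Additive (Descent.delMuBarInvariants K (Descent.Tors E Kbar n) Kbar n ⧸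
          (Descent.delMu K (Descent.Tors E Kbar n) Kbar n).subgroupOf
            (Descent.delMuBarInvariants K (Descent.Tors E Kbar n) Kbar n))) ∧
      (Function.Injective (Descent.w1 hnK w) ↔
        (Descent.Gam K (Descent.Tors E Kbar n) Kbar n).map (Descent.del (Descent.Tors E Kbar n) Kbar) =
          Descent.delMu K (Descent.Tors E Kbar n) Kbar n) := by
  have : IsSepClosed Kbar := IsSepClosure.sep_closed K
  have hnL : (n : Kbar) ≠ 0 := fun h => hnK ((algebraMap K Kbar).injective (by
    rw [map_natCast, map_zero, h]))
  have := Descent.finite_tors (E := E) hnL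
  let w := Descent.weilHom (E := E) hnL
  let e := (AddEquiv.addSubgroupCongr (Descent.ker_w1 hnK w)).trans
    (Descent.kerMapEquiv w (Descent.weilHom_injective hnL) (Descent.mem_range_weilHom_iff hnL))
  refine ⟨w, Descent.weilHom_apply hnL, Descent.map_del_Gam.symm, Descent.delMu_le, ⟨e⟩, ?_⟩
  have hbot : (Descent.w1 hnK w).ker = ⊥ ↔ Subsingleton (Descent.w1 hnK w).ker :=
    ⟨fun h => h ▸ inferInstance, fun h => AddSubgroup.eq_bot_of_subsingleton _⟩
  rw [← AddMonoidHom.ker_eq_bot_iff, hbot, e.toEquiv.subsingleton_congr, Descent.map_del_Gam]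
  refine QuotientGroup.subsingleton_iff.trans (Subgroup.subgroupOf_eq_top.trans ?_)
  exact ⟨fun h => le_antisymm h Descent.delMu_le, fun h => h.le⟩
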